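/- Let $n \ge 1$ and $p \in [0,1)$. Let $\mathcal K^n_s$ be the set of convex bodies $K \subset \mathbb R^n$ (compact convex sets with nonempty interior) that are centrally symmetric, $K = -K$. For $K, L \in \mathcal K^n_s$ let $h_K(u) = \max_{y \in K} \langle u, y\rangle$ be the support function, let $V(L[j], K[n-j])$, $0 \le j \le n$, be the mixed volumes, defined by $\mathrm{vol}(K + tL) = \sum_{j=0}^n \binom nj V(L[j], K[n-j])\, t^j$ for $t \ge 0$, and let $S_K$ be the surface area measure, $S_K(\omega) = \mathcal H^{n-1}(\nu_K^{-1}(\omega))$ for Borel $\omega \subset S^{n-1}$, where $\nu_K$ is the ($\mathcal H^{n-1}$-almost everywhere defined) Gauss map sending a point of $\partial K$ to its unique outer unit normal. For $\lambda \in [0,1]$ the $L^p$-combination is $$(1-\lambda) K +_p \lambda L = \bigcap_{u \in S^{n-1}} \{x \in \mathbb R^n : \langle x, u\rangle \le h_\lambda(u)\},$$ where $h_\lambda = \left((1-\lambda) h_K^p + \lambda h_L^p\right)^{1/p}$ if $p > 0$ and $h_\lambda = h_K^{1-\lambda} h_L^{\lambda}$ if $p = 0$. A convex polytope is a convex body that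 is the intersection of finitely many half-spaces; two polytopes $P, Q$ are strongly isomorphic if $\dim F(P,u) = \dim F(Q,u)$ for all $u \in S^{n-1}$, where $F(P,u) = \{x \in P : \langle x, u\rangle = h_P(u)\}$. **Proposition.** Assume that the local $L^p$-Brunn-Minkowski conjecture holds in dimension $n$ for the given $p$, that is, for all $K, L \in \mathcal K^n_s$, $$\mathrm{vol}(K) \left( n(n-1)\, V(L[2], K[n-2]) + (1-p) \int_{S^{n-1}} \frac{h_L^2}{h_K}\, dS_K \right) - n(n-p)\, V(L[1], K[n-1])^2 \le 0$$ (for $n = 1$ the term with the factor $n - 1$ is $0$). Then for any two strongly isomorphic polytopes $K, L \in \mathcal K^n_s$, the function $f(\lambda) = \mathrm{vol}((1-\lambda) K +_p \lambda L)$ is positive and $\frac pn$-concave on $[0,1]$: $f^{p/n}$ is concave on $[0,1]$ if $p > 0$, and $\log f$ is concave on $[0,1]$ if $p = 0$. -/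

import Mathlib

open MeasureTheory Set
open scoped Pointwise RealInnerProductSpace Polynomial

noncomputable section

namespace LpBrunnMinkowski

/-- Convex bodies: compact convex sets with nonempty interior. -/
structure IsConvexBody {n : ℕ} (K : Set (EuclideanSpace ℝ (Fin n))) : Prop where
  convex : Convex ℝ K
  isCompact : IsCompact K
  nonempty_interior : (interior K).Nonempty

/-- Centrally symmetric convex bodies: convex bodies `K` with `K = -K`. -/
structure IsSymmConvexBody {n : ℕ} (K : Set (EuclideanSpace ℝ (Fin n))) : Prop
    extends IsConvexBody K where
  symm : -K = K

/-- The support function `h_K(u) = max {⟨y, u⟩ : y ∈ K}`; the supremum is attained when `K` is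
compact and nonempty. -/
def supportFn {n : ℕ} (K : Set (EuclideanSpace ℝ (Fin n))) (u : EuclideanSpace ℝ (Fin n)) : ℝ :=
  sSup ((fun y => ⟪y, u⟫) '' K)

/-- The Wulff shape `A[h]`, the intersection of the half-spaces `{x : ⟨x, u⟩ ≤ h u}` over all unit
vectors `u`. -/
def wulffShape {n : ℕ} (h : EuclideanSpace ℝ (Fin n) → ℝ) : Set (EuclideanSpace ℝ (Fin n)) :=
  {x | ∀ u : EuclideanSpace ℝ (Fin n), ‖u‖ = 1 → ⟪x, u⟫ ≤ h u}

/-- The weighted power mean `(1 - t) a +_p t b` of two positive reals, which is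
`((1 - t) a ^ p + t b ^ p) ^ (1 / p)` for `p ≠ 0` and the geometric mean `a ^ (1 - t) b ^ t`
for `p = 0`. -/
def lpMean (p t a b : ℝ) : ℝ :=
  if p = 0 then a ^ (1 - t) * b ^ t else ((1 - t) * a ^ p + t * b ^ p) ^ (1 / p)

/-- The `L^p`-Minkowski combination `(1 - t) K +_p t L`. -/
def lpComb {n : ℕ} (p t : ℝ) (K L : Set (EuclideanSpace ℝ (Fin n))) :
    Set (EuclideanSpace ℝ (Fin n)) :=
  wulffShape fun u => lpMean p t (supportFn K u) (supportFn L u)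

/-- The polynomial `q` with `vol (K + t L) = q(t)` for all `t ≥ 0`. By a theorem of Minkowski it
exists for convex bodies; it is unique because it is prescribed on a half-line. -/
def volumePoly {n : ℕ} (K L : Set (EuclideanSpace ℝ (Fin n))) : ℝ[X] :=
  open Classical in
  if h : ∃ q : ℝ[X], ∀ t : ℝ, 0 ≤ t → volume.real (K + t • L) = q.eval t then h.choose else 0

/-- The mixed volume `V(K[n - j], L[j])`, `0 ≤ j ≤ n`, defined by
`vol (K + t L) = ∑ j, (n choose j) V(K[n - j], L[j]) t ^ j`. -/
def mixedVolume {n : ℕ} (K L : Set (EuclideanSpace ℝ (Fin n))) (j : ℕ) : ℝ :=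
  (volumePoly K L).coeff j / (n.choose j : ℝ)

/-- The mixed volumes are the normalized coefficients of any polynomial representing
`vol (K + t L)`, `t ≥ 0`. -/
theorem mixedVolume_eq {n : ℕ} {K L : Set (EuclideanSpace ℝ (Fin n))} {q : ℝ[X]}
    (hq : ∀ t : ℝ, 0 ≤ t → volume.real (K + t • L) = q.eval t) (j : ℕ) :
    mixedVolume K L j = q.coeff j / (n.choose j : ℝ) := by
  have h : ∃ q : ℝ[X], ∀ t : ℝ, 0 ≤ t → volume.real (K + t • L) = q.eval t := ⟨q, hq⟩
  have he : volumePoly K L = q := by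
    unfold volumePoly
    rw [dif_pos h]
    refine Polynomial.eq_of_infinite_eval_eq _ _ ((Ici_infinite (0 : ℝ)).mono fun t ht => ?_)
    exact (h.choose_spec t ht).symm.trans (hq t ht)
  rw [mixedVolume, he]

/-- `u` is a unit outer normal vector to `K` at the point `x` of `K`. -/
def IsUnitNormal {n : ℕ} (K : Set (EuclideanSpace ℝ (Fin n))) (x u : EuclideanSpace ℝ (Fin n)) :
    Prop :=
  ‖u‖ = 1 ∧ supportFn K u = ⟪x, u⟫

/-- The boundary points of `K` at which there is exactly one unit normal. -/
def regularBoundary {n : ℕ} (K : Set (EuclideanSpace ℝ (Fin n))) :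
    Set (EuclideanSpace ℝ (Fin n)) :=
  {x | x ∈ frontier K ∧ ∃! u, IsUnitNormal K x u}

/-- The Gauss map `ν_K`, sending a point with exactly one unit normal to that normal; the value
elsewhere is immaterial. -/
def gaussMap {n : ℕ} (K : Set (EuclideanSpace ℝ (Fin n))) (x : EuclideanSpace ℝ (Fin n)) :
    EuclideanSpace ℝ (Fin n) :=
  open Classical in
  if h : ∃! u, IsUnitNormal K x u then h.choose else 0

theorem continuous_supportFn {n : ℕ} {K : Set (EuclideanSpace ℝ (Fin n))} (hK : IsCompact K) :
    Continuous (supportFn K) := by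
  have h := hK.continuous_sSup (f := fun u y : EuclideanSpace ℝ (Fin n) => ⟪y, u⟫)
    (by dsimp only [Function.HasUncurry.uncurry, id]; fun_prop)
  exact h

theorem gaussMap_eq {n : ℕ} {K : Set (EuclideanSpace ℝ (Fin n))} {x u : EuclideanSpace ℝ (Fin n)}
    (h : ∃! u, IsUnitNormal K x u) (hu : IsUnitNormal K x u) : gaussMap K x = u := by
  unfold gaussMap
  rw [dif_pos h]
  exact h.unique h.choose_spec.1 hu

/-- The Gauss map of a compact set is Borel measurable, so that the push-forward below is the
genuine one. -/
theorem measurable_gaussMap {n : ℕ} {K : Set (EuclideanSpace ℝ (Fin n))} (hK : IsCompact K) :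
    Measurable (gaussMap K) := by
  have hc := continuous_supportFn hK
  let S := Metric.sphere (0 : EuclideanSpace ℝ (Fin n)) 1
  have : CompactSpace S := isCompact_iff_compactSpace.mp (isCompact_sphere _ _)
  have hmem : ∀ u : EuclideanSpace ℝ (Fin n), u ∈ S ↔ ‖u‖ = 1 := fun u => by simp [S]
  have hA : ∀ C : Set (EuclideanSpace ℝ (Fin n)), IsClosed C →
      IsClosed {x | ∃ u ∈ C, IsUnitNormal K x u} := by
    intro C hC
    have h1 : IsClosed {q : EuclideanSpace ℝ (Fin n) × S |
        (q.2 : EuclideanSpace ℝ (Fin n)) ∈ C ∧ supportFn K q.2 = ⟪q.1, (q.2 : _)⟫} :=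
      (hC.preimage (by fun_prop)).inter (isClosed_eq (by fun_prop) (by fun_prop))
    convert isClosedMap_fst_of_compactSpace _ h1 using 1
    ext x
    constructor
    · rintro ⟨u, huC, hu1, hu2⟩
      exact ⟨(x, ⟨u, (hmem u).2 hu1⟩), ⟨huC, hu2⟩, rfl⟩
    · rintro ⟨⟨y, u⟩, ⟨h2, h3⟩, rfl⟩
      exact ⟨u, h2, (hmem _).1 u.2, h3⟩
  have hB : ∀ k : ℕ, IsClosed {x | ∃ u v, IsUnitNormal K x u ∧ IsUnitNormal K x v ∧
      1 / ((k : ℝ) + 1) ≤ dist u v} := by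
    intro k
    have h1 : IsClosed {q : EuclideanSpace ℝ (Fin n) × (S × S) |
        supportFn K q.2.1 = ⟪q.1, (q.2.1 : _)⟫ ∧ supportFn K q.2.2 = ⟪q.1, (q.2.2 : _)⟫ ∧
        1 / ((k : ℝ) + 1) ≤ dist (q.2.1 : EuclideanSpace ℝ (Fin n)) q.2.2} :=
      (isClosed_eq (by fun_prop) (by fun_prop)).inter
        ((isClosed_eq (by fun_prop) (by fun_prop)).inter
          (isClosed_le (f := fun _ => 1 / ((k : ℝ) + 1))
            (g := fun q : EuclideanSpace ℝ (Fin n) × (S × S) =>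
              dist (q.2.1 : EuclideanSpace ℝ (Fin n)) q.2.2) continuous_const (by fun_prop)))
    convert isClosedMap_fst_of_compactSpace _ h1 using 1
    ext x
    constructor
    · rintro ⟨u, v, ⟨hu1, hu2⟩, ⟨hv1, hv2⟩, hd⟩
      exact ⟨(x, (⟨u, (hmem u).2 hu1⟩, ⟨v, (hmem v).2 hv1⟩)), ⟨hu2, hv2, hd⟩, rfl⟩
    · rintro ⟨⟨y, u, v⟩, ⟨h2, h3, h4⟩, rfl⟩
      exact ⟨u, v, ⟨(hmem _).1 u.2, h2⟩, ⟨(hmem _).1 v.2, h3⟩, h4⟩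
  have hR : MeasurableSet {x | ∃! u, IsUnitNormal K x u} := by
    convert ((hA univ isClosed_univ).measurableSet).diff
      (MeasurableSet.iUnion fun k => (hB k).measurableSet) using 1
    ext x
    simp only [mem_ofPred_eq, mem_sdiff, mem_iUnion, mem_univ, true_and]
    constructor
    · rintro ⟨u, hu, huniq⟩
      refine ⟨⟨u, hu⟩, ?_⟩
      rintro ⟨k, v, w, hv, hw, hd⟩
      rw [huniq v hv, huniq w hw, dist_self] at hd
      have : (0 : ℝ) < 1 / ((k : ℝ) + 1) := by positivity
      linarith
    · rintro ⟨⟨u, hu⟩, hno⟩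
      refine ⟨u, hu, fun v hv => ?_⟩
      by_contra hne
      obtain ⟨k, hk⟩ := exists_nat_one_div_lt (dist_pos.2 hne)
      exact hno ⟨k, v, u, hv, hu, hk.le⟩
  refine measurable_of_isClosed fun C hC => ?_
  have hpre : gaussMap K ⁻¹' C =
      ({x | ∃! u, IsUnitNormal K x u} ∩ {x | ∃ u ∈ C, IsUnitNormal K x u}) ∪
      ({x | ∃! u, IsUnitNormal K x u}ᶜ ∩ {_x | (0 : EuclideanSpace ℝ (Fin n)) ∈ C}) := by
    ext x
    by_cases h : ∃! u, IsUnitNormal K x u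
    · simp only [mem_preimage, mem_union, mem_inter_iff, mem_ofPred_eq, mem_compl_iff, h, true_and,
        not_true_eq_false, false_and, or_false]
      constructor
      · intro hx
        refine ⟨_, hx, ?_⟩
        rw [gaussMap_eq h h.choose_spec.1]
        exact h.choose_spec.1
      · rintro ⟨u, hu, hn⟩
        rwa [gaussMap_eq h hn]
    · have h0 : gaussMap K x = 0 := by
        unfold gaussMap
        exact dif_neg h
      simp [h, h0]
  rw [hpre]
  exact (hR.inter (hA C hC).measurableSet).union (hR.compl.inter (MeasurableSet.const _))

/-- The surface area measure `S_K(ω) = ℋ^{n-1}(ν_K⁻¹(ω))`, where `μHE[n - 1]` is the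
`(n - 1)`-dimensional Hausdorff measure in its usual normalization (agreeing with Lebesgue measure
on `(n - 1)`-dimensional subspaces). It is regarded as a measure on the whole space, carried by the
unit sphere. -/
def surfaceAreaMeasure {n : ℕ} (K : Set (EuclideanSpace ℝ (Fin n))) :
    Measure (EuclideanSpace ℝ (Fin n)) :=
  ((μHE[n - 1] : Measure (EuclideanSpace ℝ (Fin n))).restrict (regularBoundary K)).map (gaussMap K)

/-- The local `L^p`-Brunn-Minkowski conjecture in dimension `n`. -/
def LocalLpBrunnMinkowski (n : ℕ) (p : ℝ) : Prop :=
  ∀ K L : Set (EuclideanSpace ℝ (Fin n)), IsSymmConvexBody K → IsSymmConvexBody L →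
    volume.real K * ((n : ℝ) * ((n : ℝ) - 1) * mixedVolume K L 2
        + (1 - p) * ∫ u, supportFn L u ^ 2 / supportFn K u ∂(surfaceAreaMeasure K))
      - (n : ℝ) * ((n : ℝ) - p) * mixedVolume K L 1 ^ 2 ≤ 0

/-- Convex polytopes: convex bodies which are the intersection of finitely many half-spaces. -/
def IsPolytope {n : ℕ} (P : Set (EuclideanSpace ℝ (Fin n))) : Prop :=
  IsConvexBody P ∧ ∃ (N : ℕ) (u : Fin N → EuclideanSpace ℝ (Fin n)) (h : Fin N → ℝ),
    (∀ i, ‖u i‖ = 1) ∧ P = {x | ∀ i, ⟪x, u i⟫ ≤ h i}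

/-- The face `F(P, u)` of `P` with outer normal `u`. -/
def face {n : ℕ} (P : Set (EuclideanSpace ℝ (Fin n))) (u : EuclideanSpace ℝ (Fin n)) :
    Set (EuclideanSpace ℝ (Fin n)) :=
  {x | x ∈ P ∧ ⟪x, u⟫ = supportFn P u}

/-- Strong isomorphism: `dim F(P, u) = dim F(Q, u)` for every unit vector `u`, where `dim` is the
dimension of the affine hull. -/
def StronglyIsomorphic {n : ℕ} (P Q : Set (EuclideanSpace ℝ (Fin n))) : Prop :=
  ∀ u : EuclideanSpace ℝ (Fin n), ‖u‖ = 1 →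
    Module.finrank ℝ (vectorSpan ℝ (face P u)) = Module.finrank ℝ (vectorSpan ℝ (face Q u))

/-- `f` is positive and `α`-concave on `s` (for `α ≥ 0`): `f ^ α` is concave if `α > 0`, and
`log f` is concave if `α = 0`. -/
def PowerConcaveOn (α : ℝ) (s : Set ℝ) (f : ℝ → ℝ) : Prop :=
  (∀ x ∈ s, 0 < f x) ∧
    ConcaveOn ℝ s fun x => if α = 0 then Real.log (f x) else f x ^ α

end LpBrunnMinkowski

end

noncomputable section

namespace LpBrunnMinkowski

/-! ### Polynomial and piecewise polynomial functions on real vector spaces -/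

/-! Pick one normal `u i` from each antipodal pair of normals of `K`, so that `K` is the slab
intersection with widths `h_K (u i)`. Strong isomorphism makes `h_L` linear on the normal cones of
the vertices of `K`. Hence every `w` is a combination `∑ d i • u i` for which both `h_K w` and `h_L
w` equal the corresponding sums with weights `|d i|`. The power mean is 1-homogeneous and concave
for `p < 1`, so the half-space conditions in the directions `±u i` imply all others
(`StronglyIsomorphic.lpComb_eq_slab`). Thus `f(t) = V(H t)`, where `V = slabVolume u` depends on
finitely many widths and `H t` is the coordinatewise power mean.

The curve satisfies `H'' = (1 - p) H' ^ 2 / H` coordinatewise. Where `V` is twice differentiable,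
with `z = H'`, `f'' = D²V(z, z) + (1 - p) DV(z ^ 2 / H)`. Concavity of `f ^ (p / n)` or `log f`
amounts to `f f'' - (1 - p / n) f' ^ 2 ≤ 0`. This is the local inequality at the slab body of widths
`H t`: its mixed volumes are derivatives of `V`, and its surface area measure puts the facet areas
`∂V / ∂h_i` on the normals.

Three obstacles remain. First, the conjecture speaks of bodies `L`, while `z` is an arbitrary
vector. The quadratic form in question has `k` in its kernel, so `z` may be replaced by `k + ε z`,
which for small `ε` gives the widths of a body in the same chamber as `k`
(`IsFrame.exists_smooth_local_inequality`). Second, `V` is only piecewise polynomial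
(`IsFrame.exists_isPwPoly`), hence smooth off finitely many hyperplanes. It is nevertheless `C¹` for
positive widths (`IsFrame.hasFDerivAt_slabVolume`), so finitely many bad times do no harm to
concavity. Third, the curve could run inside a bad hyperplane. If its starting point avoids the
hyperplanes, analyticity leaves only finitely many bad times (`finite_zeros_lpMean`); the general
case follows by perturbing the starting point and passing to the limit. -/

/-- Polynomial functions on a real vector space. -/
inductive IsPolyFun {W : Type*} [AddCommGroup W] [Module ℝ W] : (W → ℝ) → Prop
  | const (c : ℝ) : IsPolyFun fun _ => c
  | linear (l : W →ₗ[ℝ] ℝ) : IsPolyFun fun w => l w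
  | add {f g : W → ℝ} : IsPolyFun f → IsPolyFun g → IsPolyFun fun w => f w + g w
  | mul {f g : W → ℝ} : IsPolyFun f → IsPolyFun g → IsPolyFun fun w => f w * g w

/-- Piecewise polynomial functions, with pieces cut out by linear inequalities. -/
inductive IsPwPoly {W : Type*} [AddCommGroup W] [Module ℝ W] : (W → ℝ) → Prop
  | poly {f : W → ℝ} : IsPolyFun f → IsPwPoly f
  | ite (l : W →ₗ[ℝ] ℝ) {f g : W → ℝ} : IsPwPoly f → IsPwPoly g →
      IsPwPoly fun w => if l w ≤ 0 then f w else g w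

section

variable {W W' : Type*} [AddCommGroup W] [Module ℝ W] [AddCommGroup W'] [Module ℝ W']

theorem IsPolyFun.comp_linear {f : W → ℝ} (hf : IsPolyFun f) (L : W' →ₗ[ℝ] W) :
    IsPolyFun fun w => f (L w) := by
  induction hf with
  | const c => exact .const c
  | linear l => exact .linear (l ∘ₗ L)
  | add _ _ h₁ h₂ => exact .add h₁ h₂
  | mul _ _ h₁ h₂ => exact .mul h₁ h₂

theorem IsPolyFun.pow {f : W → ℝ} (hf : IsPolyFun f) (k : ℕ) : IsPolyFun fun w => f w ^ k := by
  induction k with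
  | zero => simpa using IsPolyFun.const 1
  | succ k ih => simpa only [pow_succ] using ih.mul hf

theorem IsPolyFun.neg {f : W → ℝ} (hf : IsPolyFun f) : IsPolyFun fun w => -f w := by
  simpa using (IsPolyFun.const (-1)).mul hf

theorem IsPolyFun.sum {κ : Type*} (s : Finset κ) {f : κ → W → ℝ}
    (hf : ∀ i ∈ s, IsPolyFun (f i)) : IsPolyFun fun w => ∑ i ∈ s, f i w := by
  classical
  induction s using Finset.induction_on with
  | empty => simpa using IsPolyFun.const 0
  | insert a s ha ih =>
    simp only [Finset.sum_insert ha]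
    exact (hf a (by simp)).add (ih fun i hi => hf i (by simp [hi]))

theorem IsPolyFun.contDiff {W : Type*} [NormedAddCommGroup W] [NormedSpace ℝ W]
    [FiniteDimensional ℝ W] {f : W → ℝ} (hf : IsPolyFun f) {N : WithTop ℕ∞} :
    ContDiff ℝ N f := by
  induction hf with
  | const c => exact contDiff_const
  | linear l => exact (LinearMap.toContinuousLinearMap l).contDiff
  | add _ _ h₁ h₂ => exact h₁.add h₂
  | mul _ _ h₁ h₂ => exact h₁.mul h₂

/-- A polynomial function restricts to a polynomial on every line. -/
theorem IsPolyFun.exists_polynomial_line {f : W → ℝ} (hf : IsPolyFun f) (a b : W) :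
    ∃ q : ℝ[X], ∀ t : ℝ, f (a + t • b) = q.eval t := by
  induction hf with
  | const c => exact ⟨Polynomial.C c, by simp⟩
  | linear l =>
    refine ⟨Polynomial.C (l a) + Polynomial.X * Polynomial.C (l b), fun t => ?_⟩
    simp only [map_add, map_smul, smul_eq_mul, Polynomial.eval_add, Polynomial.eval_C,
      Polynomial.eval_mul, Polynomial.eval_X]
  | add _ _ h₁ h₂ =>
    obtain ⟨q₁, h₁⟩ := h₁
    obtain ⟨q₂, h₂⟩ := h₂
    exact ⟨q₁ + q₂, fun t => by simp [h₁, h₂]⟩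
  | mul _ _ h₁ h₂ =>
    obtain ⟨q₁, h₁⟩ := h₁
    obtain ⟨q₂, h₂⟩ := h₂
    exact ⟨q₁ * q₂, fun t => by simp [h₁, h₂]⟩

/-- A polynomial function of `(w, s)` is a polynomial in `s` with polynomial coefficients in `w`. -/
theorem IsPolyFun.exists_expansion {f : W × ℝ → ℝ} (hf : IsPolyFun f) :
    ∃ c : ℕ → W → ℝ, ∃ N : ℕ, (∀ j, IsPolyFun (c j)) ∧
      ∀ w s, f (w, s) = ∑ j ∈ Finset.range N, c j w * s ^ j := by
  -- The degree bound must be uniform in `w`, so that one sum over `Finset.range N` serves all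
  -- parameters.
  suffices h : ∃ P : W → ℝ[X], (∀ j, IsPolyFun fun w => (P w).coeff j) ∧
      (∃ N, ∀ w, (P w).natDegree < N) ∧ ∀ w s, f (w, s) = (P w).eval s by
    obtain ⟨P, h1, ⟨N, h2⟩, h3⟩ := h
    exact ⟨fun j w => (P w).coeff j, N, h1, fun w s => by
      rw [h3, Polynomial.eval_eq_sum_range' (h2 w)]⟩
  induction hf with
  | const c =>
    refine ⟨fun _ => Polynomial.C c, fun j => .const _, ⟨1, by simp⟩, by simp⟩
  | linear l =>
    refine ⟨fun w => Polynomial.C (l (0, 1)) * Polynomial.X + Polynomial.C (l (w, 0)), ?_, ?_, ?_⟩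
    · intro j
      rcases j with _ | _ | j
      · simpa using IsPolyFun.linear (l ∘ₗ LinearMap.inl ℝ W ℝ)
      · simpa using IsPolyFun.const (l (0, 1))
      · simpa [Polynomial.coeff_X, Polynomial.coeff_C] using IsPolyFun.const (0 : ℝ)
    · exact ⟨2, fun w => (Polynomial.natDegree_linear_le).trans_lt (by norm_num)⟩
    · intro w s
      have : (w, s) = (w, (0 : ℝ)) + s • ((0 : W), (1 : ℝ)) := by simp
      dsimp only
      rw [this, map_add, map_smul]
      simp
      ring
  | add _ _ h₁ h₂ =>
    obtain ⟨P, h1, ⟨N, h2⟩, h3⟩ := h₁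
    obtain ⟨Q, k1, ⟨M, k2⟩, k3⟩ := h₂
    refine ⟨fun w => P w + Q w, fun j => by simpa using (h1 j).add (k1 j),
      ⟨N + M, fun w => ?_⟩, fun w s => by simp [h3, k3]⟩
    have h4 := Polynomial.natDegree_add_le (P w) (Q w)
    have h5 := h2 w
    have h6 := k2 w
    dsimp only
    omega
  | mul _ _ h₁ h₂ =>
    obtain ⟨P, h1, ⟨N, h2⟩, h3⟩ := h₁
    obtain ⟨Q, k1, ⟨M, k2⟩, k3⟩ := h₂
    refine ⟨fun w => P w * Q w, fun j => ?_, ⟨N + M, fun w => ?_⟩, fun w s => by simp [h3, k3]⟩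
    · simp only [Polynomial.coeff_mul]
      exact IsPolyFun.sum _ fun i _ => (h1 _).mul (k1 _)
    · have h4 := Polynomial.natDegree_mul_le (p := P w) (q := Q w)
      have h5 := h2 w
      have h6 := k2 w
      dsimp only
      omega

theorem IsPwPoly.comp_linear {f : W → ℝ} (hf : IsPwPoly f) (L : W' →ₗ[ℝ] W) :
    IsPwPoly fun w => f (L w) := by
  induction hf with
  | poly h => exact .poly (h.comp_linear L)
  | ite l _ _ h₁ h₂ => exact .ite (l ∘ₗ L) h₁ h₂

theorem IsPwPoly.add {f g : W → ℝ} (hf : IsPwPoly f) (hg : IsPwPoly g) :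
    IsPwPoly fun w => f w + g w := by
  induction hf with
  | @poly f hf =>
    induction hg with
    | poly hg => exact .poly (hf.add hg)
    | ite l _ _ h₁ h₂ =>
      convert IsPwPoly.ite l h₁ h₂ using 2
      dsimp only
      split_ifs <;> rfl
  | ite l _ _ h₁ h₂ =>
    convert IsPwPoly.ite l h₁ h₂ using 2
    dsimp only
    split_ifs <;> rfl

/-- Fixing the parameter in a piecewise polynomial function gives a locally bounded measurable
function of the remaining variable. -/
theorem IsPwPoly.measurable_section {E : Type*} [NormedAddCommGroup E] [NormedSpace ℝ E]
    [FiniteDimensional ℝ E] [MeasurableSpace E] [BorelSpace E] {f : W × E → ℝ} (hf : IsPwPoly f)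
    (w : W) : Measurable (fun x => f (w, x)) ∧
      ∃ g : E → ℝ, Continuous g ∧ ∀ x, |f (w, x)| ≤ g x := by
  have hlin : ∀ l : W × E →ₗ[ℝ] ℝ, Continuous fun x => l (w, x) := by
    intro l
    have : (fun x : E => l (w, x)) = fun x => l (w, 0) + (l ∘ₗ LinearMap.inr ℝ W E) x := by
      ext x
      simp [← map_add]
    rw [this]
    exact continuous_const.add
      (LinearMap.toContinuousLinearMap (l ∘ₗ LinearMap.inr ℝ W E)).continuous
  induction hf with
  | @poly f h =>
    have hc : Continuous fun x => f (w, x) := by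
      induction h with
      | const c => exact continuous_const
      | linear l => exact hlin l
      | add _ _ h₁ h₂ => exact h₁.add h₂
      | mul _ _ h₁ h₂ => exact h₁.mul h₂
    exact ⟨hc.measurable, fun x => |f (w, x)|, hc.abs, fun x => le_rfl⟩
  | ite l _ _ h₁ h₂ =>
    obtain ⟨m₁, g₁, c₁, h₁⟩ := h₁
    obtain ⟨m₂, g₂, c₂, h₂⟩ := h₂
    refine ⟨Measurable.ite (measurableSet_le (hlin l).measurable measurable_const) m₁ m₂,
      fun s => max (g₁ s) (g₂ s), c₁.max c₂, fun w => ?_⟩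
    dsimp only
    split_ifs
    · exact (h₁ _).trans (le_max_left _ _)
    · exact (h₂ _).trans (le_max_right _ _)

theorem IsPwPoly.integrableOn_section {E : Type*} [NormedAddCommGroup E] [NormedSpace ℝ E]
    [FiniteDimensional ℝ E] [MeasurableSpace E] [BorelSpace E] {f : W × E → ℝ} (hf : IsPwPoly f)
    (w : W) (μ : Measure E) [IsFiniteMeasureOnCompacts μ] {s : Set E} (hs : IsCompact s) :
    IntegrableOn (fun x => f (w, x)) s μ := by
  obtain ⟨hm, g, hg, hfg⟩ := hf.measurable_section w
  exact (hg.continuousOn.integrableOn_compact hs).mono' hm.aestronglyMeasurable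
    (Filter.Eventually.of_forall hfg)

theorem IsPwPoly.intervalIntegrable {f : W × ℝ → ℝ} (hf : IsPwPoly f) (w : W) (a b : ℝ) :
    IntervalIntegrable (fun s => f (w, s)) volume a b := by
  obtain ⟨hm, g, hg, hfg⟩ := hf.measurable_section w
  exact (hg.intervalIntegrable a b).mono_fun' hm.aestronglyMeasurable
    (Filter.Eventually.of_forall hfg)

/-- Integrals of piecewise polynomial functions between linear bounds are piecewise polynomial. -/
theorem IsPwPoly.exists_integral {F : W × ℝ → ℝ} (hF : IsPwPoly F) (a b : W →ₗ[ℝ] ℝ) :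
    ∃ G : W → ℝ, IsPwPoly G ∧ ∀ w, a w ≤ b w → ∫ s in a w..b w, F (w, s) = G w := by
  induction hF generalizing a b with
  | @poly F h =>
    obtain ⟨c, N, hc, hF⟩ := h.exists_expansion
    refine ⟨fun w => ∑ j ∈ Finset.range N,
      c j w * ((b w ^ (j + 1) + -(a w ^ (j + 1))) * (1 / ((j : ℝ) + 1))), .poly ?_, fun w _ => ?_⟩
    · exact IsPolyFun.sum _ fun j _ => (hc j).mul
        ((((IsPolyFun.linear b).pow _).add ((IsPolyFun.linear a).pow _).neg).mul (.const _))
    · simp only [hF]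
      rw [intervalIntegral.integral_finsetSum]
      · refine Finset.sum_congr rfl fun j _ => ?_
        rw [intervalIntegral.integral_const_mul, integral_pow]
        ring
      · intro j _
        exact Continuous.intervalIntegrable (by fun_prop) _ _
  | @ite l f g hf hg ihf ihg =>
    have hl : ∀ w s, l (w, s) = l (w, 0) + s * l (0, 1) := by
      intro w s
      have : (w, s) = (w, (0 : ℝ)) + s • ((0 : W), (1 : ℝ)) := by simp
      rw [this, map_add, map_smul, smul_eq_mul]
    set m : W →ₗ[ℝ] ℝ := l ∘ₗ LinearMap.inl ℝ W ℝ with hm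
    have hmw : ∀ w, m w = l (w, 0) := fun w => rfl
    set c := l (0, 1) with hc
    obtain ⟨Gf, hGf, Gf_eq⟩ := ihf a b
    obtain ⟨Gg, hGg, Gg_eq⟩ := ihg a b
    -- If `c = 0`, the test does not involve the integration variable and can be taken out of the
    -- integral.
    rcases eq_or_ne c 0 with h0 | h0
    · refine ⟨_, IsPwPoly.ite m hGf hGg, fun w hw => ?_⟩
      have key : ∀ s, l (w, s) = m w := fun s => by rw [hl, h0, mul_zero, add_zero, hmw]
      simp only [key]
      split_ifs
      · exact Gf_eq w hw
      · exact Gg_eq w hw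
    -- `e w` is the root of `s ↦ l (w, s)`. Whether it lies before, after or inside `[a w, b w]` is
    -- decided by linear tests in `w`, and in the last case the integral is split there.
    set e : W →ₗ[ℝ] ℝ := (-c⁻¹) • m with he
    have hew : ∀ w, e w = -c⁻¹ * l (w, 0) := fun w => rfl
    obtain ⟨Gf1, hGf1, Gf1_eq⟩ := ihf a e
    obtain ⟨Gf2, hGf2, Gf2_eq⟩ := ihf e b
    obtain ⟨Gg1, hGg1, Gg1_eq⟩ := ihg a e
    obtain ⟨Gg2, hGg2, Gg2_eq⟩ := ihg e b
    rcases lt_or_gt_of_ne h0 with hneg | hpos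
    · have key : ∀ w s, l (w, s) ≤ 0 ↔ e w ≤ s := by
        intro w s
        rw [hl, hew, neg_mul, neg_le, ← div_eq_inv_mul, le_div_iff_of_neg hneg]
        constructor <;> intro h <;> linarith
      refine ⟨_, IsPwPoly.ite (e - a) hGf (IsPwPoly.ite (b - e) hGg (hGg1.add hGf2)),
        fun w hw => ?_⟩
      simp only [LinearMap.sub_apply, sub_nonpos, key]
      split_ifs with h1 h2
      · rw [← Gf_eq w hw]
        refine intervalIntegral.integral_congr fun s hs => ?_
        rw [uIcc_of_le hw] at hs
        exact if_pos (h1.trans hs.1)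
      · rw [← Gg_eq w hw]
        refine intervalIntegral.integral_congr_ae ?_
        filter_upwards [compl_mem_ae_iff.2 (measure_singleton (e w))] with s hs hs'
        rw [uIoc_of_le hw] at hs'
        exact if_neg fun h => hs (le_antisymm (hs'.2.trans h2) h)
      · push Not at h1 h2
        have hi : ∀ x y, IntervalIntegrable (fun s => if e w ≤ s then f (w, s) else g (w, s))
            volume x y := by
          intro x y
          have := (IsPwPoly.ite l hf hg).intervalIntegrable w x y
          simpa only [key] using this
        rw [← intervalIntegral.integral_add_adjacent_intervals (hi (a w) (e w)) (hi (e w) (b w)),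
          ← Gg1_eq w h1.le, ← Gf2_eq w h2.le]
        congr 1
        · refine intervalIntegral.integral_congr_ae ?_
          filter_upwards [compl_mem_ae_iff.2 (measure_singleton (e w))] with s hs hs'
          rw [uIoc_of_le h1.le] at hs'
          exact if_neg fun h => hs (le_antisymm hs'.2 h)
        · refine intervalIntegral.integral_congr fun s hs => ?_
          rw [uIcc_of_le h2.le] at hs
          exact if_pos hs.1
    · have key : ∀ w s, l (w, s) ≤ 0 ↔ s ≤ e w := by
        intro w s
        rw [hl, hew, neg_mul, le_neg, ← div_eq_inv_mul, div_le_iff₀ hpos]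
        constructor <;> intro h <;> linarith
      refine ⟨_, IsPwPoly.ite (b - e) hGf (IsPwPoly.ite (e - a) hGg (hGf1.add hGg2)),
        fun w hw => ?_⟩
      simp only [LinearMap.sub_apply, sub_nonpos, key]
      split_ifs with h1 h2
      · rw [← Gf_eq w hw]
        refine intervalIntegral.integral_congr fun s hs => ?_
        rw [uIcc_of_le hw] at hs
        exact if_pos (hs.2.trans h1)
      · rw [← Gg_eq w hw]
        refine intervalIntegral.integral_congr_ae ?_
        filter_upwards with s hs'
        rw [uIoc_of_le hw] at hs'
        exact if_neg fun h => absurd (hs'.1.trans_le h) (not_lt.2 h2)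
      · push Not at h1 h2
        have hi : ∀ x y, IntervalIntegrable (fun s => if s ≤ e w then f (w, s) else g (w, s))
            volume x y := by
          intro x y
          have := (IsPwPoly.ite l hf hg).intervalIntegrable w x y
          simpa only [key] using this
        rw [← intervalIntegral.integral_add_adjacent_intervals (hi (a w) (e w)) (hi (e w) (b w)),
          ← Gf1_eq w h2.le, ← Gg2_eq w h1.le]
        congr 1
        · refine intervalIntegral.integral_congr fun s hs => ?_
          rw [uIcc_of_le h2.le] at hs
          exact if_pos hs.2
        · refine intervalIntegral.integral_congr_ae ?_
          filter_upwards with s hs'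
          rw [uIoc_of_le h1.le] at hs'
          exact if_neg (not_le.2 hs'.1)

end

/-- Integrals of piecewise polynomial functions over boxes depend in a piecewise polynomial way on
the parameters. -/
theorem IsPwPoly.exists_integral_box {m : ℕ} : ∀ {W : Type} [NormedAddCommGroup W]
    [NormedSpace ℝ W] [FiniteDimensional ℝ W] {F : W × (Fin m → ℝ) → ℝ} (_ : IsPwPoly F)
    (r : W →ₗ[ℝ] ℝ), ∃ G : W → ℝ, IsPwPoly G ∧ ∀ w, 0 ≤ r w →
      ∫ x in Icc (fun _ => -r w) (fun _ => r w), F (w, x) = G w := by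
  induction m with
  | zero =>
    intro W _ _ _ F hF r
    refine ⟨fun w => F (w, 0), hF.comp_linear (LinearMap.inl ℝ W (Fin 0 → ℝ)), fun w _ => ?_⟩
    have : Icc (fun _ : Fin 0 => -r w) (fun _ => r w) = univ := by
      ext x
      simp [Subsingleton.elim x (fun _ => -r w), Subsingleton.elim (fun _ : Fin 0 => -r w) (fun _ => r w)]
    rw [this, Measure.restrict_univ, volume_pi, Measure.pi_of_empty, integral_dirac]
    exact congrArg (fun x => F (w, x)) (Subsingleton.elim _ _)
  | succ m ih =>
    intro W _ _ _ F hF r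
    -- The first coordinate joins the parameters: the induction hypothesis integrates out the other
    -- `m` coordinates, and the one-dimensional lemma then integrates this one.
    let L : (W × ℝ) × (Fin m → ℝ) →ₗ[ℝ] W × (Fin (m + 1) → ℝ) :=
      LinearMap.prod (LinearMap.fst ℝ W ℝ ∘ₗ LinearMap.fst ℝ _ _)
        (LinearMap.pi (Fin.cons (LinearMap.snd ℝ W ℝ ∘ₗ LinearMap.fst ℝ _ _)
          fun i => LinearMap.proj i ∘ₗ LinearMap.snd ℝ _ _))
    have hL : ∀ w s y, L ((w, s), y) = (w, Fin.cons s y) := by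
      intro w s y
      refine Prod.ext rfl (funext fun i => ?_)
      refine Fin.cases ?_ (fun i => ?_) i <;> simp [L]
    obtain ⟨G₁, hG₁, hG₁eq⟩ := ih (hF.comp_linear L) (r ∘ₗ LinearMap.fst ℝ W ℝ)
    obtain ⟨G, hG, hGeq⟩ := hG₁.exists_integral (-r) r
    refine ⟨G, hG, fun w hw => ?_⟩
    rw [← hGeq w (by simpa using hw)]
    have hmp := (volume_preserving_piFinSuccAbove (fun _ : Fin (m + 1) => ℝ) 0).symm
    have hFw : IntegrableOn (fun x => F (w, x)) (Icc (fun _ => -r w) (fun _ => r w)) :=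
      hF.integrableOn_section w volume isCompact_Icc
    rw [← hmp.setIntegral_preimage_emb (MeasurableEquiv.measurableEmbedding _)]
    have hpre : (MeasurableEquiv.piFinSuccAbove (fun _ : Fin (m + 1) => ℝ) 0).symm ⁻¹'
        Icc (fun _ => -r w) (fun _ => r w) =
        Icc (-r w) (r w) ×ˢ Icc (fun _ => -r w) (fun _ => r w) := by
      ext ⟨s, y⟩
      simp only [mem_preimage, mem_Icc, Pi.le_def, mem_prod, Fin.forall_fin_succ]
      exact and_and_and_comm
    rw [hpre, Measure.volume_eq_prod, setIntegral_prod]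
    · rw [intervalIntegral.integral_of_le (by simpa using hw), ← integral_Icc_eq_integral_Ioc]
      refine setIntegral_congr_fun measurableSet_Icc fun s _ => ?_
      rw [← hG₁eq (w, s) hw]
      refine setIntegral_congr_fun measurableSet_Icc fun y _ => ?_
      rw [hL]
      exact congrArg (fun z => F (w, z)) (Fin.insertNth_zero' s y)
    · rw [← Measure.volume_eq_prod, ← hpre]
      exact (hmp.integrableOn_comp_preimage (MeasurableEquiv.measurableEmbedding _)).2 hFw

/-- Away from finitely many hyperplanes, a piecewise polynomial function is polynomial on the open
cones on which the signs of the corresponding linear forms are constant. -/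
theorem IsPwPoly.exists_chamber {W : Type*} [AddCommGroup W] [Module ℝ W] {f : W → ℝ}
    (hf : IsPwPoly f) : ∃ S : Set (W →ₗ[ℝ] ℝ), S.Finite ∧ (∀ l ∈ S, l ≠ 0) ∧
      ∀ k, (∀ l ∈ S, l k ≠ 0) → ∃ G : W → ℝ, IsPolyFun G ∧
        ∀ h, (∀ l ∈ S, 0 < l h * l k) → f h = G h := by
  induction hf with
  | @poly f h => exact ⟨∅, by simp, by simp, fun k _ => ⟨f, h, by simp⟩⟩
  | @ite l f g _ _ h₁ h₂ =>
    obtain ⟨S₁, fin₁, ne₁, h₁⟩ := h₁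
    obtain ⟨S₂, fin₂, ne₂, h₂⟩ := h₂
    -- A zero form always selects the branch `f`; it has to stay out of `S`, whose members cut out
    -- genuine hyperplanes.
    rcases eq_or_ne l 0 with rfl | hl
    · refine ⟨S₁, fin₁, ne₁, fun k hk => ?_⟩
      simpa using h₁ k hk
    · refine ⟨insert l (S₁ ∪ S₂), (fin₁.union fin₂).insert l, ?_, fun k hk => ?_⟩
      · rintro m (rfl | hm | hm)
        exacts [hl, ne₁ m hm, ne₂ m hm]
      · obtain ⟨G₁, p₁, e₁⟩ := h₁ k fun m hm => hk m (by simp [hm])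
        obtain ⟨G₂, p₂, e₂⟩ := h₂ k fun m hm => hk m (by simp [hm])
        rcases lt_or_gt_of_ne (hk l (by simp)) with hlt | hlt
        · refine ⟨G₁, p₁, fun h hh => ?_⟩
          dsimp only
          rw [if_pos]
          · exact e₁ h fun m hm => hh m (by simp [hm])
          · exact (neg_of_mul_pos_left (hh l (by simp)) hlt.le).le
        · refine ⟨G₂, p₂, fun h hh => ?_⟩
          dsimp only
          rw [if_neg]
          · exact e₂ h fun m hm => hh m (by simp [hm])
          · exact not_le.2 (pos_of_mul_pos_left (hh l (by simp)) hlt.le)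

/-! ### Intersections of symmetric slabs -/

/-- The intersection of the slabs `{x : |⟨x, u i⟩| ≤ h i}`. -/
def slab {n : ℕ} {ι : Type} (u : ι → EuclideanSpace ℝ (Fin n)) (h : ι → ℝ) :
    Set (EuclideanSpace ℝ (Fin n)) :=
  {x | ∀ i, |⟪x, u i⟫| ≤ h i}

/-- A family of unit vectors, pairwise distinct up to sign, which spans the space. -/
structure IsFrame {n : ℕ} {ι : Type} (u : ι → EuclideanSpace ℝ (Fin n)) : Prop where
  norm_eq : ∀ i, ‖u i‖ = 1
  ne : ∀ i j, i ≠ j → u i ≠ u j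
  ne_neg : ∀ i j, i ≠ j → u i ≠ -u j
  span : ∀ x, (∀ i, ⟪x, u i⟫ = 0) → x = 0

/-- The volume of an intersection of slabs, as a function of the widths. -/
def slabVolume {n : ℕ} {ι : Type} (u : ι → EuclideanSpace ℝ (Fin n)) (h : ι → ℝ) : ℝ :=
  volume.real (slab u h)

section

variable {n : ℕ} {ι : Type} [Fintype ι] {u : ι → EuclideanSpace ℝ (Fin n)}

theorem convex_slab {ι : Type} (u : ι → EuclideanSpace ℝ (Fin n)) (h : ι → ℝ) :
    Convex ℝ (slab u h) := by
  intro x hx y hy a b ha hb hab i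
  rw [inner_add_left, real_inner_smul_left, real_inner_smul_left]
  calc |a * ⟪x, u i⟫ + b * ⟪y, u i⟫| ≤ a * |⟪x, u i⟫| + b * |⟪y, u i⟫| := by
        refine (abs_add_le _ _).trans_eq ?_
        rw [abs_mul, abs_mul, abs_of_nonneg ha, abs_of_nonneg hb]
    _ ≤ a * h i + b * h i := by
        gcongr
        exacts [hx i, hy i]
    _ = h i := by rw [← add_mul, hab, one_mul]

theorem isClosed_slab {ι : Type} (u : ι → EuclideanSpace ℝ (Fin n)) (h : ι → ℝ) :
    IsClosed (slab u h) := by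
  simp only [slab, ofPred_forall]
  exact isClosed_iInter fun i => isClosed_le (by fun_prop) continuous_const

theorem measurableSet_slab {ι : Type} (u : ι → EuclideanSpace ℝ (Fin n)) (h : ι → ℝ) :
    MeasurableSet (slab u h) := (isClosed_slab u h).measurableSet

theorem neg_mem_slab {ι : Type} {u : ι → EuclideanSpace ℝ (Fin n)} {h : ι → ℝ}
    {x : EuclideanSpace ℝ (Fin n)} : -x ∈ slab u h ↔ x ∈ slab u h := by
  simp [slab, inner_neg_left]

theorem smul_mem_slab {ι : Type} {u : ι → EuclideanSpace ℝ (Fin n)} {h : ι → ℝ}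
    {x : EuclideanSpace ℝ (Fin n)} {c : ℝ} (hc : 0 < c) :
    c • x ∈ slab u (c • h) ↔ x ∈ slab u h := by
  simp only [slab, mem_ofPred_eq, real_inner_smul_left, abs_mul, abs_of_pos hc, Pi.smul_apply,
    smul_eq_mul, mul_le_mul_iff_right₀ hc]

theorem smul_slab {ι : Type} (u : ι → EuclideanSpace ℝ (Fin n)) (h : ι → ℝ) {c : ℝ} (hc : 0 < c) :
    c • slab u h = slab u (c • h) := by
  ext x
  rw [mem_smul_set_iff_inv_smul_mem₀ hc.ne', ← smul_mem_slab hc, smul_inv_smul₀ hc.ne']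

/-- In a frame, a vector is controlled by its inner products. -/
theorem IsFrame.exists_norm_le (hu : IsFrame u) :
    ∃ C : ℝ, 0 ≤ C ∧ ∀ x, ‖x‖ ≤ C * ∑ i, |⟪x, u i⟫| := by
  let Φ : EuclideanSpace ℝ (Fin n) →ₗ[ℝ] (ι → ℝ) :=
    LinearMap.pi fun i => (innerₗ (EuclideanSpace ℝ (Fin n))).flip (u i)
  have hΦ : ∀ x i, Φ x i = ⟪x, u i⟫ := fun x i => rfl
  have hinj : LinearMap.ker Φ = ⊥ := by
    rw [LinearMap.ker_eq_bot']
    intro x hx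
    exact hu.span x fun i => by rw [← hΦ, hx, Pi.zero_apply]
  obtain ⟨Ψ, hΨ⟩ := Φ.exists_leftInverse_of_injective hinj
  refine ⟨‖LinearMap.toContinuousLinearMap Ψ‖, norm_nonneg _, fun x => ?_⟩
  have h1 : x = LinearMap.toContinuousLinearMap Ψ (Φ x) := by
    have := congrArg (fun f => f x) hΨ
    exact this.symm
  calc ‖x‖ = ‖LinearMap.toContinuousLinearMap Ψ (Φ x)‖ := by rw [← h1]
    _ ≤ ‖LinearMap.toContinuousLinearMap Ψ‖ * ‖Φ x‖ := ContinuousLinearMap.le_opNorm _ _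
    _ ≤ _ := by
        gcongr
        rw [pi_norm_le_iff_of_nonneg (by positivity)]
        intro i
        exact Finset.single_le_sum (f := fun i => |⟪x, u i⟫|) (fun i _ => abs_nonneg _)
          (Finset.mem_univ i)

theorem IsFrame.exists_slab_subset (hu : IsFrame u) :
    ∃ C : ℝ, 0 ≤ C ∧ ∀ h, ∀ x ∈ slab u h, ‖x‖ ≤ C * ∑ i, h i := by
  obtain ⟨C, hC, hx⟩ := hu.exists_norm_le
  refine ⟨C, hC, fun h x hxh => (hx x).trans ?_⟩
  gcongr with i
  exact hxh i

theorem IsFrame.isCompact_slab (hu : IsFrame u) (h : ι → ℝ) : IsCompact (slab u h) := by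
  obtain ⟨C, -, hx⟩ := hu.exists_slab_subset
  refine Metric.isCompact_of_isClosed_isBounded (isClosed_slab u h) ?_
  refine (Metric.isBounded_closedBall (x := 0) (r := C * ∑ i, h i)).subset fun x hxh => ?_
  simpa using hx h x hxh

theorem zero_mem_slab {ι : Type} {u : ι → EuclideanSpace ℝ (Fin n)} {h : ι → ℝ}
    (hh : ∀ i, 0 ≤ h i) : 0 ∈ slab u h := fun i => by simpa using hh i

theorem subset_interior_slab (h : ι → ℝ) : {x | ∀ i, |⟪x, u i⟫| < h i} ⊆ interior (slab u h) := by
  refine interior_maximal (fun x hx i => (hx i).le) ?_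
  simp only [ofPred_forall]
  exact isOpen_iInter_of_finite fun i => isOpen_lt (by fun_prop) continuous_const

theorem IsFrame.isSymmConvexBody_slab (hu : IsFrame u) {h : ι → ℝ} (hh : ∀ i, 0 < h i) :
    IsSymmConvexBody (slab u h) where
  convex := convex_slab u h
  isCompact := hu.isCompact_slab h
  nonempty_interior := ⟨0, subset_interior_slab h fun i => by simpa using hh i⟩
  symm := by
    ext x
    rw [mem_neg, neg_mem_slab]

theorem IsFrame.slabVolume_pos (hu : IsFrame u) {h : ι → ℝ} (hh : ∀ i, 0 < h i) :
    0 < slabVolume u h := by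
  have h1 : 0 < volume (slab u h) :=
    Measure.measure_pos_of_nonempty_interior _ (hu.isSymmConvexBody_slab hh).nonempty_interior
  exact ENNReal.toReal_pos h1.ne' (hu.isCompact_slab h).measure_lt_top.ne

theorem slabVolume_smul {ι : Type} (u : ι → EuclideanSpace ℝ (Fin n)) (h : ι → ℝ) {c : ℝ}
    (hc : 0 < c) : slabVolume u (c • h) = c ^ n * slabVolume u h := by
  rw [slabVolume, ← smul_slab u h hc, measureReal_def, Measure.addHaar_smul, ENNReal.toReal_mul,
    finrank_euclideanSpace_fin, abs_of_pos (pow_pos hc n),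
    ENNReal.toReal_ofReal (pow_pos hc n).le]
  rfl

/-- The volume of an intersection of slabs is a piecewise polynomial function of the widths. -/
theorem IsFrame.exists_isPwPoly (hu : IsFrame u) :
    ∃ G : (ι → ℝ) → ℝ, IsPwPoly G ∧ ∀ h, (∀ i, 0 ≤ h i) → slabVolume u h = G h := by
  classical
  obtain ⟨C, hC, hx⟩ := hu.exists_slab_subset
  let a : ι → (ι → ℝ) × (Fin n → ℝ) →ₗ[ℝ] ℝ := fun i =>
    (innerₗ (EuclideanSpace ℝ (Fin n))).flip (u i) ∘ₗ
      (WithLp.linearEquiv 2 ℝ (Fin n → ℝ)).symm.toLinearMap ∘ₗ LinearMap.snd ℝ _ _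
  have ha : ∀ i h x, a i (h, x) = ⟪(WithLp.toLp 2 x : EuclideanSpace ℝ (Fin n)), u i⟫ :=
    fun i h x => rfl
  let b : ι → (ι → ℝ) × (Fin n → ℝ) →ₗ[ℝ] ℝ := fun i => LinearMap.proj i ∘ₗ LinearMap.fst ℝ _ _
  have hb : ∀ i h x, b i (h, x) = h i := fun i h x => rfl
  -- The indicator of the slabs is piecewise polynomial jointly in the widths and the point: each
  -- slab contributes two linear tests.
  have hF : ∀ s : Finset ι, IsPwPoly fun z : (ι → ℝ) × (Fin n → ℝ) =>
      if ∀ i ∈ s, |a i z| ≤ b i z then (1 : ℝ) else 0 := by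
    intro s
    induction s using Finset.induction_on with
    | empty => simpa using IsPwPoly.poly (IsPolyFun.const 1)
    | insert j s hj ih =>
      have h0 : IsPwPoly fun _ : (ι → ℝ) × (Fin n → ℝ) => (0 : ℝ) := .poly (.const 0)
      convert IsPwPoly.ite (a j - b j) (IsPwPoly.ite (-a j - b j) ih h0) h0 using 2 with z
      simp only [Finset.forall_mem_insert, abs_le, LinearMap.sub_apply, LinearMap.neg_apply,
        sub_nonpos, neg_le (a := a j z)]
      split_ifs <;> tauto
  -- Half the side of a box containing the slab intersection, chosen linear in the widths so that
  -- the box integral is again piecewise polynomial.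
  let r : (ι → ℝ) →ₗ[ℝ] ℝ := C • ∑ i, LinearMap.proj i
  have hr : ∀ h, r h = C * ∑ i, h i := fun h => by simp [r]
  obtain ⟨G, hG, hGeq⟩ := (hF Finset.univ).exists_integral_box r
  refine ⟨G, hG, fun h hh => ?_⟩
  rw [← hGeq h (by rw [hr]; exact mul_nonneg hC (Finset.sum_nonneg fun i _ => hh i))]
  set T : Set (Fin n → ℝ) := {x | WithLp.toLp 2 x ∈ slab u h} with hT
  have hTm : MeasurableSet T := (measurableSet_slab u h).preimage
    (PiLp.continuous_toLp 2 _).measurable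
  have hTsub : T ⊆ Icc (fun _ => -r h) (fun _ => r h) := by
    intro x hxT
    have h1 := hx h _ hxT
    rw [← hr] at h1
    have h2 : ∀ i, |x i| ≤ r h := fun i =>
      (PiLp.norm_apply_le (WithLp.toLp 2 x : EuclideanSpace ℝ (Fin n)) i).trans h1
    exact ⟨fun i => (abs_le.1 (h2 i)).1, fun i => (abs_le.1 (h2 i)).2⟩
  have hfun : (fun x : Fin n → ℝ => if ∀ i ∈ Finset.univ, |a i (h, x)| ≤ b i (h, x)
      then (1 : ℝ) else 0) = T.indicator 1 := by
    ext x
    simp only [Finset.mem_univ, true_imp_iff, ha, hb, indicator, hT, slab, mem_ofPred_eq,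
      Pi.one_apply]
  rw [hfun, setIntegral_indicator hTm, inter_eq_self_of_subset_right hTsub]
  simp only [Pi.one_apply, integral_const, smul_eq_mul, mul_one, measureReal_restrict_apply_univ]
  have := (PiLp.volume_preserving_ofLp (Fin n)).measure_preimage hTm.nullMeasurableSet
  rw [slabVolume, measureReal_def, measureReal_def, ← this]
  rfl

/-- At an extreme point of an intersection of slabs the active normals span the space. -/
theorem eq_zero_of_mem_extremePoints_slab {h : ι → ℝ} {x y : EuclideanSpace ℝ (Fin n)}
    (hx : x ∈ (slab u h).extremePoints ℝ) (hy : ∀ i, |⟪x, u i⟫| = h i → ⟪y, u i⟫ = 0) : y = 0 := by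
  -- Moving by `±ε y` leaves the active constraints unchanged and the inactive ones satisfied for
  -- small `ε`, so `x` would be a proper midpoint if `y ≠ 0`.
  have hev : ∀ᶠ ε : ℝ in nhdsWithin 0 (Ioi 0), ∀ i, |⟪x + ε • y, u i⟫| ≤ h i ∧
      |⟪x - ε • y, u i⟫| ≤ h i := by
    rw [Filter.eventually_all]
    intro i
    rcases (hx.1 i).eq_or_lt with h1 | h1
    · filter_upwards with ε
      rw [inner_add_left, inner_sub_left, real_inner_smul_left, hy i h1, mul_zero, add_zero,
        sub_zero]
      exact ⟨h1.le, h1.le⟩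
    · refine Filter.Eventually.filter_mono nhdsWithin_le_nhds ?_
      refine Filter.Eventually.and ?_ ?_
      · have : ContinuousAt (fun ε : ℝ => |⟪x + ε • y, u i⟫|) 0 := by fun_prop
        exact (this.eventually_lt continuousAt_const (by simpa using h1)).mono fun _ h => le_of_lt h
      · have : ContinuousAt (fun ε : ℝ => |⟪x - ε • y, u i⟫|) 0 := by fun_prop
        exact (this.eventually_lt continuousAt_const (by simpa using h1)).mono fun _ h => le_of_lt h
  obtain ⟨ε, hε, hpos⟩ := (hev.and self_mem_nhdsWithin).exists
  have hmem := (mem_extremePoints.1 hx).2 (x + ε • y) (fun i => (hε i).1) (x - ε • y)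
    (fun i => (hε i).2) ⟨1 / 2, 1 / 2, by norm_num, by norm_num, by norm_num, by module⟩
  have : ε • y = 0 := by simpa using hmem.1
  exact (smul_eq_zero.1 this).resolve_left (ne_of_gt hpos)

/-- The extreme points of intersections of slabs are given by finitely many linear functions of the
widths. -/
theorem exists_finite_extremePoints (u : ι → EuclideanSpace ℝ (Fin n)) :
    ∃ T : Set ((ι → ℝ) →ₗ[ℝ] EuclideanSpace ℝ (Fin n)), T.Finite ∧
      ∀ h, ∀ x ∈ (slab u h).extremePoints ℝ, ∃ v ∈ T, v h = x := by
  classical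
  let Φ : ∀ I : Finset ι, EuclideanSpace ℝ (Fin n) →ₗ[ℝ] (I → ℝ) := fun I =>
    LinearMap.pi fun i => (innerₗ (EuclideanSpace ℝ (Fin n))).flip (u i)
  have hΦ : ∀ I x i, Φ I x i = ⟪x, u i⟫ := fun I x i => rfl
  have hex : ∀ I : Finset ι, ∃ Ψ : (I → ℝ) →ₗ[ℝ] EuclideanSpace ℝ (Fin n),
      LinearMap.ker (Φ I) = ⊥ → Ψ ∘ₗ Φ I = LinearMap.id := by
    intro I
    by_cases hI : LinearMap.ker (Φ I) = ⊥
    · obtain ⟨Ψ, hΨ⟩ := (Φ I).exists_leftInverse_of_injective hI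
      exact ⟨Ψ, fun _ => hΨ⟩
    · exact ⟨0, fun h => absurd h hI⟩
  choose Ψ hΨ using hex
  -- A vertex with active set `I` and signs `σ` solves `⟪x, u i⟫ = ±h i` for `i ∈ I`, hence is a
  -- linear function of the widths. There are finitely many pairs `(I, σ)`.
  let v : Finset ι × (ι → Bool) → (ι → ℝ) →ₗ[ℝ] EuclideanSpace ℝ (Fin n) := fun p =>
    Ψ p.1 ∘ₗ LinearMap.pi fun i : p.1 =>
      (if p.2 i then (1 : ℝ) else -1) • (LinearMap.proj (i : ι) : (ι → ℝ) →ₗ[ℝ] ℝ)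
  refine ⟨range v, finite_range v, fun h x hx => ?_⟩
  let I : Finset ι := Finset.univ.filter fun i => |⟪x, u i⟫| = h i
  let σ : ι → Bool := fun i => decide (0 ≤ ⟪x, u i⟫)
  refine ⟨_, ⟨(I, σ), rfl⟩, ?_⟩
  have hker : LinearMap.ker (Φ I) = ⊥ := by
    rw [LinearMap.ker_eq_bot']
    intro y hy
    refine eq_zero_of_mem_extremePoints_slab hx fun i hi => ?_
    have := congrFun hy ⟨i, by simp [I, hi]⟩
    exact this
  have h1 := congrArg (fun f => f x) (hΨ I hker)
  simp only [LinearMap.comp_apply, LinearMap.id_apply] at h1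
  rw [← h1]
  simp only [v, LinearMap.comp_apply]
  rw [h1]
  conv_rhs => rw [← h1]
  congr 1
  ext ⟨i, hi⟩
  have hi' : |⟪x, u i⟫| = h i := by simpa [I] using hi
  rw [hΦ]
  simp only [LinearMap.pi_apply, LinearMap.smul_apply, LinearMap.proj_apply, smul_eq_mul, σ,
    decide_eq_true_eq]
  rw [← hi']
  split_ifs with hs
  · rw [abs_of_nonneg hs, one_mul]
  · rw [abs_of_neg (not_le.1 hs)]
    ring

theorem finite_extremePoints_slab (u : ι → EuclideanSpace ℝ (Fin n)) (h : ι → ℝ) :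
    ((slab u h).extremePoints ℝ).Finite := by
  obtain ⟨T, hT, hex⟩ := exists_finite_extremePoints u
  refine (hT.image fun v => v h).subset fun x hx => ?_
  obtain ⟨v, hv, rfl⟩ := hex h x hx
  exact ⟨v, hv, rfl⟩

/-- Away from finitely many hyperplanes, intersections of slabs with widths in the same chamber
have additive Minkowski combinations and the same nonempty facets. -/
theorem IsFrame.exists_chamber_add (hu : IsFrame u) :
    ∃ S : Set ((ι → ℝ) →ₗ[ℝ] ℝ), S.Finite ∧ (∀ l ∈ S, l ≠ 0) ∧
      ∀ k h, (∀ i, 0 < k i) → (∀ i, 0 < h i) → (∀ l ∈ S, 0 < l h * l k) →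
        slab u (k + h) = slab u k + slab u h ∧
        ∀ i, (∃ x ∈ slab u k, ⟪x, u i⟫ = k i) → ∃ y ∈ slab u h, ⟪y, u i⟫ = h i := by
  obtain ⟨T, hT, hex⟩ := exists_finite_extremePoints u
  let a : ((ι → ℝ) →ₗ[ℝ] EuclideanSpace ℝ (Fin n)) → ι → ((ι → ℝ) →ₗ[ℝ] ℝ) := fun v i =>
    (innerₗ (EuclideanSpace ℝ (Fin n))).flip (u i) ∘ₗ v
  have ha : ∀ v i h, a v i h = ⟪v h, u i⟫ := fun _ _ _ => rfl
  -- The slack of the candidate vertex `v h` in the two inequalities of the `i`-th slab. The nonzero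
  -- slack forms cut out the hyperplanes, so in a chamber each candidate satisfies the same
  -- inequalities for all widths.
  let f : Bool → ι → ((ι → ℝ) →ₗ[ℝ] EuclideanSpace ℝ (Fin n)) → ((ι → ℝ) →ₗ[ℝ] ℝ) :=
    fun s i v => if s then LinearMap.proj i - a v i else LinearMap.proj i + a v i
  have hft : ∀ i v h, f true i v h = h i - ⟪v h, u i⟫ := fun _ _ _ => rfl
  have hff : ∀ i v h, f false i v h = h i + ⟪v h, u i⟫ := fun _ _ _ => rfl
  refine ⟨{l | l ≠ 0 ∧ l ∈ ⋃ s, ⋃ i, f s i '' T}, ?_, fun l hl => hl.1, ?_⟩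
  · exact (finite_iUnion fun s => finite_iUnion fun i => hT.image _).subset fun l hl => hl.2
  intro k h hk hh hsign
  have hsign' : ∀ v ∈ T, ∀ s i, f s i v = 0 ∨ 0 < f s i v h * f s i v k := by
    intro v hv s i
    rcases eq_or_ne (f s i v) 0 with h0 | h0
    · exact Or.inl h0
    · exact Or.inr (hsign _ ⟨h0, mem_iUnion.2 ⟨s, mem_iUnion.2 ⟨i, v, hv, rfl⟩⟩⟩)
  have hmem : ∀ v ∈ T, ∀ g, v g ∈ slab u g ↔ ∀ s i, 0 ≤ f s i v g := by
    intro v _ g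
    simp only [Bool.forall_bool, hft, hff, slab, mem_ofPred_eq, abs_le, ← forall_and]
    refine forall_congr' fun i => ?_
    constructor <;> rintro ⟨h1, h2⟩ <;> constructor <;> linarith
  constructor
  · apply Subset.antisymm
    · rw [← closure_convexHull_extremePoints (hu.isCompact_slab (k + h)) (convex_slab u (k + h))]
      refine closure_minimal (convexHull_min ?_ ((convex_slab u k).add (convex_slab u h)))
        ((hu.isCompact_slab k).add (hu.isCompact_slab h)).isClosed
      intro x hx
      obtain ⟨v, hv, rfl⟩ := hex _ x hx
      have h1 := (hmem v hv _).1 hx.1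
      -- The slacks at `k` and `h` have the same sign and a nonnegative sum, so both are
      -- nonnegative: the vertex `v (k + h)` splits as `v k + v h`.
      have h2 : ∀ s i, 0 ≤ f s i v k ∧ 0 ≤ f s i v h := by
        intro s i
        rcases hsign' v hv s i with h0 | h0
        · simp [h0]
        · have h3 := h1 s i
          rw [map_add] at h3
          rcases mul_pos_iff.1 h0 with h4 | h4
          · exact ⟨h4.2.le, h4.1.le⟩
          · linarith [h4.1, h4.2]
      rw [map_add]
      exact add_mem_add ((hmem v hv k).2 fun s i => (h2 s i).1)
        ((hmem v hv h).2 fun s i => (h2 s i).2)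
    · rintro _ ⟨x, hx, y, hy, rfl⟩ i
      dsimp only
      rw [inner_add_left]
      exact (abs_add_le _ _).trans (add_le_add (hx i) (hy i))
  · rintro i ⟨x₀, hx₀, hx₀i⟩
    -- An extreme point of the facet is a vertex of the whole body, hence of the form `v k` with `v
    -- ∈ T`.
    set F : Set (EuclideanSpace ℝ (Fin n)) := {x | x ∈ slab u k ∧ ⟪x, u i⟫ = k i} with hF
    have hFc : IsCompact F := (hu.isCompact_slab k).inter_right
      (isClosed_eq (by fun_prop) continuous_const)
    obtain ⟨x, hx⟩ := hFc.extremePoints_nonempty (E := EuclideanSpace ℝ (Fin n)) ⟨x₀, hx₀, hx₀i⟩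
    have hxe : x ∈ (slab u k).extremePoints ℝ := by
      rw [mem_extremePoints] at hx ⊢
      refine ⟨hx.1.1, fun y hy z hz hyz => ?_⟩
      have hy1 := (abs_le.1 (hy i)).2
      have hz1 := (abs_le.1 (hz i)).2
      obtain ⟨b, c, hb, hc, hbc, hsum⟩ := hyz
      have h1 : b * ⟪y, u i⟫ + c * ⟪z, u i⟫ = k i := by
        rw [← hx.1.2, ← hsum, inner_add_left, real_inner_smul_left, real_inner_smul_left]
      have h2 : b * k i + c * k i = k i := by rw [← add_mul, hbc, one_mul]
      have hyi : ⟪y, u i⟫ = k i := by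
        by_contra hne
        have := lt_of_le_of_ne hy1 hne
        linarith [mul_lt_mul_of_pos_left this hb, mul_le_mul_of_nonneg_left hz1 hc.le]
      have hzi : ⟪z, u i⟫ = k i := by
        by_contra hne
        have := lt_of_le_of_ne hz1 hne
        linarith [mul_lt_mul_of_pos_left this hc, mul_le_mul_of_nonneg_left hy1 hb.le]
      exact hx.2 y ⟨hy, hyi⟩ z ⟨hz, hzi⟩ ⟨b, c, hb, hc, hbc, hsum⟩
    obtain ⟨v, hv, rfl⟩ := hex _ x hxe
    refine ⟨v h, (hmem v hv h).2 fun s j => ?_, ?_⟩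
    · have h1 := (hmem v hv k).1 hxe.1 s j
      rcases hsign' v hv s j with h0 | h0
      · simp [h0]
      · exact (pos_of_mul_pos_left h0 h1).le
    -- A nonzero slack form cannot vanish at `k`, so this one is identically zero and the constraint
    -- is tight at `h` as well.
    · have h1 : f true i v k = 0 := by rw [hft, hx.1.2, sub_self]
      rcases hsign' v hv true i with h0 | h0
      · have := hft i v h
        rw [h0, LinearMap.zero_apply] at this
        linarith
      · rw [h1, mul_zero] at h0
        exact absurd h0 (lt_irrefl _)

end

/-! ### The volume of an intersection of slabs is continuously differentiable -/

/-- A function with continuous partial derivatives is differentiable. -/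
theorem hasFDerivAt_of_partial_deriv {ι : Type*} [Fintype ι] [DecidableEq ι] {F : (ι → ℝ) → ℝ}
    {g : ι → (ι → ℝ) → ℝ} {x : ι → ℝ}
    (hF : ∀ᶠ y in nhds x, ∀ i, HasDerivAt (fun s => F (Function.update y i s)) (g i y) (y i))
    (hg : ∀ i, ContinuousAt (g i) x) :
    HasFDerivAt F (∑ i, g i x • (ContinuousLinearMap.proj i : (ι → ℝ) →L[ℝ] ℝ)) x := by
  -- Pass from `x` to `y` one coordinate at a time; `s` is the set of coordinates already changed.
  have key : ∀ s : Finset ι, (fun y => F (s.piecewise y x) - F x - ∑ i ∈ s, g i x * (y i - x i))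
      =o[nhds x] fun y => y - x := by
    intro s
    induction s using Finset.induction_on with
    | empty => simp
    | insert a s ha ih =>
      suffices h : (fun y => F ((insert a s).piecewise y x) - F (s.piecewise y x)
          - g a x * (y a - x a)) =o[nhds x] fun y => y - x by
        refine (h.add ih).congr_left fun y => ?_
        rw [Finset.sum_insert ha]
        ring
      rw [Asymptotics.isLittleO_iff]
      intro ε hε
      have h1 : ∀ᶠ y in nhds x, |g a y - g a x| ≤ ε := by
        have := (hg a).eventually (Metric.closedBall_mem_nhds (g a x) hε)
        simpa only [Metric.mem_closedBall, Real.dist_eq] using this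
      obtain ⟨δ, hδ, hball⟩ := Metric.eventually_nhds_iff_ball.1 (hF.and h1)
      filter_upwards [Metric.ball_mem_nhds x hδ] with y hy
      set z := s.piecewise y x with hz
      have hza : z a = x a := by simp [hz, ha]
      have hyd : ∀ i, |y i - x i| < δ := fun i =>
        (norm_le_pi_norm (y - x) i).trans_lt (by simpa [dist_eq_norm] using hy)
      have hmem : ∀ t, |t - x a| < δ → Function.update z a t ∈ Metric.ball x δ := by
        intro t ht
        rw [Metric.mem_ball, dist_pi_lt_iff hδ]
        intro i
        rcases eq_or_ne i a with rfl | hi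
        · simpa [Real.dist_eq] using ht
        · rw [Function.update_of_ne hi, hz, Real.dist_eq]
          by_cases his : i ∈ s
          · simpa [his] using hyd i
          · simpa [his] using hδ
      have hins : (insert a s).piecewise y x = Function.update z a (y a) := by
        rw [hz, Finset.piecewise_insert]
      -- After subtracting the linear part, the derivative is at most `ε` in absolute value, and the
      -- mean value inequality bounds the increment.
      have hderiv : ∀ t ∈ Metric.ball (x a) δ, HasDerivWithinAt
          (fun t => F (Function.update z a t) - g a x * t)
          (g a (Function.update z a t) - g a x) (Metric.ball (x a) δ) t := by
        intro t ht
        have h2 := (hball _ (hmem t (by simpa [Real.dist_eq] using ht))).1 a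
        simp only [Function.update_idem, Function.update_self] at h2
        have h3 := h2.fun_sub ((hasDerivAt_id' t).const_mul (g a x))
        rw [mul_one] at h3
        exact h3.hasDerivWithinAt
      have hmv := (convex_ball (x a) δ).norm_image_sub_le_of_norm_hasDerivWithin_le
        (C := ε) hderiv (fun t ht => by
          simpa using (hball _ (hmem t (by simpa [Real.dist_eq] using ht))).2)
        (Metric.mem_ball_self hδ) (y := y a) (by simpa [Real.dist_eq] using hyd a)
      rw [hins]
      have hzx : Function.update z a (x a) = z := by rw [← hza, Function.update_eq_self]
      simp only [hzx] at hmv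
      calc _ = ‖F (Function.update z a (y a)) - g a x * y a - (F z - g a x * x a)‖ := by
            congr 1
            ring
        _ ≤ ε * ‖y a - x a‖ := hmv
        _ ≤ ε * ‖y - x‖ := by
            gcongr
            exact norm_le_pi_norm (y - x) a
  rw [hasFDerivAt_iff_isLittleO]
  refine (key Finset.univ).congr_left fun y => ?_
  simp

/-- Level sets of nonzero linear functionals are null. -/
theorem measure_levelSet_eq_zero {H : Type*} [NormedAddCommGroup H] [NormedSpace ℝ H]
    [FiniteDimensional ℝ H] [MeasurableSpace H] [BorelSpace H] (μ : Measure H)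
    [μ.IsAddHaarMeasure] {a : H →ₗ[ℝ] ℝ} (ha : a ≠ 0) (c : ℝ) : μ {y | a y = c} = 0 := by
  rcases Set.eq_empty_or_nonempty {y | a y = c} with h | ⟨y₀, hy₀⟩
  · rw [h, measure_empty]
  have h1 : {y | a y = c} = (AffineSubspace.mk' y₀ (LinearMap.ker a) : Set H) := by
    ext y
    simp only [mem_ofPred_eq] at hy₀ ⊢
    rw [SetLike.mem_coe, AffineSubspace.mem_mk', LinearMap.mem_ker, vsub_eq_sub, map_sub, hy₀,
      sub_eq_zero]
  rw [h1]
  refine Measure.addHaar_affineSubspace μ _ fun h => ha ?_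
  have h2 := congrArg AffineSubspace.direction h
  rw [AffineSubspace.direction_mk', AffineSubspace.direction_top] at h2
  exact LinearMap.ker_eq_top.1 h2

theorem ae_abs_add_ne {H : Type*} [NormedAddCommGroup H] [NormedSpace ℝ H]
    [FiniteDimensional ℝ H] [MeasurableSpace H] [BorelSpace H] (μ : Measure H)
    [μ.IsAddHaarMeasure] {a : H →ₗ[ℝ] ℝ} (ha : a ≠ 0) (b c : ℝ) :
    ∀ᵐ y ∂μ, |a y + c| ≠ b := by
  have h1 := compl_mem_ae_iff.2 (measure_levelSet_eq_zero μ ha (b - c))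
  have h2 := compl_mem_ae_iff.2 (measure_levelSet_eq_zero μ ha (-b - c))
  filter_upwards [h1, h2] with y hy1 hy2 heq
  simp only [mem_compl_iff, mem_ofPred_eq] at hy1 hy2
  rcases abs_choice (a y + c) with h | h
  · exact hy1 (by linarith)
  · exact hy2 (by linarith)

/-- The volume of a bounded polyhedron is continuous in its parameters. -/
theorem continuous_measure_polyhedron {X H κ : Type*} [TopologicalSpace X]
    [FirstCountableTopology X] [NormedAddCommGroup H] [NormedSpace ℝ H] [FiniteDimensional ℝ H]
    [MeasurableSpace H] [BorelSpace H] (μ : Measure H) [μ.IsAddHaarMeasure] [Fintype κ]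
    (a : κ → H →ₗ[ℝ] ℝ) (ha : ∀ j, a j ≠ 0) (C : ℝ) (hC : 0 ≤ C)
    (hbound : ∀ y, ‖y‖ ≤ C * ∑ j, |a j y|) (c b : κ → X → ℝ) (hc : ∀ j, Continuous (c j))
    (hb : ∀ j, Continuous (b j)) :
    Continuous fun x => μ.real {y | ∀ j, |a j y + c j x| ≤ b j x} := by
  have haj : ∀ j, Continuous (a j) := fun j => (LinearMap.toContinuousLinearMap (a j)).continuous
  have hmeas : ∀ x, MeasurableSet {y | ∀ j, |a j y + c j x| ≤ b j x} := by
    intro x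
    simp only [ofPred_forall]
    refine MeasurableSet.iInter fun j => (isClosed_le ?_ continuous_const).measurableSet
    exact ((haj j).add continuous_const).abs
  have hint : (fun x => μ.real {y | ∀ j, |a j y + c j x| ≤ b j x}) =
      fun x => ∫ y, {y | ∀ j, |a j y + c j x| ≤ b j x}.indicator (fun _ => (1 : ℝ)) y ∂μ := by
    ext x
    rw [integral_indicator (hmeas x)]
    simp
  rw [hint, continuous_iff_continuousAt]
  intro x₀
  -- All polyhedra with parameters near `x₀` lie in the ball of radius `R`, whose indicator
  -- dominates theirs.
  set R : ℝ := C * ∑ j, (|b j x₀| + |c j x₀| + 1) with hR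
  refine continuousAt_of_dominated (bound := (Metric.closedBall 0 R).indicator fun _ => (1 : ℝ))
    (Filter.Eventually.of_forall fun x =>
      (measurable_const.indicator (hmeas x)).aestronglyMeasurable) ?_ ?_ ?_
  · have : ∀ᶠ x in nhds x₀, ∀ j, |b j x| + |c j x| < |b j x₀| + |c j x₀| + 1 := by
      rw [Filter.eventually_all]
      intro j
      exact (Continuous.continuousAt (f := fun x => |b j x| + |c j x|)
        ((hb j).abs.add (hc j).abs)).eventually_lt continuousAt_const (lt_add_one _)
    filter_upwards [this] with x hx
    refine Filter.Eventually.of_forall fun y => ?_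
    by_cases hy : y ∈ {y | ∀ j, |a j y + c j x| ≤ b j x}
    · have hyR : y ∈ Metric.closedBall (0 : H) R := by
        rw [mem_closedBall_zero_iff]
        refine (hbound y).trans ?_
        rw [hR]
        gcongr with j
        have h1 := hy j
        have h2 : |a j y| ≤ |a j y + c j x| + |c j x| := by
          have := abs_sub (a j y + c j x) (c j x)
          rwa [add_sub_cancel_right] at this
        have h3 := le_abs_self (b j x)
        linarith [hx j]
      rw [indicator_of_mem hy, indicator_of_mem hyR, norm_one]
    · rw [indicator_of_notMem hy, norm_zero]
      exact indicator_nonneg (fun _ _ => zero_le_one) _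
  · rw [integrable_indicator_iff Metric.isClosed_closedBall.measurableSet]
    exact integrableOn_const (isCompact_closedBall 0 R).measure_lt_top.ne
  -- Off the null set of bounding hyperplanes, membership of `y` is locally constant in the
  -- parameter.
  · have hnull : ∀ᵐ y ∂μ, ∀ j, |a j y + c j x₀| ≠ b j x₀ := by
      rw [ae_all_iff]
      intro j
      exact ae_abs_add_ne μ (ha j) _ _
    filter_upwards [hnull] with y hy
    have hcont : ∀ j, Continuous fun x => |a j y + c j x| := fun j =>
      (continuous_const.add (hc j)).abs
    by_cases hmem : ∀ j, |a j y + c j x₀| ≤ b j x₀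
    · have hev : ∀ᶠ x in nhds x₀, ∀ j, |a j y + c j x| < b j x := by
        rw [Filter.eventually_all]
        exact fun j => (hcont j).continuousAt.eventually_lt (hb j).continuousAt
          (lt_of_le_of_ne (hmem j) (hy j))
      refine (continuousAt_const (y := (1 : ℝ))).congr (hev.mono fun x hx => ?_)
      exact (indicator_of_mem (s := {y | ∀ j, |a j y + c j x| ≤ b j x}) (f := fun _ => (1 : ℝ))
        (fun j => (hx j).le)).symm
    · push Not at hmem
      obtain ⟨j, hj⟩ := hmem
      have hev : ∀ᶠ x in nhds x₀, b j x < |a j y + c j x| :=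
        (hb j).continuousAt.eventually_lt (hcont j).continuousAt hj
      refine (continuousAt_const (y := (0 : ℝ))).congr (hev.mono fun x hx => ?_)
      exact (indicator_of_notMem (s := {y | ∀ j, |a j y + c j x| ≤ b j x})
        (f := fun _ => (1 : ℝ)) (fun h => absurd (h j) (not_le.2 hx))).symm

/-! ### Slices orthogonal to a normal, Fubini, and the gradient of the volume. -/

section

variable {n : ℕ} {ι : Type} [Fintype ι] {u : ι → EuclideanSpace ℝ (Fin n)}

/-- The projection to `(u i)ᗮ` of the slice of `slab u h` at height `s` in the direction `u i`,
disregarding the constraint with index `i`. -/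
def slice {ι : Type} (u : ι → EuclideanSpace ℝ (Fin n)) (i : ι) (s : ℝ) (h : ι → ℝ) :
    Set (Submodule.span ℝ {u i})ᗮ :=
  {y | ∀ j : {j // j ≠ i}, |⟪(y : EuclideanSpace ℝ (Fin n)), u j⟫ + s * ⟪u i, u j⟫| ≤ h j}

/-- The `(n - 1)`-dimensional volume of a slice. -/
def sliceVolume {ι : Type} (u : ι → EuclideanSpace ℝ (Fin n)) (i : ι) (s : ℝ) (h : ι → ℝ) : ℝ :=
  volume.real (slice u i s h)

/-- A form `⟪·, u j⟫` vanishing on `(u i)ᗮ` would make the unit vector `u j` a multiple of `u i`,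
hence `±u i`. This makes the boundaries of slices null sets. -/
theorem IsFrame.inner_restrict_ne_zero {ι : Type} {u : ι → EuclideanSpace ℝ (Fin n)}
    (hu : IsFrame u) {i j : ι} (hij : j ≠ i) :
    (innerₗ (EuclideanSpace ℝ (Fin n))).flip (u j) ∘ₗ (Submodule.span ℝ {u i})ᗮ.subtype ≠ 0 := by
  intro h
  have h1 : u j ∈ (Submodule.span ℝ {u i})ᗮᗮ := by
    rw [Submodule.mem_orthogonal]
    intro y hy
    exact congrArg (fun f => f ⟨y, hy⟩) h
  rw [Submodule.orthogonal_orthogonal, Submodule.mem_span_singleton] at h1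
  obtain ⟨c, hc⟩ := h1
  have h2 := congrArg norm hc
  rw [norm_smul, hu.norm_eq, hu.norm_eq, mul_one, Real.norm_eq_abs, abs_eq zero_le_one] at h2
  rcases h2 with rfl | rfl
  · exact hu.ne j i hij (by rw [← hc, one_smul])
  · exact hu.ne_neg j i hij (by rw [← hc, neg_one_smul])

/-- Dropping constraint `i` is what gives continuity even at the facet heights `s = ±h i`: the true
section would jump to the empty set there. -/
theorem IsFrame.continuous_sliceVolume (hu : IsFrame u) (i : ι) :
    Continuous fun z : ℝ × (ι → ℝ) => sliceVolume u i z.1 z.2 := by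
  classical
  obtain ⟨C, hC, hbd⟩ := hu.exists_norm_le
  refine continuous_measure_polyhedron (X := ℝ × (ι → ℝ)) (κ := {j // j ≠ i}) volume
    (fun j => (innerₗ (EuclideanSpace ℝ (Fin n))).flip (u j) ∘ₗ
      (Submodule.span ℝ {u i})ᗮ.subtype)
    (fun j => hu.inner_restrict_ne_zero j.2) C hC (fun y => ?_)
    (fun j z => z.1 * ⟪u i, u j⟫) (fun j z => z.2 j) (fun j => by fun_prop) (fun j => by fun_prop)
  refine (hbd y).trans_eq ?_
  congr 1
  have hyi : ⟪(y : EuclideanSpace ℝ (Fin n)), u i⟫ = 0 :=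
    Submodule.inner_left_of_mem_orthogonal (Submodule.mem_span_singleton_self _) y.2
  rw [← Finset.sum_erase_add _ _ (Finset.mem_univ i), hyi, abs_zero, add_zero]
  refine Finset.sum_bij' (fun j hj => (⟨j, Finset.ne_of_mem_erase hj⟩ : {j // j ≠ i}))
    (fun j _ => (j : ι)) (by simp) (fun j _ => by simpa using j.2) (by simp) (by simp)
    (fun j _ => rfl)

theorem IsFrame.volume_slice_lt_top (hu : IsFrame u) (i : ι) (s : ℝ) (h : ι → ℝ) :
    volume (slice u i s h) < ⊤ := by
  obtain ⟨C, hC, hbd⟩ := hu.exists_slab_subset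
  classical
  have : slice u i s h ⊆ Metric.closedBall 0
      (C * ∑ j, Function.update (fun j => h j + |s * ⟪u i, u j⟫|) i 0 j) := by
    intro y hy
    rw [mem_closedBall_zero_iff]
    refine hbd _ (y : EuclideanSpace ℝ (Fin n)) fun j => ?_
    rcases eq_or_ne j i with rfl | hj
    · have hyi : ⟪(y : EuclideanSpace ℝ (Fin n)), u j⟫ = 0 :=
        Submodule.inner_left_of_mem_orthogonal (Submodule.mem_span_singleton_self _) y.2
      simp [hyi]
    · rw [Function.update_of_ne hj]
      have h1 := hy ⟨j, hj⟩
      have h2 := abs_sub (⟪(y : EuclideanSpace ℝ (Fin n)), u j⟫ + s * ⟪u i, u j⟫) (s * ⟪u i, u j⟫)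
      rw [add_sub_cancel_right] at h2
      simp only at h1
      linarith
  exact (measure_mono this).trans_lt (isCompact_closedBall _ _).measure_lt_top

/-- The Hausdorff measure of a subset of the hyperplane at height `s` in the direction `u i`. -/
theorem IsFrame.hausdorffMeasure_image_slice {ι : Type} {u : ι → EuclideanSpace ℝ (Fin n)}
    (hu : IsFrame u) (i : ι) (s : ℝ) (T : Set (Submodule.span ℝ {u i})ᗮ) :
    (μHE[n - 1] : Measure (EuclideanSpace ℝ (Fin n)))
      ((fun y : (Submodule.span ℝ {u i})ᗮ => (y : EuclideanSpace ℝ (Fin n)) + s • u i) '' T) =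
      volume T := by
  have hiso : Isometry fun y : (Submodule.span ℝ {u i})ᗮ =>
      (y : EuclideanSpace ℝ (Fin n)) + s • u i :=
    (isometry_add_right (s • u i)).comp isometry_subtype_coe
  have hne : u i ≠ 0 := by
    rw [← norm_ne_zero_iff, hu.norm_eq]
    exact one_ne_zero
  have hrank : n - 1 = Module.finrank ℝ (Submodule.span ℝ {u i})ᗮ := by
    have h1 := (Submodule.span ℝ {u i}).finrank_add_finrank_orthogonal
    rw [finrank_span_singleton hne, finrank_euclideanSpace_fin] at h1
    omega
  rw [hiso.euclideanHausdorffMeasure_image, hrank,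
    InnerProductSpace.euclideanHausdorffMeasure_eq_volume]

theorem IsFrame.slab_inter_eq {ι : Type} {u : ι → EuclideanSpace ℝ (Fin n)}
    (hu : IsFrame u) (i : ι) {s : ℝ} {h : ι → ℝ} (hs : |s| ≤ h i) :
    {x | x ∈ slab u h ∧ ⟪x, u i⟫ = s} =
      (fun y : (Submodule.span ℝ {u i})ᗮ => (y : EuclideanSpace ℝ (Fin n)) + s • u i) ''
        slice u i s h := by
  have hii : ⟪u i, u i⟫ = 1 := by rw [real_inner_self_eq_norm_sq, hu.norm_eq, one_pow]
  ext x
  constructor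
  · rintro ⟨hx, hxs⟩
    refine ⟨⟨x - s • u i, ?_⟩, fun j => ?_, by simp⟩
    · rw [Submodule.mem_orthogonal_singleton_iff_inner_left, inner_sub_left, real_inner_smul_left,
        hii, hxs, mul_one, sub_self]
    · simp only [inner_sub_left, real_inner_smul_left, sub_add_cancel]
      exact hx j
  · rintro ⟨y, hy, rfl⟩
    have hyi : ⟪(y : EuclideanSpace ℝ (Fin n)), u i⟫ = 0 :=
      Submodule.inner_left_of_mem_orthogonal (Submodule.mem_span_singleton_self _) y.2
    have hval : ⟪(y : EuclideanSpace ℝ (Fin n)) + s • u i, u i⟫ = s := by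
      rw [inner_add_left, real_inner_smul_left, hii, hyi, zero_add, mul_one]
    refine ⟨fun j => ?_, hval⟩
    rcases eq_or_ne j i with rfl | hj
    · simp only [hval]
      exact hs
    · simp only [inner_add_left, real_inner_smul_left]
      exact hy ⟨j, hj⟩

/-- Fubini's theorem in the direction `u i`. -/
theorem IsFrame.slabVolume_eq_integral (hu : IsFrame u) (i : ι) {h : ι → ℝ} (hi : 0 ≤ h i) :
    slabVolume u h = ∫ s in -h i..h i, sliceVolume u i s h := by
  have hne : u i ≠ 0 := by
    rw [← norm_ne_zero_iff, hu.norm_eq]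
    exact one_ne_zero
  -- The indicator restores the constraint `i`, which `sliceVolume` disregards.
  have hvol : (volume : Measure (EuclideanSpace ℝ (Fin n))) (slab u h) =
      ∫⁻ s, ENNReal.ofReal ((Icc (-h i) (h i)).indicator (fun s => sliceVolume u i s h) s) := by
    have h1 := EuclideanGeometry.euclideanHausdorffMeasure_eq_lintegral
      (0 : EuclideanSpace ℝ (Fin n)) hne (measurableSet_slab u h)
    rw [InnerProductSpace.euclideanHausdorffMeasure_eq_volume] at h1
    rw [h1]
    have h2 : ‖u i‖ₑ = 1 := by rw [← ofReal_norm, hu.norm_eq, ENNReal.ofReal_one]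
    rw [h2, one_mul]
    refine lintegral_congr fun s => ?_
    have hplane : slab u h ∩ (AffineSubspace.mk' (s • u i +ᵥ (0 : EuclideanSpace ℝ (Fin n)))
        (Submodule.span ℝ {u i})ᗮ : Set (EuclideanSpace ℝ (Fin n))) =
        {x | x ∈ slab u h ∧ ⟪x, u i⟫ = s} := by
      ext x
      refine and_congr_right fun _ => ?_
      have hii : ⟪u i, u i⟫ = 1 := by rw [real_inner_self_eq_norm_sq, hu.norm_eq, one_pow]
      rw [SetLike.mem_coe, AffineSubspace.mem_mk', vsub_eq_sub, vadd_eq_add, add_zero,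
        Submodule.mem_orthogonal_singleton_iff_inner_left, inner_sub_left, real_inner_smul_left,
        hii, mul_one, sub_eq_zero]
    rw [hplane, finrank_euclideanSpace_fin]
    by_cases hs : |s| ≤ h i
    · rw [hu.slab_inter_eq i hs, hu.hausdorffMeasure_image_slice,
        indicator_of_mem (show s ∈ Icc (-h i) (h i) from abs_le.1 hs), sliceVolume,
        ofReal_measureReal (hu.volume_slice_lt_top i s h).ne]
    · rw [indicator_of_notMem (show s ∉ Icc (-h i) (h i) from fun hmem => hs (abs_le.2 hmem)), ENNReal.ofReal_zero]
      convert measure_empty (μ := (μHE[n - 1] : Measure (EuclideanSpace ℝ (Fin n))))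
      refine eq_empty_iff_forall_notMem.2 fun x hx => hs ?_
      have := hx.1 i
      rwa [hx.2] at this
  have hcont : Continuous fun s => sliceVolume u i s h :=
    (hu.continuous_sliceVolume i).comp (continuous_id.prodMk continuous_const)
  rw [slabVolume, measureReal_def, hvol, ← integral_eq_lintegral_of_nonneg_ae,
    integral_indicator measurableSet_Icc, integral_Icc_eq_integral_Ioc,
    intervalIntegral.integral_of_le (by linarith)]
  · exact Filter.Eventually.of_forall fun s =>
      indicator_nonneg (fun _ _ => measureReal_nonneg) _
  · exact (hcont.measurable.indicator measurableSet_Icc).aestronglyMeasurable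

/-- The sum of the areas of the two facets orthogonal to `u i`. -/
def facetArea {ι : Type} (u : ι → EuclideanSpace ℝ (Fin n)) (i : ι) (h : ι → ℝ) : ℝ :=
  sliceVolume u i (h i) h + sliceVolume u i (-h i) h

theorem IsFrame.continuous_facetArea (hu : IsFrame u) (i : ι) : Continuous (facetArea u i) :=
  Continuous.add
    ((hu.continuous_sliceVolume i).comp
      (Continuous.prodMk (f := fun h : ι → ℝ => h i) (continuous_apply i) continuous_id))
    ((hu.continuous_sliceVolume i).comp
      (Continuous.prodMk (f := fun h : ι → ℝ => -h i) (continuous_apply i).neg continuous_id))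

theorem sliceVolume_update {ι : Type} [DecidableEq ι] (u : ι → EuclideanSpace ℝ (Fin n)) (i : ι)
    (s t : ℝ) (h : ι → ℝ) : sliceVolume u i s (Function.update h i t) = sliceVolume u i s h := by
  have : slice u i s (Function.update h i t) = slice u i s h := by
    ext y
    refine forall_congr' fun j => ?_
    rw [Function.update_of_ne j.2]
  rw [sliceVolume, this, sliceVolume]

/-- In Fubini's formula `∫ s in -h i..h i` the integrand does not depend on `h i`, so the partial
derivative is the sum of its two endpoint values. These are continuous in `h`, which gives total
differentiability. -/
theorem IsFrame.hasFDerivAt_slabVolume (hu : IsFrame u) {h : ι → ℝ} (hh : ∀ i, 0 < h i) :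
    HasFDerivAt (slabVolume u)
      (∑ i, facetArea u i h • (ContinuousLinearMap.proj i : (ι → ℝ) →L[ℝ] ℝ)) h := by
  classical
  refine hasFDerivAt_of_partial_deriv ?_ fun i => (hu.continuous_facetArea i).continuousAt
  have hev : ∀ᶠ y in nhds h, ∀ i, 0 < y i := by
    rw [Filter.eventually_all]
    exact fun i => (continuous_apply i).continuousAt.eventually (lt_mem_nhds (hh i))
  filter_upwards [hev] with y hy i
  have hcont : Continuous fun s => sliceVolume u i s y :=
    (hu.continuous_sliceVolume i).comp (continuous_id.prodMk continuous_const)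
  have h1 : (fun s => slabVolume u (Function.update y i s)) =ᶠ[nhds (y i)]
      fun s => ∫ t in -s..s, sliceVolume u i t y := by
    filter_upwards [lt_mem_nhds (hy i)] with s hs
    rw [hu.slabVolume_eq_integral i (by simpa using hs.le)]
    simp only [Function.update_self, sliceVolume_update]
  refine HasDerivAt.congr_of_eventuallyEq ?_ h1
  have h2 : ∀ s : ℝ, ∫ t in -s..s, sliceVolume u i t y =
      (∫ t in (0 : ℝ)..s, sliceVolume u i t y) - ∫ t in (0 : ℝ)..-s, sliceVolume u i t y := by
    intro s
    rw [intervalIntegral.integral_interval_sub_left (hcont.intervalIntegrable _ _)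
      (hcont.intervalIntegrable _ _)]
  simp only [h2]
  have h3 : ∀ s : ℝ, HasDerivAt (fun s => ∫ t in (0 : ℝ)..s, sliceVolume u i t y)
      (sliceVolume u i s y) s := fun s => intervalIntegral.integral_hasDerivAt_right
    (hcont.intervalIntegrable _ _) (hcont.stronglyMeasurableAtFilter _ _) hcont.continuousAt
  have h4 := (h3 (y i)).fun_sub ((h3 (-y i)).comp (y i) (hasDerivAt_neg (y i)))
  rw [mul_neg_one, sub_neg_eq_add] at h4
  exact h4

end

/-! ### Support functions -/

section

variable {n : ℕ}

theorem le_supportFn {K : Set (EuclideanSpace ℝ (Fin n))} (hK : IsCompact K)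
    {y : EuclideanSpace ℝ (Fin n)} (hy : y ∈ K) (w : EuclideanSpace ℝ (Fin n)) :
    ⟪y, w⟫ ≤ supportFn K w :=
  le_csSup (hK.image (by fun_prop)).bddAbove ⟨y, hy, rfl⟩

theorem supportFn_le {K : Set (EuclideanSpace ℝ (Fin n))} (hK : K.Nonempty)
    {w : EuclideanSpace ℝ (Fin n)} {c : ℝ} (h : ∀ y ∈ K, ⟪y, w⟫ ≤ c) : supportFn K w ≤ c :=
  csSup_le (hK.image _) (by rintro _ ⟨y, hy, rfl⟩; exact h y hy)

theorem supportFn_eq {K : Set (EuclideanSpace ℝ (Fin n))} (hK : IsCompact K)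
    {x w : EuclideanSpace ℝ (Fin n)} (hx : x ∈ K) (h : ∀ y ∈ K, ⟪y, w⟫ ≤ ⟪x, w⟫) :
    supportFn K w = ⟪x, w⟫ :=
  le_antisymm (supportFn_le ⟨x, hx⟩ h) (le_supportFn hK hx w)

theorem exists_eq_supportFn {K : Set (EuclideanSpace ℝ (Fin n))} (hK : IsCompact K)
    (hne : K.Nonempty) (w : EuclideanSpace ℝ (Fin n)) : ∃ x ∈ K, ⟪x, w⟫ = supportFn K w := by
  obtain ⟨x, hx, h⟩ := hK.exists_isMaxOn hne
    (f := fun y : EuclideanSpace ℝ (Fin n) => ⟪y, w⟫) (by fun_prop)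
  exact ⟨x, hx, (supportFn_eq hK hx h).symm⟩

theorem IsSymmConvexBody.neg_mem {K : Set (EuclideanSpace ℝ (Fin n))} (hK : IsSymmConvexBody K)
    {x : EuclideanSpace ℝ (Fin n)} (hx : x ∈ K) : -x ∈ K := by
  rw [← hK.symm] at hx
  exact hx

theorem IsSymmConvexBody.zero_mem_interior {K : Set (EuclideanSpace ℝ (Fin n))}
    (hK : IsSymmConvexBody K) : (0 : EuclideanSpace ℝ (Fin n)) ∈ interior K := by
  obtain ⟨x, hx⟩ := hK.nonempty_interior
  have hx' : -x ∈ interior K := by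
    have h1 := (Homeomorph.neg (EuclideanSpace ℝ (Fin n))).preimage_interior K
    have h2 : (Homeomorph.neg (EuclideanSpace ℝ (Fin n))) ⁻¹' K = K := hK.symm
    rw [h2] at h1
    rw [← h1] at hx
    exact hx
  have := hK.convex.interior hx hx' (a := 1 / 2) (b := 1 / 2) (by norm_num) (by norm_num)
    (by norm_num)
  simpa using this

theorem IsSymmConvexBody.nonempty {K : Set (EuclideanSpace ℝ (Fin n))}
    (hK : IsSymmConvexBody K) : K.Nonempty :=
  ⟨0, interior_subset hK.zero_mem_interior⟩

theorem IsSymmConvexBody.supportFn_neg {K : Set (EuclideanSpace ℝ (Fin n))}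
    (hK : IsSymmConvexBody K) (w : EuclideanSpace ℝ (Fin n)) :
    supportFn K (-w) = supportFn K w := by
  have key : ∀ w, supportFn K (-w) ≤ supportFn K w := by
    intro w
    refine supportFn_le hK.nonempty fun y hy => ?_
    rw [inner_neg_right, ← inner_neg_left]
    exact le_supportFn hK.isCompact (hK.neg_mem hy) w
  refine le_antisymm (key w) ?_
  simpa using key (-w)

theorem IsSymmConvexBody.supportFn_pos {K : Set (EuclideanSpace ℝ (Fin n))}
    (hK : IsSymmConvexBody K) {w : EuclideanSpace ℝ (Fin n)} (hw : w ≠ 0) :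
    0 < supportFn K w := by
  have hcont : ContinuousAt (fun t : ℝ => t • w) 0 := by fun_prop
  have h1 : ∀ᶠ t : ℝ in nhdsWithin 0 (Ioi 0), t • w ∈ K := by
    refine Filter.Eventually.filter_mono nhdsWithin_le_nhds (hcont.eventually ?_)
    dsimp only
    rw [zero_smul]
    exact mem_interior_iff_mem_nhds.1 hK.zero_mem_interior
  obtain ⟨t, ht, htpos⟩ := (h1.and self_mem_nhdsWithin).exists
  refine lt_of_lt_of_le ?_ (le_supportFn hK.isCompact ht w)
  rw [real_inner_smul_left]
  exact mul_pos htpos (real_inner_self_pos.2 hw)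

end

/-! ### The surface area measure of an intersection of slabs -/

section

variable {n : ℕ} {ι : Type} [Fintype ι] {u : ι → EuclideanSpace ℝ (Fin n)}

/-- The relative interior of a facet consists of regular boundary points. -/
theorem IsFrame.isUnitNormal_iff_of_mem_facet (hu : IsFrame u) {k : ι → ℝ} (hk : ∀ i, 0 < k i)
    {i : ι} {ε : ℝ} (hε : ε = 1 ∨ ε = -1) {x : EuclideanSpace ℝ (Fin n)}
    (hxi : ⟪x, u i⟫ = ε * k i) (hxj : ∀ j ≠ i, |⟪x, u j⟫| < k j) :
    x ∈ frontier (slab u k) ∧ ∀ w, IsUnitNormal (slab u k) x w ↔ w = ε • u i := by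
  have hii : ⟪u i, u i⟫ = 1 := by rw [real_inner_self_eq_norm_sq, hu.norm_eq, one_pow]
  have hεε : ε * ε = 1 := by rcases hε with rfl | rfl <;> norm_num
  have habs : |ε| = 1 := by rcases hε with rfl | rfl <;> norm_num
  have hx : x ∈ slab u k := by
    intro j
    rcases eq_or_ne j i with rfl | hj
    · rw [hxi, abs_mul, habs, one_mul, abs_of_pos (hk j)]
    · exact (hxj j hj).le
  have hcpt := hu.isCompact_slab k
  have hle : ∀ y ∈ slab u k, ⟪y, ε • u i⟫ ≤ k i := by
    intro y hy
    rw [real_inner_smul_right]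
    refine (le_abs_self _).trans ?_
    rw [abs_mul, habs, one_mul]
    exact hy i
  have hxε : ⟪x, ε • u i⟫ = k i := by rw [real_inner_smul_right, hxi, ← mul_assoc, hεε, one_mul]
  constructor
  · rw [(isClosed_slab u k).frontier_eq]
    refine ⟨hx, fun hint => ?_⟩
    have hcont : ContinuousAt (fun t : ℝ => x + t • (ε • u i)) 0 := by fun_prop
    have h1 : ∀ᶠ t : ℝ in nhdsWithin 0 (Ioi 0), x + t • (ε • u i) ∈ slab u k := by
      refine Filter.Eventually.filter_mono nhdsWithin_le_nhds (hcont.eventually ?_)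
      dsimp only
      rw [zero_smul, add_zero]
      exact mem_interior_iff_mem_nhds.1 hint
    obtain ⟨t, ht, htpos⟩ := (h1.and self_mem_nhdsWithin).exists
    have h2 := hle _ ht
    rw [inner_add_left, hxε, real_inner_smul_left, real_inner_smul_left, real_inner_smul_right,
      hii, mul_one, hεε, mul_one] at h2
    have : (0 : ℝ) < t := htpos
    linarith
  · intro w
    constructor
    · rintro ⟨hw, hsupp⟩
      have hmax : ∀ y ∈ slab u k, ⟪y, w⟫ ≤ ⟪x, w⟫ := fun y hy => by
        rw [← hsupp]
        exact le_supportFn hcpt hy w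
      set c := ⟪w, u i⟫ with hc
      -- Moving from `x` along `z ⊥ u i` stays in the facet for a short time. As `w` is maximal at
      -- `x`, this forces `⟪z, w⟫ = ‖z‖ ^ 2 ≤ 0`.
      set z := w - c • u i with hz
      have hzi : ⟪z, u i⟫ = 0 := by
        rw [hz, inner_sub_left, real_inner_smul_left, hii, mul_one, ← hc, sub_self]
      have hzw : ⟪z, w⟫ = ⟪z, z⟫ := by
        conv_rhs => rw [hz, inner_sub_right, ← hz, real_inner_smul_right, hzi, mul_zero, sub_zero]
      have h1 : ∀ᶠ t : ℝ in nhdsWithin 0 (Ioi 0), x + t • z ∈ slab u k := by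
        simp only [slab, mem_ofPred_eq]
        rw [Filter.eventually_all]
        intro j
        rcases eq_or_ne j i with rfl | hj
        · filter_upwards with t
          rw [inner_add_left, real_inner_smul_left, hzi, mul_zero, add_zero]
          exact hx j
        · refine Filter.Eventually.filter_mono nhdsWithin_le_nhds ?_
          have : ContinuousAt (fun t : ℝ => |⟪x + t • z, u j⟫|) 0 := by fun_prop
          exact (this.eventually_lt continuousAt_const (by simpa using hxj j hj)).mono
            fun _ h => le_of_lt h
      obtain ⟨t, ht, htpos⟩ := (h1.and self_mem_nhdsWithin).exists
      have h2 := hmax _ ht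
      rw [inner_add_left, real_inner_smul_left, hzw] at h2
      have h3 : ⟪z, z⟫ ≤ 0 := by
        have : (0 : ℝ) < t := htpos
        by_contra hpos
        push Not at hpos
        linarith [mul_pos this hpos]
      have hz0 : z = 0 := by rwa [real_inner_self_eq_norm_sq, sq_nonpos_iff, norm_eq_zero] at h3
      have hwc : w = c • u i := sub_eq_zero.1 hz0
      have hcabs : |c| = 1 := by
        have := congrArg norm hwc
        rw [norm_smul, hu.norm_eq, hw, mul_one, Real.norm_eq_abs] at this
        exact this.symm
      have hcε : c = ε ∨ c = -ε := by
        rcases hε with rfl | rfl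
        · exact (abs_eq zero_le_one).1 hcabs
        · rw [neg_neg]
          exact ((abs_eq zero_le_one).1 hcabs).symm
      rcases hcε with h | h
      · rw [hwc, h]
      · exfalso
        -- With the wrong sign, `⟪·, w⟫` would be smaller at `x` than at the origin.
        have h4 := hmax 0 (zero_mem_slab fun i => (hk i).le)
        rw [inner_zero_left, hwc, h, neg_smul, inner_neg_right, hxε] at h4
        linarith [hk i]
    · rintro rfl
      refine ⟨by rw [norm_smul, hu.norm_eq, mul_one, Real.norm_eq_abs, habs], ?_⟩
      exact supportFn_eq hcpt hx fun y hy => (hle y hy).trans_eq hxε.symm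

/-- Up to a null set a facet consists of points where no other constraint is active, and there the
Gauss map is constant. Only this lower bound on the atoms is needed, because `1 - p > 0`. -/
theorem IsFrame.le_surfaceAreaMeasure (hu : IsFrame u) {k : ι → ℝ} (hk : ∀ i, 0 < k i) (i : ι)
    {ε : ℝ} (hε : ε = 1 ∨ ε = -1) :
    volume (slice u i (ε * k i) k) ≤ surfaceAreaMeasure (slab u k) {ε • u i} := by
  set T : Set (Submodule.span ℝ {u i})ᗮ := {y | ∀ j : {j // j ≠ i},
    |⟪(y : EuclideanSpace ℝ (Fin n)), u j⟫ + (ε * k i) * ⟪u i, u j⟫| < k j} with hT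
  have h1 : volume (slice u i (ε * k i) k) ≤ volume T := by
    refine measure_mono_ae ?_
    have : ∀ᵐ y : (Submodule.span ℝ {u i})ᗮ, ∀ j : {j // j ≠ i},
        |⟪(y : EuclideanSpace ℝ (Fin n)), u j⟫ + (ε * k i) * ⟪u i, u j⟫| ≠ k j := by
      rw [ae_all_iff]
      exact fun j => ae_abs_add_ne volume (hu.inner_restrict_ne_zero j.2) _ _
    filter_upwards [this] with y hy hmem j
    exact lt_of_le_of_ne (hmem j) (hy j)
  refine h1.trans ?_
  have hmeas := measurable_gaussMap (hu.isCompact_slab k)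
  rw [surfaceAreaMeasure, Measure.map_apply hmeas (measurableSet_singleton _),
    Measure.restrict_apply (hmeas (measurableSet_singleton _)),
    ← hu.hausdorffMeasure_image_slice i (ε * k i) T]
  refine measure_mono ?_
  rintro _ ⟨y, hy, rfl⟩
  have hii : ⟪u i, u i⟫ = 1 := by rw [real_inner_self_eq_norm_sq, hu.norm_eq, one_pow]
  have hyi : ⟪(y : EuclideanSpace ℝ (Fin n)), u i⟫ = 0 :=
    Submodule.inner_left_of_mem_orthogonal (Submodule.mem_span_singleton_self _) y.2
  have hxi : ⟪(y : EuclideanSpace ℝ (Fin n)) + (ε * k i) • u i, u i⟫ = ε * k i := by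
    rw [inner_add_left, real_inner_smul_left, hii, hyi, zero_add, mul_one]
  have hxj : ∀ j ≠ i, |⟪(y : EuclideanSpace ℝ (Fin n)) + (ε * k i) • u i, u j⟫| < k j := by
    intro j hj
    rw [inner_add_left, real_inner_smul_left]
    exact hy ⟨j, hj⟩
  obtain ⟨hfr, hnormal⟩ := hu.isUnitNormal_iff_of_mem_facet hk hε hxi hxj
  have huniq : ∃! w, IsUnitNormal (slab u k) ((y : EuclideanSpace ℝ (Fin n)) + (ε * k i) • u i) w :=
    ⟨ε • u i, (hnormal _).2 rfl, fun w hw => (hnormal w).1 hw⟩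
  exact ⟨gaussMap_eq huniq ((hnormal _).2 rfl), hfr, huniq⟩

/-- The boundary is covered by finitely many facets, each of finite area. -/
theorem IsFrame.isFiniteMeasure_surfaceAreaMeasure (hu : IsFrame u) {k : ι → ℝ}
    (hk : ∀ i, 0 < k i) : IsFiniteMeasure (surfaceAreaMeasure (slab u k)) := by
  have hmeas := measurable_gaussMap (hu.isCompact_slab k)
  refine ⟨?_⟩
  rw [surfaceAreaMeasure, Measure.map_apply hmeas MeasurableSet.univ, preimage_univ,
    Measure.restrict_apply_univ]
  have hsub : regularBoundary (slab u k) ⊆ ⋃ i, ({x | x ∈ slab u k ∧ ⟪x, u i⟫ = k i} ∪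
      {x | x ∈ slab u k ∧ ⟪x, u i⟫ = -k i}) := by
    rintro x ⟨hx, -⟩
    rw [(isClosed_slab u k).frontier_eq] at hx
    have h1 : ¬ ∀ i, |⟪x, u i⟫| < k i := fun h => hx.2 (subset_interior_slab k h)
    push Not at h1
    obtain ⟨i, hi⟩ := h1
    refine mem_iUnion.2 ⟨i, ?_⟩
    have h2 := le_antisymm (hx.1 i) hi
    rcases (abs_eq (hk i).le).1 h2 with h | h
    · exact Or.inl ⟨hx.1, h⟩
    · exact Or.inr ⟨hx.1, h⟩
  refine (measure_mono hsub).trans_lt ?_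
  refine (measure_iUnion_fintype_le _ _).trans_lt (ENNReal.sum_lt_top.2 fun i _ => ?_)
  refine (measure_union_le _ _).trans_lt (ENNReal.add_lt_top.2 ⟨?_, ?_⟩)
  · rw [hu.slab_inter_eq i (abs_of_pos (hk i)).le, hu.hausdorffMeasure_image_slice]
    exact hu.volume_slice_lt_top _ _ _
  · rw [hu.slab_inter_eq i (by rw [abs_neg, abs_of_pos (hk i)]), hu.hausdorffMeasure_image_slice]
    exact hu.volume_slice_lt_top _ _ _

theorem ae_norm_eq_one_surfaceAreaMeasure {K : Set (EuclideanSpace ℝ (Fin n))}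
    (hK : IsCompact K) : ∀ᵐ w ∂(surfaceAreaMeasure K), ‖w‖ = 1 := by
  have hmeas := measurable_gaussMap hK
  have hms : MeasurableSet {w : EuclideanSpace ℝ (Fin n) | ¬ ‖w‖ = 1} :=
    (measurableSet_eq_fun measurable_norm measurable_const).compl
  rw [ae_iff, surfaceAreaMeasure, Measure.map_apply hmeas hms, Measure.restrict_apply (hmeas hms)]
  convert measure_empty (μ := (μHE[n - 1] : Measure (EuclideanSpace ℝ (Fin n))))
  refine eq_empty_iff_forall_notMem.2 ?_
  rintro x ⟨hx, -, hex⟩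
  obtain ⟨w, hw, -⟩ := id hex
  refine hx ?_
  rw [gaussMap_eq hex hw]
  exact hw.1

/-- The surface area measure of an intersection of slabs charges the normals with the areas of the
corresponding facets. -/
theorem IsFrame.sum_facetArea_le_integral (hu : IsFrame u) {k : ι → ℝ} (hk : ∀ i, 0 < k i)
    {φ : EuclideanSpace ℝ (Fin n) → ℝ} (hφ : Measurable φ) (hφ0 : ∀ w, 0 ≤ φ w) {M : ℝ}
    (hM : ∀ w, ‖w‖ = 1 → φ w ≤ M) (heven : ∀ w, φ (-w) = φ w) :
    ∑ i, facetArea u i k * φ (u i) ≤ ∫ w, φ w ∂(surfaceAreaMeasure (slab u k)) := by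
  classical
  have hfin := hu.isFiniteMeasure_surfaceAreaMeasure hk
  set S := surfaceAreaMeasure (slab u k) with hS
  have hint : Integrable φ S := by
    refine Integrable.of_bound hφ.aestronglyMeasurable M ?_
    filter_upwards [ae_norm_eq_one_surfaceAreaMeasure (hu.isCompact_slab k)] with w hw
    rw [Real.norm_eq_abs, abs_of_nonneg (hφ0 w)]
    exact hM w hw
  have hinj : Function.Injective u := fun i j hij => by
    by_contra hne
    exact hu.ne i j hne hij
  have hdisj : Disjoint (Finset.univ.image u) (Finset.univ.image fun i => -u i) := by
    rw [Finset.disjoint_left]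
    intro w hw hw'
    obtain ⟨i, -, rfl⟩ := Finset.mem_image.1 hw
    obtain ⟨j, -, hj⟩ := Finset.mem_image.1 hw'
    rcases eq_or_ne i j with rfl | hne
    · have h2 : (2 : ℝ) • u i = 0 := by
        rw [two_smul]
        exact add_eq_zero_iff_eq_neg.2 hj.symm
      have h0 : u i = 0 := (smul_eq_zero.1 h2).resolve_left two_ne_zero
      have := hu.norm_eq i
      rw [h0, norm_zero] at this
      exact zero_ne_one this
    · exact hu.ne_neg i j hne hj.symm
  -- The vectors `±u i` are pairwise distinct, so their atoms contribute separately; the rest of the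
  -- integral is nonnegative.
  set A := Finset.univ.image u ∪ Finset.univ.image fun i => -u i with hA
  calc ∑ i, facetArea u i k * φ (u i)
      ≤ ∑ i, (S.real {u i} * φ (u i) + S.real {-u i} * φ (-u i)) := by
        refine Finset.sum_le_sum fun i _ => ?_
        rw [facetArea, add_mul, heven]
        have h1 := hu.le_surfaceAreaMeasure hk i (ε := 1) (Or.inl rfl)
        have h2 := hu.le_surfaceAreaMeasure hk i (ε := -1) (Or.inr rfl)
        rw [one_mul, one_smul] at h1
        rw [neg_one_mul, neg_one_smul] at h2
        gcongr
        · exact hφ0 _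
        · exact ENNReal.toReal_mono (measure_ne_top S _) h1
        · exact hφ0 _
        · exact ENNReal.toReal_mono (measure_ne_top S _) h2
    _ = ∑ w ∈ A, S.real {w} • φ w := by
        rw [hA, Finset.sum_union hdisj, Finset.sum_image fun i _ j _ h => hinj h,
          Finset.sum_image fun i _ j _ h => hinj (neg_injective h), Finset.sum_add_distrib]
        rfl
    _ = ∫ w in (A : Set (EuclideanSpace ℝ (Fin n))), φ w ∂S :=
        (setIntegral_finset A hint.integrableOn).symm
    _ ≤ ∫ w, φ w ∂S := setIntegral_le_integral hint (Filter.Eventually.of_forall hφ0)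

end

/-! ### The local inequality at intersections of slabs -/

/-- The derivatives at `0` of a polynomial representing a function along a line. -/
theorem coeff_of_eval_line {W : Type*} [NormedAddCommGroup W] [NormedSpace ℝ W] {G : W → ℝ}
    (hG : ContDiff ℝ 2 G) {k l : W} {q : ℝ[X]} (hq : ∀ t : ℝ, G (k + t • l) = q.eval t) :
    q.coeff 1 = fderiv ℝ G k l ∧ 2 * q.coeff 2 = fderiv ℝ (fderiv ℝ G) k l l := by
  have hline : ∀ t : ℝ, HasDerivAt (fun t : ℝ => k + t • l) l t := by
    intro t
    simpa using ((hasDerivAt_id t).smul_const l).const_add k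
  have hd1 : Differentiable ℝ G := hG.differentiable (by norm_num)
  have hd2 : Differentiable ℝ (fderiv ℝ G) :=
    (hG.fderiv_right (m := 1) (by norm_num)).differentiable (by norm_num)
  have h1 : ∀ t : ℝ, q.derivative.eval t = fderiv ℝ G (k + t • l) l := by
    intro t
    refine (q.hasDerivAt t).unique ?_
    have h2 := (hd1 (k + t • l)).hasFDerivAt.comp_hasDerivAt t (hline t)
    refine h2.congr_of_eventuallyEq (Filter.Eventually.of_forall fun s => (hq s).symm)
  have h2 : q.derivative.derivative.eval 0 = fderiv ℝ (fderiv ℝ G) k l l := by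
    refine (q.derivative.hasDerivAt 0).unique ?_
    have h3 := (hd2 (k + (0 : ℝ) • l)).hasFDerivAt.comp_hasDerivAt 0 (hline 0)
    have h4 := h3.clm_apply (hasDerivAt_const (0 : ℝ) l)
    simp only [zero_smul, add_zero, map_zero] at h4
    refine h4.congr_of_eventuallyEq (Filter.Eventually.of_forall fun s => h1 s)
  constructor
  · have := h1 0
    rw [zero_smul, add_zero] at this
    rw [← this, ← Polynomial.coeff_zero_eq_eval_zero, Polynomial.coeff_derivative]
    norm_num
  · rw [← h2, ← Polynomial.coeff_zero_eq_eval_zero, Polynomial.coeff_derivative,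
      Polynomial.coeff_derivative]
    norm_num
    ring

/-- Euler's identities for functions which are homogeneous near a point. -/
theorem fderiv_of_homogeneous {W : Type*} [NormedAddCommGroup W] [NormedSpace ℝ W] {G : W → ℝ}
    (hG : ContDiff ℝ 2 G) {k : W} {n : ℕ}
    (hh : ∀ᶠ h in nhds k, ∀ᶠ s : ℝ in nhds 1, G (s • h) = s ^ n * G h) :
    fderiv ℝ G k k = n * G k ∧
      ∀ z, fderiv ℝ (fderiv ℝ G) k z k = ((n : ℝ) - 1) * fderiv ℝ G k z := by
  have hd1 : Differentiable ℝ G := hG.differentiable (by norm_num)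
  have hd2 : Differentiable ℝ (fderiv ℝ G) :=
    (hG.fderiv_right (m := 1) (by norm_num)).differentiable (by norm_num)
  have h1 : ∀ᶠ h in nhds k, fderiv ℝ G h h = n * G h := by
    filter_upwards [hh] with h hs
    have h2 : HasDerivAt (fun s : ℝ => s • h) h 1 := by
      simpa using (hasDerivAt_id (1 : ℝ)).smul_const h
    have h3 := (hd1 ((1 : ℝ) • h)).hasFDerivAt.comp_hasDerivAt 1 h2
    have h4 : HasDerivAt (fun s : ℝ => s ^ n * G h) (n * G h) 1 := by
      simpa using (hasDerivAt_pow n (1 : ℝ)).mul_const (G h)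
    rw [one_smul] at h3
    exact h3.unique (h4.congr_of_eventuallyEq hs)
  refine ⟨h1.self_of_nhds, fun z => ?_⟩
  have h2 : HasDerivAt (fun s : ℝ => k + s • z) z 0 := by
    simpa using ((hasDerivAt_id (0 : ℝ)).smul_const z).const_add k
  -- Differentiating `DG(h)(h) = n G(h)` along `h = k + s z` at `s = 0` gives `D²G(z, k) + DG(z) = n
  -- DG(z)`.
  have h3 := (hd2 (k + (0 : ℝ) • z)).hasFDerivAt.comp_hasDerivAt 0 h2
  have h4 := h3.clm_apply h2
  have h5 := ((hd1 (k + (0 : ℝ) • z)).hasFDerivAt.comp_hasDerivAt 0 h2).const_mul (n : ℝ)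
  have h6 : Filter.Tendsto (fun s : ℝ => k + s • z) (nhds 0) (nhds k) := by
    simpa using h2.continuousAt.tendsto
  have h7 := h4.unique (h5.congr_of_eventuallyEq (h6.eventually h1))
  simp only [zero_smul, add_zero, Function.comp_apply] at h7
  linarith

section

variable {n : ℕ} {ι : Type} [Fintype ι] {u : ι → EuclideanSpace ℝ (Fin n)}

/-- On the line the orthogonal complement of a unit vector is trivial, so any other unit vector is
its negative. -/
theorem IsFrame.subsingleton {ι : Type} {u : ι → EuclideanSpace ℝ (Fin n)} (hu : IsFrame u)
    (hn : n = 1) : Subsingleton ι := by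
  subst hn
  refine ⟨fun j i => ?_⟩
  by_contra hij
  refine hu.inner_restrict_ne_zero hij ?_
  have hne : u i ≠ 0 := by
    rw [← norm_ne_zero_iff, hu.norm_eq]
    exact one_ne_zero
  have h1 := (Submodule.span ℝ {u i}).finrank_add_finrank_orthogonal
  rw [finrank_span_singleton hne, finrank_euclideanSpace_fin] at h1
  have h2 : Subsingleton (Submodule.span ℝ {u i})ᗮ :=
    Module.finrank_zero_iff.1 (by omega : Module.finrank ℝ (Submodule.span ℝ {u i})ᗮ = 0)
  ext y
  rw [Subsingleton.elim y 0, map_zero, map_zero]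

theorem exists_mem_facet_of_facetArea_pos {ι : Type} {u : ι → EuclideanSpace ℝ (Fin n)} {i : ι} {k : ι → ℝ} (hk : ∀ i, 0 < k i)
    (hu : IsFrame u) (h : 0 < facetArea u i k) : ∃ x ∈ slab u k, ⟪x, u i⟫ = k i := by
  have key : ∀ s, |s| = k i → 0 < sliceVolume u i s k → ∃ x ∈ slab u k, ⟪x, u i⟫ = s := by
    intro s hs hpos
    have hne : (slice u i s k).Nonempty := by
      rw [nonempty_iff_ne_empty]
      intro h0
      rw [sliceVolume, h0, measureReal_empty] at hpos
      exact lt_irrefl _ hpos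
    have h1 := hu.slab_inter_eq i hs.le
    obtain ⟨x, hx⟩ := hne.image
      fun y : (Submodule.span ℝ {u i})ᗮ => (y : EuclideanSpace ℝ (Fin n)) + s • u i
    rw [← h1] at hx
    exact ⟨x, hx⟩
  by_cases h1 : 0 < sliceVolume u i (k i) k
  · exact key _ (abs_of_pos (hk i)) h1
  · have h2 : 0 < sliceVolume u i (-k i) k := by
      rw [facetArea] at h
      linarith
    obtain ⟨x, hx, hxi⟩ := key _ (by rw [abs_neg, abs_of_pos (hk i)]) h2
    exact ⟨-x, neg_mem_slab.2 hx, by rw [inner_neg_left, hxi, neg_neg]⟩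

theorem IsFrame.supportFn_slab_eq (hu : IsFrame u) {k : ι → ℝ} {i : ι}
    (h : ∃ x ∈ slab u k, ⟪x, u i⟫ = k i) : supportFn (slab u k) (u i) = k i := by
  obtain ⟨x, hx, hxi⟩ := h
  rw [← hxi]
  exact supportFn_eq (hu.isCompact_slab k) hx fun y hy => by
    rw [hxi]
    exact (abs_le.1 (hy i)).2

/-- The local inequality for two intersections of slabs in a common chamber. -/
theorem IsFrame.local_inequality (hu : IsFrame u) (hn : 1 ≤ n) {p : ℝ} (hp1 : p < 1)
    (hloc : LocalLpBrunnMinkowski n p) {k l : ι → ℝ} (hk : ∀ i, 0 < k i) (hl : ∀ i, 0 < l i)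
    {q : ℝ[X]} (hq : ∀ t : ℝ, 0 ≤ t → volume.real (slab u k + t • slab u l) = q.eval t)
    (hfacet : ∀ i, (∃ x ∈ slab u k, ⟪x, u i⟫ = k i) → ∃ y ∈ slab u l, ⟪y, u i⟫ = l i)
    (hq2 : n = 1 → q.coeff 2 = 0) :
    slabVolume u k * (2 * q.coeff 2 + (1 - p) * ∑ i, facetArea u i k * (l i ^ 2 / k i))
      - ((n : ℝ) - p) / n * q.coeff 1 ^ 2 ≤ 0 := by
  have hK := hu.isSymmConvexBody_slab hk
  have hL := hu.isSymmConvexBody_slab hl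
  have h := hloc _ _ hK hL
  have hn0 : (0 : ℝ) < n := by exact_mod_cast hn
  have h1 : mixedVolume (slab u k) (slab u l) 1 = q.coeff 1 / n := by
    rw [mixedVolume_eq hq, Nat.choose_one_right]
  have h2 : (n : ℝ) * ((n : ℝ) - 1) * mixedVolume (slab u k) (slab u l) 2 = 2 * q.coeff 2 := by
    -- For `n = 1` the factor `n - 1` kills the mixed volume, so `q.coeff 2` must vanish; for `n ≥
    -- 2` the binomial coefficient leaves the factor `2`.
    rcases eq_or_ne n 1 with hn1 | hn1
    · have : (n : ℝ) = 1 := by exact_mod_cast hn1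
      rw [hq2 hn1, this, sub_self, mul_zero, zero_mul, mul_zero]
    · have hn2 : (1 : ℝ) < n := by exact_mod_cast lt_of_le_of_ne hn (Ne.symm hn1)
      rw [mixedVolume_eq hq, Nat.cast_choose_two]
      have : (n : ℝ) - 1 ≠ 0 := by linarith
      field_simp
  rw [h1, h2] at h
  set φ : EuclideanSpace ℝ (Fin n) → ℝ := fun w =>
    supportFn (slab u l) w ^ 2 / supportFn (slab u k) w with hφ
  have hcK := continuous_supportFn hK.isCompact
  have hcL := continuous_supportFn hL.isCompact
  have hK0 : ∀ w, 0 ≤ supportFn (slab u k) w := fun w => by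
    have := le_supportFn hK.isCompact (zero_mem_slab fun i => (hk i).le) w
    rwa [inner_zero_left] at this
  -- The bound ensures integrability; otherwise the integral would be the default value `0` and no
  -- lower bound could hold.
  obtain ⟨M, hM⟩ := (isCompact_sphere (0 : EuclideanSpace ℝ (Fin n)) 1).exists_bound_of_continuousOn
    (f := φ) ((hcL.pow 2).continuousOn.div hcK.continuousOn fun w hw =>
      (hK.supportFn_pos (norm_ne_zero_iff.1 (by
        rw [mem_sphere_zero_iff_norm.1 hw]
        exact one_ne_zero))).ne')
  have hint := hu.sum_facetArea_le_integral hk (φ := φ) (M := M)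
    ((hcL.pow 2).measurable.div hcK.measurable) (fun w => div_nonneg (sq_nonneg _) (hK0 w))
    (fun w hw => (le_abs_self _).trans (hM w (by simpa using hw)))
    (fun w => by simp only [hφ, hK.supportFn_neg, hL.supportFn_neg])
  -- A width can exceed the support number, but only if its facet is empty, hence has area zero.
  have hsum : ∑ i, facetArea u i k * φ (u i) = ∑ i, facetArea u i k * (l i ^ 2 / k i) := by
    refine Finset.sum_congr rfl fun i _ => ?_
    have h0 : 0 ≤ facetArea u i k := add_nonneg measureReal_nonneg measureReal_nonneg
    rcases h0.eq_or_lt with h0 | h0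
    · rw [← h0, zero_mul, zero_mul]
    · have hex := exists_mem_facet_of_facetArea_pos hk hu h0
      simp only [hφ]
      rw [hu.supportFn_slab_eq hex, hu.supportFn_slab_eq (hfacet i hex)]
  rw [hsum] at hint
  have hv := hu.slabVolume_pos hk
  have h3 : (n : ℝ) * ((n : ℝ) - p) * (q.coeff 1 / n) ^ 2 =
      ((n : ℝ) - p) / n * q.coeff 1 ^ 2 := by
    field_simp
  rw [h3] at h
  -- As `1 - p ≥ 0`, replacing the integral by the facet sum can only decrease the left side.
  refine le_trans (sub_le_sub_right ?_ _) h
  have hp : 0 ≤ 1 - p := by linarith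
  exact mul_le_mul_of_nonneg_left (add_le_add_right (mul_le_mul_of_nonneg_left hint hp) _) hv.le

/-- Off finitely many hyperplanes, the volume of an intersection of slabs is a smooth function of
the widths whose second derivatives satisfy the local inequality in all directions. -/
theorem IsFrame.exists_smooth_local_inequality (hu : IsFrame u) (hn : 1 ≤ n) {p : ℝ} (hp1 : p < 1)
    (hloc : LocalLpBrunnMinkowski n p) :
    ∃ S : Set ((ι → ℝ) →ₗ[ℝ] ℝ), S.Finite ∧ (∀ l ∈ S, l ≠ 0) ∧
      ∀ k : ι → ℝ, (∀ i, 0 < k i) → (∀ l ∈ S, l k ≠ 0) → ∃ G : (ι → ℝ) → ℝ, ContDiff ℝ 2 G ∧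
        (∀ᶠ h in nhds k, slabVolume u h = G h) ∧
        ∀ z : ι → ℝ, G k * (fderiv ℝ (fderiv ℝ G) k z z +
          (1 - p) * fderiv ℝ G k (fun i => z i ^ 2 / k i)) -
            ((n : ℝ) - p) / n * fderiv ℝ G k z ^ 2 ≤ 0 := by
  obtain ⟨F, hF, hFeq⟩ := hu.exists_isPwPoly
  obtain ⟨S₁, fin₁, ne₁, h₁⟩ := hF.exists_chamber
  obtain ⟨S₂, fin₂, ne₂, h₂⟩ := hu.exists_chamber_add
  refine ⟨S₁ ∪ S₂, fin₁.union fin₂, ?_, fun k hk hkS => ?_⟩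
  · rintro l (hl | hl)
    exacts [ne₁ l hl, ne₂ l hl]
  obtain ⟨G, hGpoly, hG⟩ := h₁ k fun l hl => hkS l (Or.inl hl)
  -- The chamber of `k`, an open convex cone. On it the volume is the single polynomial `G`, and
  -- Minkowski combinations add the widths.
  set C : Set (ι → ℝ) := {h | (∀ i, 0 < h i) ∧ ∀ l ∈ S₁ ∪ S₂, 0 < l h * l k} with hC
  have hCnhds : ∀ h ∈ C, C ∈ nhds h := by
    intro h hh
    refine Filter.inter_mem (s := {h : ι → ℝ | ∀ i, 0 < h i}) ?_ ?_
    · refine Filter.eventually_all.2 fun i => ?_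
      exact (continuous_apply i).continuousAt.eventually (lt_mem_nhds (hh.1 i))
    · refine (Filter.eventually_all_finite (fin₁.union fin₂)).2 fun l hl => ?_
      have hlc : Continuous l := (LinearMap.toContinuousLinearMap l).continuous
      exact (hlc.mul continuous_const).continuousAt.eventually (lt_mem_nhds (hh.2 l hl))
  have hkC : k ∈ C := ⟨hk, fun l hl => mul_self_pos.2 (hkS l hl)⟩
  have hCsmul : ∀ h ∈ C, ∀ c : ℝ, 0 < c → c • h ∈ C := by
    intro h hh c hc
    refine ⟨fun i => mul_pos hc (hh.1 i), fun l hl => ?_⟩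
    rw [map_smul, smul_eq_mul, mul_assoc]
    exact mul_pos hc (hh.2 l hl)
  have hCadd : ∀ h ∈ C, ∀ h' ∈ C, h + h' ∈ C := by
    intro h hh h' hh'
    refine ⟨fun i => add_pos (hh.1 i) (hh'.1 i), fun l hl => ?_⟩
    rw [map_add, add_mul]
    exact add_pos (hh.2 l hl) (hh'.2 l hl)
  have hVG : ∀ h ∈ C, slabVolume u h = G h := fun h hh => by
    rw [hFeq h fun i => (hh.1 i).le, hG h fun l hl => hh.2 l (Or.inl hl)]
  have hGd : ContDiff ℝ 2 G := hGpoly.contDiff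
  have hev : ∀ᶠ h in nhds k, slabVolume u h = G h :=
    Filter.mem_of_superset (hCnhds k hkC) hVG
  refine ⟨G, hGd, hev, fun z => ?_⟩
  have hfd : ∀ z, fderiv ℝ G k z = ∑ i, facetArea u i k * z i := by
    intro z
    have h1 := ((hu.hasFDerivAt_slabVolume hk).congr_of_eventuallyEq
      (hev.mono fun h hh => hh.symm)).fderiv
    rw [h1]
    simp
  obtain ⟨euler₁, euler₂⟩ := fderiv_of_homogeneous hGd (k := k) (n := n) (by
    filter_upwards [hCnhds k hkC] with h hh
    filter_upwards [lt_mem_nhds (zero_lt_one (α := ℝ))] with s hs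
    rw [← hVG _ (hCsmul h hh s hs), ← hVG h hh, slabVolume_smul u h hs])
  have hsymm : ∀ z w, fderiv ℝ (fderiv ℝ G) k z w = fderiv ℝ (fderiv ℝ G) k w z := by
    have : IsSymmSndFDerivAt ℝ G k := hGd.contDiffAt.isSymmSndFDerivAt (by simp)
    exact fun z w => this.eq z w
  have hineq : ∀ l ∈ C, G k * (fderiv ℝ (fderiv ℝ G) k l l +
      (1 - p) * fderiv ℝ G k (fun i => l i ^ 2 / k i)) -
        ((n : ℝ) - p) / n * fderiv ℝ G k l ^ 2 ≤ 0 := by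
    intro l hl
    obtain ⟨q, hq⟩ := hGpoly.exists_polynomial_line k l
    obtain ⟨c₁, c₂⟩ := coeff_of_eval_line hGd hq
    have hvol : ∀ t : ℝ, 0 ≤ t → volume.real (slab u k + t • slab u l) = q.eval t := by
      intro t ht
      rcases ht.eq_or_lt with rfl | ht
      · rw [zero_smul_set ⟨0, zero_mem_slab fun i => (hl.1 i).le⟩, add_zero, ← hq, zero_smul,
          add_zero]
        exact hVG k hkC
      · have htl := hCsmul l hl t ht
        rw [smul_slab u l ht, ← (h₂ k (t • l) hk htl.1 fun m hm => htl.2 m (Or.inr hm)).1, ← hq]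
        exact hVG _ (hCadd k hkC _ htl)
    have h := hu.local_inequality hn hp1 hloc hk hl.1 hvol
      (h₂ k l hk hl.1 fun m hm => hl.2 m (Or.inr hm)).2 (fun hn1 => ?_)
    · rw [hVG k hkC, c₁, c₂, ← hfd fun i => l i ^ 2 / k i] at h
      exact h
    -- In dimension one `l` is a multiple of `k`, and Euler's identity with `n = 1` makes the second
    -- derivative in this direction vanish.
    · have hs := hu.subsingleton hn1
      have hlk : ∃ c : ℝ, l = c • k := by
        rcases isEmpty_or_nonempty ι with he | ⟨⟨i⟩⟩
        · exact ⟨0, Subsingleton.elim _ _⟩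
        · refine ⟨l i / k i, funext fun j => ?_⟩
          rw [Subsingleton.elim j i, Pi.smul_apply, smul_eq_mul, div_mul_cancel₀ _ (hk i).ne']
      obtain ⟨c, rfl⟩ := hlk
      have h0 : fderiv ℝ (fderiv ℝ G) k (c • k) (c • k) = 0 := by
        rw [map_smul, map_smul, _root_.smul_apply, euler₂ k, hn1]
        simp
      linarith
  -- The vector `z` need not be the widths of a body, but `k + ε z` is, for small `ε`.
  obtain ⟨ε, hεC, hε⟩ : ∃ ε : ℝ, k + ε • z ∈ C ∧ 0 < ε := by
    have hcont : ContinuousAt (fun t : ℝ => k + t • z) 0 := by fun_prop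
    have h1 : ∀ᶠ t : ℝ in nhdsWithin 0 (Ioi 0), k + t • z ∈ C := by
      refine Filter.Eventually.filter_mono nhdsWithin_le_nhds (hcont.eventually ?_)
      dsimp only
      rw [zero_smul, add_zero]
      exact hCnhds k hkC
    exact (h1.and self_mem_nhdsWithin).exists
  have h := hineq _ hεC
  have hquad : fderiv ℝ G k (fun i => (k + ε • z) i ^ 2 / k i) =
      n * G k + 2 * ε * fderiv ℝ G k z + ε ^ 2 * fderiv ℝ G k (fun i => z i ^ 2 / k i) := by
    have : (fun i => (k + ε • z) i ^ 2 / k i) =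
        k + (2 * ε) • z + (ε ^ 2) • fun i => z i ^ 2 / k i := by
      ext i
      have := (hk i).ne'
      simp only [Pi.add_apply, Pi.smul_apply, smul_eq_mul]
      field_simp
      ring
    rw [this, map_add, map_add, map_smul, map_smul, euler₁]
    simp
  have hD2 : fderiv ℝ (fderiv ℝ G) k (k + ε • z) (k + ε • z) =
      ((n : ℝ) - 1) * (n * G k) + 2 * ε * (((n : ℝ) - 1) * fderiv ℝ G k z) +
        ε ^ 2 * fderiv ℝ (fderiv ℝ G) k z z := by
    simp only [map_add, map_smul, _root_.add_apply, _root_.smul_apply,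
      smul_eq_mul, hsymm k z, euler₂, euler₁]
    ring
  rw [hquad, hD2, map_add, map_smul, euler₁, smul_eq_mul] at h
  have hn0 : (n : ℝ) ≠ 0 := by
    have : (0 : ℝ) < n := by exact_mod_cast hn
    exact this.ne'
  set v := G k
  set d := fderiv ℝ G k z
  set Q := fderiv ℝ (fderiv ℝ G) k z z
  set s := fderiv ℝ G k (fun i => z i ^ 2 / k i)
  -- By Euler's identities `k` lies in the kernel of the quadratic form, so its value at `k + ε z`
  -- is `ε ^ 2` times its value at `z`.
  have hid : v * (((n : ℝ) - 1) * (n * v) + 2 * ε * (((n : ℝ) - 1) * d) + ε ^ 2 * Q +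
      (1 - p) * (n * v + 2 * ε * d + ε ^ 2 * s)) - ((n : ℝ) - p) / n * (n * v + ε * d) ^ 2 =
      ε ^ 2 * (v * (Q + (1 - p) * s) - ((n : ℝ) - p) / n * d ^ 2) := by
    field_simp
    ring
  rw [hid] at h
  exact nonpos_of_mul_nonpos_right h (by positivity)

end

/-! ### Concavity from second order information off a finite set -/

/-- Cut the interval at the exceptional points; continuity lets the estimates on the pieces be
chained. -/
theorem le_of_deriv_nonpos_off_finset {g : ℝ → ℝ} (B : Finset ℝ) :
    ∀ {x y : ℝ}, x ≤ y → ContinuousOn g (Icc x y) →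
      (∀ t ∈ Ioo x y, t ∉ B → ∃ d ≤ 0, HasDerivAt g d t) → g y ≤ g x := by
  induction B using Finset.induction_on with
  | empty =>
    intro x y hxy hc hd
    refine antitoneOn_of_deriv_nonpos (convex_Icc x y) hc ?_ ?_ (left_mem_Icc.2 hxy)
      (right_mem_Icc.2 hxy) hxy
    · intro t ht
      rw [interior_Icc] at ht
      obtain ⟨d, -, h⟩ := hd t ht (by simp)
      exact h.differentiableAt.differentiableWithinAt
    · intro t ht
      rw [interior_Icc] at ht
      obtain ⟨d, hd0, h⟩ := hd t ht (by simp)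
      rwa [h.deriv]
  | insert c B hcB ih =>
    intro x y hxy hc hd
    by_cases hcm : c ∈ Ioo x y
    · have h1 : g y ≤ g c := ih hcm.2.le (hc.mono (Icc_subset_Icc_left hcm.1.le))
        fun t ht htB => hd t ⟨hcm.1.trans ht.1, ht.2⟩ (by simp [htB, ht.1.ne'])
      have h2 : g c ≤ g x := ih hcm.1.le (hc.mono (Icc_subset_Icc_right hcm.2.le))
        fun t ht htB => hd t ⟨ht.1, ht.2.trans hcm.2⟩ (by simp [htB, ht.2.ne])
      exact h1.trans h2
    · exact ih hxy hc fun t ht htB => hd t ht (by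
        simp only [Finset.mem_insert, not_or]
        exact ⟨fun h => hcm (h ▸ ht), htB⟩)

/-- A second order criterion for `f ^ α`, or `log f` if `α = 0`, to be concave. -/
theorem concaveOn_of_second_order {α : ℝ} (hα : 0 ≤ α) {f f₁ : ℝ → ℝ} {B : Set ℝ} (hB : B.Finite)
    (hpos : ∀ t ∈ Icc (0 : ℝ) 1, 0 < f t) (hf : ∀ t ∈ Icc (0 : ℝ) 1, HasDerivAt f (f₁ t) t)
    (hf₁ : ContinuousOn f₁ (Icc 0 1))
    (hf₂ : ∀ t ∈ Ioo (0 : ℝ) 1, t ∉ B →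
      ∃ d, HasDerivAt f₁ d t ∧ f t * d - (1 - α) * f₁ t ^ 2 ≤ 0) :
    ConcaveOn ℝ (Icc 0 1) fun t => if α = 0 then Real.log (f t) else f t ^ α := by
  set g₁ : ℝ → ℝ := fun t => if α = 0 then f₁ t / f t else f₁ t * α * f t ^ (α - 1) with hg₁
  have hfc : ContinuousOn f (Icc 0 1) := fun t ht => (hf t ht).continuousAt.continuousWithinAt
  have hg : ∀ t ∈ Icc (0 : ℝ) 1,
      HasDerivAt (fun t => if α = 0 then Real.log (f t) else f t ^ α) (g₁ t) t := by
    intro t ht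
    simp only [hg₁]
    split_ifs
    · exact (hf t ht).log (hpos t ht).ne'
    · exact (hf t ht).rpow_const (Or.inl (hpos t ht).ne')
  have hg₁c : ContinuousOn g₁ (Icc 0 1) := by
    simp only [hg₁]
    split_ifs
    · exact hf₁.div hfc fun t ht => (hpos t ht).ne'
    · exact (hf₁.mul continuousOn_const).mul
        (hfc.rpow_const fun t ht => Or.inl (hpos t ht).ne')
  have hg₂ : ∀ t ∈ Ioo (0 : ℝ) 1, t ∉ B → ∃ d ≤ 0, HasDerivAt g₁ d t := by
    intro t ht htB
    have ht' := Ioo_subset_Icc_self ht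
    obtain ⟨d, hd, hle⟩ := hf₂ t ht htB
    have h0 := hpos t ht'
    simp only [hg₁]
    by_cases hα0 : α = 0
    · simp only [hα0, if_true]
      refine ⟨_, ?_, hd.fun_div (hf t ht') h0.ne'⟩
      refine div_nonpos_of_nonpos_of_nonneg ?_ (sq_nonneg _)
      rw [hα0] at hle
      linarith
    · simp only [hα0, if_false]
      refine ⟨_, ?_, (hd.mul_const α).fun_mul ((hf t ht').rpow_const (Or.inl h0.ne'))⟩
      -- Factoring out `f ^ (α - 2)` turns the second derivative into `α f ^ (α - 2) (f f'' - (1 -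
      -- α) f' ^ 2)`.
      have h1 : f t ^ (α - 1) = f t ^ (α - 1 - 1) * f t := by
        conv_rhs => rw [← Real.rpow_add_one h0.ne' (α - 1 - 1), sub_add_cancel]
      rw [h1]
      have h2 : 0 ≤ α * f t ^ (α - 1 - 1) := mul_nonneg hα (Real.rpow_nonneg h0.le _)
      have h3 := mul_nonpos_of_nonneg_of_nonpos h2 hle
      refine le_of_eq_of_le ?_ h3
      ring
  refine AntitoneOn.concaveOn_of_deriv (convex_Icc 0 1)
    (fun t ht => (hg t ht).continuousAt.continuousWithinAt) ?_ ?_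
  · intro t ht
    exact (hg t (interior_subset ht)).differentiableAt.differentiableWithinAt
  · intro x hx y hy hxy
    rw [(hg x (interior_subset hx)).deriv, (hg y (interior_subset hy)).deriv]
    rw [interior_Icc] at hx hy
    refine le_of_deriv_nonpos_off_finset hB.toFinset hxy
      (hg₁c.mono (Icc_subset_Icc hx.1.le hy.2.le)) fun t ht htB => ?_
    exact hg₂ t ⟨hx.1.trans ht.1, ht.2.trans hy.2⟩ (by simpa using htB)

/-! ### Power means -/

/-- The logarithmic derivative of the power mean in the weight. -/
def lpSlope (p t a b : ℝ) : ℝ :=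
  if p = 0 then Real.log b - Real.log a else (b ^ p - a ^ p) / (p * ((1 - t) * a ^ p + t * b ^ p))

theorem lpBase_pos (p : ℝ) {t a b : ℝ} (ht : t ∈ Icc (0 : ℝ) 1) (ha : 0 < a) (hb : 0 < b) :
    0 < (1 - t) * a ^ p + t * b ^ p := by
  have h1 := Real.rpow_pos_of_pos ha p
  have h2 := Real.rpow_pos_of_pos hb p
  rcases ht.1.eq_or_lt with h0 | h0
  · rw [← h0]
    simpa using h1
  · exact add_pos_of_nonneg_of_pos (mul_nonneg (by linarith [ht.2]) h1.le) (mul_pos h0 h2)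

theorem lpMean_pos (p : ℝ) {t a b : ℝ} (ht : t ∈ Icc (0 : ℝ) 1) (ha : 0 < a) (hb : 0 < b) :
    0 < lpMean p t a b := by
  unfold lpMean
  split_ifs
  · exact mul_pos (Real.rpow_pos_of_pos ha _) (Real.rpow_pos_of_pos hb _)
  · exact Real.rpow_pos_of_pos (lpBase_pos p ht ha hb) _

theorem lpMean_zero_left (p : ℝ) {a b : ℝ} (ha : 0 < a) : lpMean p 0 a b = a := by
  unfold lpMean
  split_ifs with hp
  · simp
  · simp [← Real.rpow_mul ha.le, hp]

theorem hasDerivAt_lpMean (p : ℝ) {t a b : ℝ} (ht : t ∈ Icc (0 : ℝ) 1) (ha : 0 < a)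
    (hb : 0 < b) :
    HasDerivAt (fun t => lpMean p t a b) (lpMean p t a b * lpSlope p t a b) t := by
  unfold lpMean lpSlope
  split_ifs with hp
  · have h1 : HasDerivAt (fun t : ℝ => 1 - t) (-1) t := by
      simpa using (hasDerivAt_id t).const_sub 1
    have h2 := (h1.const_rpow ha).fun_mul ((hasDerivAt_id' t).const_rpow hb)
    refine h2.congr_deriv ?_
    ring
  · have hB := lpBase_pos p ht ha hb
    have h1 : HasDerivAt (fun t : ℝ => (1 - t) * a ^ p + t * b ^ p) (b ^ p - a ^ p) t := by
      have := (((hasDerivAt_id' t).const_sub 1).mul_const (a ^ p)).fun_add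
        ((hasDerivAt_id' t).mul_const (b ^ p))
      refine this.congr_deriv ?_
      ring
    refine (h1.rpow_const (p := 1 / p) (Or.inl hB.ne')).congr_deriv ?_
    rw [Real.rpow_sub_one hB.ne']
    field_simp

/-- Together with `M' = M s` for the power mean `M` and its slope `s`, this Riccati equation yields
`M'' = (1 - p) M' ^ 2 / M`, the source of the term with `1 - p` in the local inequality. -/
theorem hasDerivAt_lpSlope (p : ℝ) {t a b : ℝ} (ht : t ∈ Icc (0 : ℝ) 1) (ha : 0 < a)
    (hb : 0 < b) :
    HasDerivAt (fun t => lpSlope p t a b) (-p * lpSlope p t a b ^ 2) t := by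
  unfold lpSlope
  split_ifs with hp
  · simpa [hp] using hasDerivAt_const t (Real.log b - Real.log a)
  · have hB := lpBase_pos p ht ha hb
    have h1 : HasDerivAt (fun t : ℝ => p * ((1 - t) * a ^ p + t * b ^ p))
        (p * (b ^ p - a ^ p)) t := by
      have := ((((hasDerivAt_id' t).const_sub 1).mul_const (a ^ p)).fun_add
        ((hasDerivAt_id' t).mul_const (b ^ p))).const_mul p
      refine this.congr_deriv ?_
      ring
    have h2 := (hasDerivAt_const t (b ^ p - a ^ p)).fun_div h1 (mul_ne_zero hp hB.ne')
    refine h2.congr_deriv ?_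
    field_simp
    ring

theorem analyticAt_lpMean (p : ℝ) {t a b : ℝ} (ht : t ∈ Icc (0 : ℝ) 1) (ha : 0 < a)
    (hb : 0 < b) : AnalyticAt ℝ (fun t => lpMean p t a b) t := by
  suffices h : ContDiffAt ℝ (⊤ : WithTop ℕ∞) (fun t => lpMean p t a b) t from
    h.analyticAt
  unfold lpMean
  split_ifs with hp
  · exact (contDiffAt_const.rpow (contDiffAt_const.sub contDiffAt_id) ha.ne').mul
      (contDiffAt_const.rpow contDiffAt_id hb.ne')
  · refine ContDiffAt.rpow ?_ contDiffAt_const (lpBase_pos p ht ha hb).ne'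
    exact ((contDiffAt_const.sub contDiffAt_id).mul contDiffAt_const).add
      (contDiffAt_id.mul contDiffAt_const)

theorem continuousAt_lpMean_left (p : ℝ) {t a b : ℝ} (ht : t ∈ Icc (0 : ℝ) 1) (ha : 0 < a)
    (hb : 0 < b) : ContinuousAt (fun a => lpMean p t a b) a := by
  unfold lpMean
  split_ifs with hp
  · exact (Real.continuousAt_rpow_const a (1 - t) (Or.inl ha.ne')).mul continuousAt_const
  · exact ((continuousAt_const.mul (Real.continuousAt_rpow_const a p (Or.inl ha.ne'))).add
      continuousAt_const).rpow_const (Or.inl (lpBase_pos p ht ha hb).ne')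

/-! ### Concavity of the volume along power mean curves -/

section

variable {n : ℕ} {ι : Type} [Fintype ι] {u : ι → EuclideanSpace ℝ (Fin n)}

/-- A curve of power means starting off a hyperplane meets it finitely often. -/
theorem finite_zeros_lpMean (p : ℝ) {h l : ι → ℝ} (hh : ∀ i, 0 < h i) (hl : ∀ i, 0 < l i)
    (m : (ι → ℝ) →ₗ[ℝ] ℝ) (hm : m h ≠ 0) :
    {t | t ∈ Icc (0 : ℝ) 1 ∧ m (fun i => lpMean p t (h i) (l i)) = 0}.Finite := by
  classical
  by_contra hinf
  obtain ⟨x, hx, hacc⟩ := Set.Infinite.exists_accPt_of_subset_isCompact hinf isCompact_Icc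
    fun t ht => ht.1
  have han : AnalyticOnNhd ℝ (fun t => m (fun i => lpMean p t (h i) (l i))) (Icc 0 1) := by
    intro t ht
    have : (fun t => m (fun i => lpMean p t (h i) (l i))) =
        fun t => ∑ i, lpMean p t (h i) (l i) • m fun j => if i = j then 1 else 0 := by
      ext t
      exact LinearMap.pi_apply_eq_sum_univ m _
    rw [this]
    exact Finset.univ.analyticAt_fun_sum fun i _ =>
      (analyticAt_lpMean p ht (hh i) (hl i)).smul analyticAt_const
  have hfreq : ∃ᶠ t in nhdsWithin x {x}ᶜ, m (fun i => lpMean p t (h i) (l i)) = 0 :=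
    (accPt_iff_frequently_nhdsNE.1 hacc).mono fun t ht => ht.2
  -- Infinitely many zeros would accumulate in `[0, 1]`. By the identity theorem the analytic
  -- function would then vanish also at `t = 0`, where the curve is at `h`.
  have h0 := han.eqOn_zero_of_preconnected_of_frequently_eq_zero isPreconnected_Icc hx hfreq
    (left_mem_Icc.2 zero_le_one)
  refine hm ?_
  have : (fun i => lpMean p 0 (h i) (l i)) = h := funext fun i => lpMean_zero_left p (hh i)
  dsimp only at h0
  rw [this] at h0
  exact h0

theorem IsFrame.continuousAt_slabVolume (hu : IsFrame u) {h : ι → ℝ} (hh : ∀ i, 0 < h i) :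
    ContinuousAt (slabVolume u) h := (hu.hasFDerivAt_slabVolume hh).continuousAt

/-- With `z = H'`, the inequality in `hSG` is exactly `f f'' - (1 - p / n) f' ^ 2 ≤ 0`, since `(n -
p) / n = 1 - p / n`. Starting off the hyperplanes leaves only finitely many times where it is
unavailable. -/
theorem IsFrame.concaveOn_of_local_inequality (hu : IsFrame u) (hn : 1 ≤ n) {p : ℝ} (hp0 : 0 ≤ p)
    {S : Set ((ι → ℝ) →ₗ[ℝ] ℝ)} (hS : S.Finite)
    (hSG : ∀ k : ι → ℝ, (∀ i, 0 < k i) → (∀ l ∈ S, l k ≠ 0) → ∃ G : (ι → ℝ) → ℝ, ContDiff ℝ 2 G ∧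
        (∀ᶠ h in nhds k, slabVolume u h = G h) ∧
        ∀ z : ι → ℝ, G k * (fderiv ℝ (fderiv ℝ G) k z z +
          (1 - p) * fderiv ℝ G k (fun i => z i ^ 2 / k i)) -
            ((n : ℝ) - p) / n * fderiv ℝ G k z ^ 2 ≤ 0)
    {h l : ι → ℝ} (hh : ∀ i, 0 < h i) (hl : ∀ i, 0 < l i) (hhS : ∀ m ∈ S, m h ≠ 0) :
    ConcaveOn ℝ (Icc 0 1) fun t => if p / n = 0
      then Real.log (slabVolume u fun i => lpMean p t (h i) (l i))
      else slabVolume u (fun i => lpMean p t (h i) (l i)) ^ (p / n) := by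
  set H : ℝ → ι → ℝ := fun t i => lpMean p t (h i) (l i) with hH
  set Z : ℝ → ι → ℝ := fun t i => lpMean p t (h i) (l i) * lpSlope p t (h i) (l i) with hZ
  have hHpos : ∀ t ∈ Icc (0 : ℝ) 1, ∀ i, 0 < H t i := fun t ht i => lpMean_pos p ht (hh i) (hl i)
  have hHZ : ∀ t ∈ Icc (0 : ℝ) 1, HasDerivAt H (Z t) t := fun t ht =>
    hasDerivAt_pi.2 fun i => hasDerivAt_lpMean p ht (hh i) (hl i)
  have hZ' : ∀ t ∈ Icc (0 : ℝ) 1, HasDerivAt Z ((1 - p) • fun i => Z t i ^ 2 / H t i) t := by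
    intro t ht
    refine hasDerivAt_pi.2 fun i => ?_
    refine ((hasDerivAt_lpMean p ht (hh i) (hl i)).fun_mul
      (hasDerivAt_lpSlope p ht (hh i) (hl i))).congr_deriv ?_
    have := (lpMean_pos p ht (hh i) (hl i)).ne'
    simp only [Pi.smul_apply, hZ, hH, smul_eq_mul]
    field_simp
    ring
  have hfd : ∀ t ∈ Icc (0 : ℝ) 1, fderiv ℝ (slabVolume u) (H t) (Z t) =
      ∑ i, facetArea u i (H t) * Z t i := by
    intro t ht
    rw [(hu.hasFDerivAt_slabVolume (hHpos t ht)).fderiv]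
    simp
  refine concaveOn_of_second_order (f := fun t => slabVolume u (H t))
    (f₁ := fun t => fderiv ℝ (slabVolume u) (H t) (Z t)) (α := p / n) (by positivity)
    (B := ⋃ m ∈ S, {t | t ∈ Icc (0 : ℝ) 1 ∧ m (H t) = 0})
    (hS.biUnion fun m hm => finite_zeros_lpMean p hh hl m (hhS m hm))
    (fun t ht => hu.slabVolume_pos (hHpos t ht)) ?_ ?_ ?_
  · intro t ht
    exact (hu.hasFDerivAt_slabVolume (hHpos t ht)).differentiableAt.hasFDerivAt.comp_hasDerivAt t
      (hHZ t ht)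
  -- Written with facet areas, `f'` is continuous on all of `[0, 1]`, including the times when the
  -- curve crosses a hyperplane.
  · refine ContinuousOn.congr ?_ hfd
    refine continuousOn_finsetSum _ fun i _ => ContinuousOn.mul ?_ ?_
    · exact (hu.continuous_facetArea i).comp_continuousOn fun t ht =>
        (hHZ t ht).continuousAt.continuousWithinAt
    · intro t ht
      exact ((continuous_apply i).continuousAt.comp (hZ' t ht).continuousAt).continuousWithinAt
  · intro t ht htB
    have ht' := Ioo_subset_Icc_self ht
    have htS : ∀ m ∈ S, m (H t) ≠ 0 := fun m hm h0 => htB (mem_biUnion hm ⟨ht', h0⟩)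
    obtain ⟨G, hG, hev, hineq⟩ := hSG (H t) (hHpos t ht') htS
    have hd2 : Differentiable ℝ (fderiv ℝ G) :=
      (hG.fderiv_right (m := 1) (by norm_num)).differentiable (by norm_num)
    have h1 := (hd2 (H t)).hasFDerivAt.comp_hasDerivAt t (hHZ t ht')
    have h2 := h1.clm_apply (hZ' t ht')
    have hev2 : ∀ᶠ k in nhds (H t), fderiv ℝ (slabVolume u) k = fderiv ℝ G k := by
      have h3 : slabVolume u =ᶠ[nhds (H t)] G := hev
      exact h3.eventuallyEq_nhds.mono fun k hk => hk.fderiv_eq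
    have hev3 := (hHZ t ht').continuousAt.eventually hev2
    refine ⟨_, h2.congr_of_eventuallyEq (hev3.mono fun s hs => by dsimp only; rw [hs]; rfl), ?_⟩
    have h4 := hineq (Z t)
    have hn0 : (n : ℝ) ≠ 0 := by
      have : (0 : ℝ) < n := by exact_mod_cast hn
      exact this.ne'
    rw [hev.self_of_nhds, hev2.self_of_nhds]
    refine le_of_eq_of_le ?_ h4
    simp only [map_smul, smul_eq_mul, Function.comp_apply]
    congr 2
    field_simp

/-- Under the local inequality, the volume of intersections of slabs is power concave along curves
of power means. -/
theorem IsFrame.concaveOn_slabVolume (hu : IsFrame u) (hn : 1 ≤ n) {p : ℝ} (hp0 : 0 ≤ p)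
    (hp1 : p < 1) (hloc : LocalLpBrunnMinkowski n p) {h l : ι → ℝ} (hh : ∀ i, 0 < h i)
    (hl : ∀ i, 0 < l i) :
    ConcaveOn ℝ (Icc 0 1) fun t => if p / n = 0
      then Real.log (slabVolume u fun i => lpMean p t (h i) (l i))
      else slabVolume u (fun i => lpMean p t (h i) (l i)) ^ (p / n) := by
  obtain ⟨S, hS, hS0, hSG⟩ := hu.exists_smooth_local_inequality hn hp1 hloc
  -- The hyperplanes are null, so generic starting points are dense; only `h` is perturbed and `l`
  -- is kept.
  have hdense : Dense {h : ι → ℝ | ∀ m ∈ S, m h ≠ 0} := by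
    refine Measure.dense_of_ae (μ := (volume : Measure (ι → ℝ))) ?_
    rw [ae_ball_iff hS.countable]
    exact fun m hm => compl_mem_ae_iff.2 (measure_levelSet_eq_zero volume (hS0 m hm) 0)
  have hne := mem_closure_iff_nhdsWithin_neBot.1 (hdense h)
  set Φ : (ι → ℝ) → ℝ → ℝ := fun h t => if p / n = 0
      then Real.log (slabVolume u fun i => lpMean p t (h i) (l i))
      else slabVolume u (fun i => lpMean p t (h i) (l i)) ^ (p / n) with hΦ
  have hcont : ∀ t ∈ Icc (0 : ℝ) 1, Filter.Tendsto (fun h' => Φ h' t)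
      (nhdsWithin h {h : ι → ℝ | ∀ m ∈ S, m h ≠ 0}) (nhds (Φ h t)) := by
    intro t ht
    refine Filter.Tendsto.mono_left ?_ nhdsWithin_le_nhds
    have hpos : ∀ i, 0 < lpMean p t (h i) (l i) := fun i => lpMean_pos p ht (hh i) (hl i)
    have h1 : ContinuousAt (fun h' : ι → ℝ => fun i => lpMean p t (h' i) (l i)) h :=
      continuousAt_pi.2 fun i => ContinuousAt.comp (f := fun h' : ι → ℝ => h' i)
        (g := fun a => lpMean p t a (l i)) (continuousAt_lpMean_left p ht (hh i) (hl i))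
        (continuous_apply i).continuousAt
    have h2 : ContinuousAt (fun h' : ι → ℝ => slabVolume u fun i => lpMean p t (h' i) (l i)) h :=
      ContinuousAt.comp (f := fun h' : ι → ℝ => fun i => lpMean p t (h' i) (l i))
        (hu.continuousAt_slabVolume hpos) h1
    have h3 := (hu.slabVolume_pos hpos).ne'
    simp only [hΦ]
    split_ifs
    · exact h2.log h3
    · exact h2.rpow_const (Or.inl h3)
  have hev : ∀ᶠ h' in nhdsWithin h {h : ι → ℝ | ∀ m ∈ S, m h ≠ 0},
      ConcaveOn ℝ (Icc 0 1) (Φ h') := by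
    have h1 : ∀ᶠ h' : ι → ℝ in nhds h, ∀ i, 0 < h' i := Filter.eventually_all.2 fun i =>
      (continuous_apply i).continuousAt.eventually (lt_mem_nhds (hh i))
    filter_upwards [h1.filter_mono nhdsWithin_le_nhds, self_mem_nhdsWithin] with h' hpos hgen
    exact hu.concaveOn_of_local_inequality hn hp0 hS hSG hpos hl hgen
  -- Concavity survives pointwise limits.
  refine ⟨convex_Icc 0 1, fun x hx y hy a b ha hb hab => ?_⟩
  refine le_of_tendsto_of_tendsto
    (((hcont x hx).const_smul a).add ((hcont y hy).const_smul b))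
    (hcont _ ((convex_Icc 0 1) hx hy ha hb hab)) ?_
  filter_upwards [hev] with h' hc
  exact hc.2 hx hy ha hb hab

end

/-! ### Symmetric polytopes as intersections of slabs -/

section

variable {n : ℕ}

/-- Greedy choice: a vector is added only if neither it nor its negative is already present. This
selects one normal per slab. -/
theorem exists_subset_up_to_sign {E : Type*} [AddCommGroup E] [Module ℝ E] [DecidableEq E]
    (A : Finset E) (hA : ∀ x ∈ A, x ≠ 0) :
    ∃ A' ⊆ A, (∀ x ∈ A, x ∈ A' ∨ -x ∈ A') ∧ ∀ x ∈ A', ∀ y ∈ A', x ≠ -y := by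
  induction A using Finset.induction_on with
  | empty => exact ⟨∅, by simp, by simp, by simp⟩
  | insert a A _ ih =>
    obtain ⟨A', hsub, hcov, hne⟩ := ih fun x hx => hA x (by simp [hx])
    by_cases h : a ∈ A' ∨ -a ∈ A'
    · refine ⟨A', hsub.trans (Finset.subset_insert _ _), fun x hx => ?_, hne⟩
      rcases Finset.mem_insert.1 hx with rfl | hx
      exacts [h, hcov x hx]
    · push Not at h
      refine ⟨insert a A', Finset.insert_subset_insert a hsub, fun x hx => ?_, ?_⟩
      · rcases Finset.mem_insert.1 hx with rfl | hx
        · simp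
        · exact (hcov x hx).imp (by simp +contextual) (by simp +contextual)
      · intro x hx y hy hxy
        rcases Finset.mem_insert.1 hx with rfl | hx
        · rcases Finset.mem_insert.1 hy with rfl | hy
          · have h2 : (2 : ℝ) • y = 0 := by
              rw [two_smul]
              exact add_eq_zero_iff_eq_neg.2 hxy
            exact hA y (by simp) ((smul_eq_zero.1 h2).resolve_left two_ne_zero)
          · exact h.2 (by rwa [hxy, neg_neg])
        · rcases Finset.mem_insert.1 hy with rfl | hy
          · exact h.2 (by rwa [← hxy])
          · exact hne x hx y hy hxy

/-- A symmetric polytope is an intersection of slabs given by a frame. -/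
theorem IsSymmConvexBody.exists_frame {K : Set (EuclideanSpace ℝ (Fin n))}
    (hK : IsSymmConvexBody K) (hP : IsPolytope K) :
    ∃ A : Finset (EuclideanSpace ℝ (Fin n)), IsFrame (fun i : A => (i : EuclideanSpace ℝ (Fin n))) ∧
      K = slab (fun i : A => (i : EuclideanSpace ℝ (Fin n))) fun i => supportFn K i := by
  classical
  obtain ⟨-, N, a, b, ha, hKab⟩ := hP
  obtain ⟨A, hsub, hcov, hne⟩ := exists_subset_up_to_sign (Finset.univ.image a) (by
    intro x hx
    obtain ⟨i, -, rfl⟩ := Finset.mem_image.1 hx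
    rw [← norm_ne_zero_iff, ha]
    exact one_ne_zero)
  have hslab : K = slab (fun i : A => (i : EuclideanSpace ℝ (Fin n))) fun i => supportFn K i := by
    apply Subset.antisymm
    · intro x hx i
      refine abs_le'.2 ⟨le_supportFn hK.isCompact hx _, ?_⟩
      rw [← inner_neg_left]
      exact le_supportFn hK.isCompact (hK.neg_mem hx) _
    · intro x hx
      have hle : ∀ i, ⟪x, a i⟫ ≤ supportFn K (a i) := by
        intro i
        rcases hcov (a i) (by simp) with h | h
        · exact (abs_le.1 (hx ⟨a i, h⟩)).2
        · have := (abs_le.1 (hx ⟨-a i, h⟩)).1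
          simp only [inner_neg_right, hK.supportFn_neg] at this
          linarith
      rw [hKab]
      intro i
      refine (hle i).trans (supportFn_le hK.nonempty fun y hy => ?_)
      rw [hKab] at hy
      exact hy i
  refine ⟨A, ⟨?_, ?_, ?_, ?_⟩, hslab⟩
  · rintro ⟨x, hx⟩
    obtain ⟨i, -, rfl⟩ := Finset.mem_image.1 (hsub hx)
    exact ha i
  · exact fun i j hij h => hij (Subtype.ext h)
  · exact fun i j _ => hne i i.2 j j.2
  · intro x hx
    by_contra hx0
    obtain ⟨R, hR⟩ := hK.isCompact.isBounded.exists_norm_le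
    -- A vector orthogonal to all normals spans a line inside `K`; this multiple has norm `|R| + 1`,
    -- beyond the bound `R`.
    have hmem : ((|R| + 1) / ‖x‖) • x ∈ K := by
      rw [hslab]
      intro i
      rw [real_inner_smul_left, hx i, mul_zero, abs_zero]
      have := le_supportFn hK.isCompact (interior_subset hK.zero_mem_interior)
        (i : EuclideanSpace ℝ (Fin n))
      rwa [inner_zero_left] at this
    have h1 := hR _ hmem
    rw [norm_smul, Real.norm_eq_abs, abs_div, abs_norm, div_mul_cancel₀ _ (norm_ne_zero_iff.2 hx0),
      abs_of_pos (by positivity)] at h1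
    linarith [le_abs_self R]

theorem IsSymmConvexBody.finite_extremePoints {K : Set (EuclideanSpace ℝ (Fin n))}
    (hK : IsSymmConvexBody K) (hP : IsPolytope K) : (K.extremePoints ℝ).Finite := by
  obtain ⟨A, -, h⟩ := hK.exists_frame hP
  rw [h]
  exact finite_extremePoints_slab _ _

/-! ### Faces and vertices -/

theorem isExtreme_face {K : Set (EuclideanSpace ℝ (Fin n))} (hK : IsCompact K)
    (w : EuclideanSpace ℝ (Fin n)) : IsExtreme ℝ K (face K w) := by
  refine IsExposed.isExtreme (𝕜 := ℝ) fun hne => ⟨innerSL ℝ w, ?_⟩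
  ext x
  refine and_congr_right fun hx => ?_
  simp only [innerSL_apply_apply, real_inner_comm _ w]
  constructor
  · intro h y hy
    rw [h]
    exact le_supportFn hK hy w
  · exact fun h => (supportFn_eq hK hx h).symm

theorem isCompact_face {K : Set (EuclideanSpace ℝ (Fin n))} (hK : IsCompact K)
    (w : EuclideanSpace ℝ (Fin n)) : IsCompact (face K w) :=
  hK.inter_right (isClosed_eq (by fun_prop) continuous_const)

theorem convex_face {K : Set (EuclideanSpace ℝ (Fin n))} (hK : Convex ℝ K)
    (w : EuclideanSpace ℝ (Fin n)) : Convex ℝ (face K w) := by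
  intro x hx y hy a b ha hb hab
  refine ⟨hK hx.1 hy.1 ha hb hab, ?_⟩
  rw [inner_add_left, real_inner_smul_left, real_inner_smul_left, hx.2, hy.2, ← add_mul, hab,
    one_mul]

theorem exists_vertex_eq_supportFn {K : Set (EuclideanSpace ℝ (Fin n))} (hK : IsCompact K)
    (hne : K.Nonempty) (w : EuclideanSpace ℝ (Fin n)) :
    ∃ v ∈ K.extremePoints ℝ, ⟪v, w⟫ = supportFn K w := by
  obtain ⟨x, hx, hxw⟩ := exists_eq_supportFn hK hne w
  obtain ⟨v, hv⟩ := (isCompact_face hK w).extremePoints_nonempty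
    (E := EuclideanSpace ℝ (Fin n)) ⟨x, hx, hxw⟩
  exact ⟨v, (isExtreme_face hK w).extremePoints_subset_extremePoints hv, hv.1.2⟩

/-- The directions in which `v` is the only maximizer among the points of `V`. -/
def strictNormalCone (V : Set (EuclideanSpace ℝ (Fin n))) (v : EuclideanSpace ℝ (Fin n)) :
    Set (EuclideanSpace ℝ (Fin n)) :=
  {x | ∀ v' ∈ V, v' ≠ v → ⟪v', x⟫ < ⟪v, x⟫}

theorem isOpen_strictNormalCone {V : Set (EuclideanSpace ℝ (Fin n))} (hV : V.Finite)
    (v : EuclideanSpace ℝ (Fin n)) : IsOpen (strictNormalCone V v) := by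
  have : strictNormalCone V v = ⋂ v' ∈ V, {x | v' ≠ v → ⟪v', x⟫ < ⟪v, x⟫} := by
    ext x
    simp [strictNormalCone]
  rw [this]
  refine hV.isOpen_biInter fun v' _ => ?_
  by_cases h : v' = v
  · simp [h]
  · simp only [ne_eq, h, not_false_eq_true, true_imp_iff]
    exact isOpen_lt (by fun_prop) (by fun_prop)

theorem convex_strictNormalCone (V : Set (EuclideanSpace ℝ (Fin n)))
    (v : EuclideanSpace ℝ (Fin n)) : Convex ℝ (strictNormalCone V v) := by
  intro x hx y hy a b ha hb hab v' hv' hne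
  simp only [inner_add_right, real_inner_smul_right]
  rcases ha.eq_or_lt with rfl | ha
  · rw [zero_add] at hab
    simpa [hab] using hy v' hv' hne
  · exact add_lt_add_of_lt_of_le (mul_lt_mul_of_pos_left (hx v' hv' hne) ha)
      (mul_le_mul_of_nonneg_left (hy v' hv' hne).le hb)

/-- Every direction lies in the closed normal cone of a point whose strict normal cone is not
empty. -/
theorem exists_strictNormalCone_nonempty {V : Set (EuclideanSpace ℝ (Fin n))} (hV : V.Finite)
    (hne : V.Nonempty) (w : EuclideanSpace ℝ (Fin n)) :
    ∃ v ∈ V, (strictNormalCone V v).Nonempty ∧ ∀ v' ∈ V, ⟪v', w⟫ ≤ ⟪v, w⟫ := by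
  obtain ⟨e, he⟩ : ∃ e : EuclideanSpace ℝ (Fin n),
      ∀ v ∈ V, ∀ v' ∈ V, v ≠ v' → ⟪v, e⟫ ≠ ⟪v', e⟫ := by
    -- A generic `e` separates the points of `V`. It is used to break ties among the maximizers of
    -- `⟪·, w⟫`: the chosen point is the unique maximizer for `w + t e` with small `t > 0`.
    have : ∀ᵐ e : EuclideanSpace ℝ (Fin n), ∀ v ∈ V, ∀ v' ∈ V, v ≠ v' → ⟪v, e⟫ ≠ ⟪v', e⟫ := by
      rw [ae_ball_iff hV.countable]
      intro v _
      rw [ae_ball_iff hV.countable]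
      intro v' _
      by_cases h : v = v'
      · simp [h]
      · have h0 : innerₗ (EuclideanSpace ℝ (Fin n)) (v - v') ≠ 0 := by
          intro h0
          have h1 := congrArg (fun f => f (v - v')) h0
          exact h (sub_eq_zero.1 (inner_self_eq_zero.1 h1))
        filter_upwards [compl_mem_ae_iff.2 (measure_levelSet_eq_zero volume h0 0)] with e he _ heq
        refine he ?_
        simp only [mem_ofPred_eq, innerₗ_apply_apply, inner_sub_left, heq, sub_self]
    exact this.exists
  obtain ⟨v₀, hv₀, hmax₀⟩ := hV.exists_maximalFor (fun v => ⟪v, w⟫) V hne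
  have hmax₀' : ∀ v' ∈ V, ⟪v', w⟫ ≤ ⟪v₀, w⟫ := fun v' hv' =>
    (le_total ⟪v', w⟫ ⟪v₀, w⟫).elim id fun h => hmax₀ hv' h
  obtain ⟨v, ⟨hv, hvw⟩, hmax⟩ := (hV.subset (sep_subset V fun v => ⟪v, w⟫ = ⟪v₀, w⟫)).exists_maximalFor
    (fun v => ⟪v, e⟫) _ ⟨v₀, hv₀, rfl⟩
  have hmax' : ∀ v' ∈ V, ⟪v', w⟫ = ⟪v₀, w⟫ → ⟪v', e⟫ ≤ ⟪v, e⟫ := fun v' hv' h' =>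
    (le_total ⟪v', e⟫ ⟪v, e⟫).elim id fun h => hmax ⟨hv', h'⟩ h
  refine ⟨v, hv, ?_, fun v' hv' => (hmax₀' v' hv').trans_eq hvw.symm⟩
  have hev : ∀ᶠ t : ℝ in nhdsWithin 0 (Ioi 0), ∀ v' ∈ V, v' ≠ v →
      ⟪v', w + t • e⟫ < ⟪v, w + t • e⟫ := by
    rw [Filter.eventually_all_finite hV]
    intro v' hv'
    by_cases hvv : v' = v
    · simp [hvv]
    rcases (hmax₀' v' hv').eq_or_lt with h | h
    · filter_upwards [self_mem_nhdsWithin] with t ht _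
      rw [inner_add_right, inner_add_right, real_inner_smul_right, real_inner_smul_right, h, hvw]
      have h1 := lt_of_le_of_ne (hmax' v' hv' h) (he v' hv' v hv hvv)
      have h2 : (0 : ℝ) < t := ht
      linarith [mul_lt_mul_of_pos_left h1 h2]
    · refine Filter.Eventually.filter_mono nhdsWithin_le_nhds ?_
      have h1 : ContinuousAt (fun t : ℝ => ⟪v', w + t • e⟫) 0 := by fun_prop
      have h2 : ContinuousAt (fun t : ℝ => ⟪v, w + t • e⟫) 0 := by fun_prop
      have h3 := h1.eventually_lt h2 (by simpa [hvw] using h)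
      exact h3.mono fun t ht _ => ht
  obtain ⟨t, ht⟩ := hev.exists
  exact ⟨_, ht⟩

theorem face_subset_of_mem_strictNormalCone {K : Set (EuclideanSpace ℝ (Fin n))}
    (hc : Convex ℝ K) (hK : IsCompact K) {v x : EuclideanSpace ℝ (Fin n)}
    (hv : v ∈ K.extremePoints ℝ) (hx : x ∈ strictNormalCone (K.extremePoints ℝ) v) :
    face K x ⊆ {v} := by
  have h1 : (face K x).extremePoints ℝ ⊆ {v} := by
    intro y hy
    have hyK := (isExtreme_face hK x).extremePoints_subset_extremePoints hy
    by_contra hne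
    have h2 := hx y hyK hne
    rw [hy.1.2] at h2
    exact absurd (le_supportFn hK hv.1 x) (not_le.2 h2)
  rw [← closure_convexHull_extremePoints (isCompact_face hK x) (convex_face hc x)]
  refine (closure_mono (convexHull_mono h1)).trans ?_
  rw [convexHull_singleton, closure_singleton]

/-- Strong isomorphism speaks only of unit vectors; this extends it to all nonzero directions. -/
theorem face_smul {K : Set (EuclideanSpace ℝ (Fin n))} (hK : IsCompact K) (hne : K.Nonempty)
    {c : ℝ} (hc : 0 < c) (w : EuclideanSpace ℝ (Fin n)) : face K (c • w) = face K w := by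
  obtain ⟨x, hx, hxw⟩ := exists_eq_supportFn hK hne w
  have h1 : supportFn K (c • w) = c * supportFn K w := by
    rw [← hxw, ← real_inner_smul_right]
    refine supportFn_eq hK hx fun y hy => ?_
    rw [real_inner_smul_right, real_inner_smul_right, hxw]
    exact mul_le_mul_of_nonneg_left (le_supportFn hK hy w) hc.le
  ext y
  refine and_congr_right fun _ => ?_
  rw [h1, real_inner_smul_right, mul_right_inj' hc.ne']

/-- For strongly isomorphic polytopes, the support function of one is linear on the normal cones
of the vertices of the other. -/
theorem StronglyIsomorphic.exists_linear_supportFn {K L : Set (EuclideanSpace ℝ (Fin n))}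
    (hKL : StronglyIsomorphic K L) (hK : IsSymmConvexBody K) (hL : IsSymmConvexBody L)
    (hKP : IsPolytope K) (hLP : IsPolytope L) {w : EuclideanSpace ℝ (Fin n)} (hw : w ≠ 0) :
    ∃ v ∈ K, ∃ y : EuclideanSpace ℝ (Fin n), ⟪v, w⟫ = supportFn K w ∧
      ∀ x, ⟪v, x⟫ = supportFn K x → ⟪y, x⟫ = supportFn L x := by
  set V := K.extremePoints ℝ with hVdef
  set Y := L.extremePoints ℝ with hYdef
  have hV : V.Finite := hK.finite_extremePoints hKP
  have hY : Y.Finite := hL.finite_extremePoints hLP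
  obtain ⟨v₀, hv₀, hv₀w⟩ := exists_vertex_eq_supportFn hK.isCompact hK.nonempty w
  obtain ⟨v, hv, ⟨e, he⟩, hmax⟩ := exists_strictNormalCone_nonempty hV ⟨v₀, hv₀⟩ w
  set C := strictNormalCone V v with hC
  -- If `0` were in the cone, `v` would be the only vertex and `⟪v, ·⟫` would be positive at both
  -- `w` and `-w`.
  have hC0 : (0 : EuclideanSpace ℝ (Fin n)) ∉ C := by
    intro h0
    have hVv : ∀ v' ∈ V, v' = v := by
      intro v' hv'
      by_contra hne
      have := h0 v' hv' hne
      simp at this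
    have key : ∀ x, x ≠ 0 → 0 < ⟪v, x⟫ := by
      intro x hx
      obtain ⟨v', hv', hv'x⟩ := exists_vertex_eq_supportFn hK.isCompact hK.nonempty x
      rw [← hVv v' hv', hv'x]
      exact hK.supportFn_pos hx
    have h1 := key w hw
    have h2 := key (-w) (neg_ne_zero.2 hw)
    rw [inner_neg_right] at h2
    linarith
  -- In directions of `C` the face of `K` is a point. By strong isomorphism so is the face of `L`,
  -- which means that a single vertex of `L` is the strict maximizer.
  have hcover : ∀ x ∈ C, ∃ y ∈ Y, x ∈ strictNormalCone Y y := by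
    intro x hx
    have hx0 : x ≠ 0 := fun h => hC0 (h ▸ hx)
    have hnorm : 0 < ‖x‖⁻¹ := inv_pos.2 (norm_pos_iff.2 hx0)
    have hrank := hKL (‖x‖⁻¹ • x) (norm_smul_inv_norm (𝕜 := ℝ) hx0)
    rw [face_smul hK.isCompact hK.nonempty hnorm, face_smul hL.isCompact hL.nonempty hnorm] at hrank
    have hKface : (face K x).Subsingleton :=
      subsingleton_singleton.anti
        (face_subset_of_mem_strictNormalCone hK.convex hK.isCompact hv hx)
    rw [(vectorSpan_eq_bot_iff_subsingleton ℝ).2 hKface, finrank_bot] at hrank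
    have hLface : (face L x).Subsingleton :=
      (vectorSpan_eq_bot_iff_subsingleton ℝ).1 (Submodule.finrank_eq_zero.1 hrank.symm)
    obtain ⟨y, hy, hyx⟩ := exists_vertex_eq_supportFn hL.isCompact hL.nonempty x
    refine ⟨y, hy, fun y' hy' hne => ?_⟩
    refine lt_of_le_of_ne (by rw [hyx]; exact le_supportFn hL.isCompact hy'.1 x) fun heq => hne ?_
    exact hLface ⟨hy'.1, heq.trans hyx⟩ ⟨hy.1, hyx⟩
  obtain ⟨y, hy, hye⟩ := hcover e he
  -- The strict normal cones of `L` are open and disjoint, and `C` is convex, hence connected; so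
  -- one vertex `y` serves all of `C`.
  have hCy : C ⊆ strictNormalCone Y y := by
    refine IsPreconnected.subset_left_of_subset_union (isOpen_strictNormalCone hY y)
      (v := ⋃ y' ∈ Y \ {y}, strictNormalCone Y y')
      (isOpen_biUnion fun y' _ => isOpen_strictNormalCone hY y') ?_ ?_ ⟨e, he, hye⟩
      (convex_strictNormalCone V v).isPreconnected
    · rw [Set.disjoint_left]
      intro x hx hx'
      simp only [mem_iUnion] at hx'
      obtain ⟨y', ⟨hy', hne⟩, hxy'⟩ := hx'
      exact lt_asymm (hx y' hy' hne) (hxy' y hy (Ne.symm hne))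
    · intro x hx
      obtain ⟨y', hy', hxy'⟩ := hcover x hx
      by_cases h : y' = y
      · exact Or.inl (h ▸ hxy')
      · exact Or.inr (mem_biUnion (x := y') ⟨hy', h⟩ hxy')
  refine ⟨v, hv.1, y, ?_, fun x hx => ?_⟩
  · refine le_antisymm (le_supportFn hK.isCompact hv.1 w) ?_
    rw [← hv₀w]
    exact hmax v₀ hv₀
  · obtain ⟨y', hy', hy'x⟩ := exists_vertex_eq_supportFn hL.isCompact hL.nonempty x
    refine le_antisymm (le_supportFn hL.isCompact hy.1 x) ?_
    rw [← hy'x]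
    rcases eq_or_ne y' y with rfl | hne
    · exact le_rfl
    -- A point `x` of the closed normal cone is approached from inside by `x + t e ∈ C`, and `t → 0`
    -- gives the inequality at `x`.
    have hpos : ∀ t : ℝ, 0 < t → ⟪y', x + t • e⟫ ≤ ⟪y, x + t • e⟫ := by
      intro t ht
      refine (hCy (?_ : x + t • e ∈ C) y' hy' hne).le
      intro v' hv' hne'
      rw [inner_add_right, inner_add_right, real_inner_smul_right, real_inner_smul_right, hx]
      exact add_lt_add_of_le_of_lt (le_supportFn hK.isCompact hv'.1 x)
        (mul_lt_mul_of_pos_left (he v' hv' hne') ht)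
    have h1 : ContinuousAt (fun t : ℝ => ⟪y', x + t • e⟫) 0 := by fun_prop
    have h2 : ContinuousAt (fun t : ℝ => ⟪y, x + t • e⟫) 0 := by fun_prop
    have h3 := le_of_tendsto_of_tendsto (h1.tendsto.mono_left (nhdsWithin_le_nhds (s := Ioi 0)))
      (h2.tendsto.mono_left nhdsWithin_le_nhds)
      (by filter_upwards [self_mem_nhdsWithin] with t ht using hpos t ht)
    simpa using h3

/-! ### The `L^p`-combination as an intersection of slabs -/

/-- Vectors in the polar body of an intersection of slabs are combinations of the normals. -/
theorem exists_combination_of_supportFn_le {ι : Type} [Fintype ι]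
    {u : ι → EuclideanSpace ℝ (Fin n)} (hu : IsFrame u) {k : ι → ℝ} (hk : ∀ i, 0 < k i)
    {w : EuclideanSpace ℝ (Fin n)} (hw : supportFn (slab u k) w ≤ 1) :
    ∃ d : ι → ℝ, w = ∑ i, d i • u i ∧ ∑ i, |d i| * k i ≤ 1 := by
  classical
  set D : Set (ι → ℝ) := {d | ∑ i, |d i| * k i ≤ 1} with hD
  let Φ : (ι → ℝ) →ₗ[ℝ] EuclideanSpace ℝ (Fin n) :=
    ∑ i, (LinearMap.proj i : (ι → ℝ) →ₗ[ℝ] ℝ).smulRight (u i)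
  have hΦ : ∀ d, Φ d = ∑ i, d i • u i := fun d => by simp [Φ]
  have hDconv : Convex ℝ D := by
    intro x hx y hy a b ha hb hab
    calc ∑ i, |(a • x + b • y) i| * k i ≤ ∑ i, (a * (|x i| * k i) + b * (|y i| * k i)) := by
          refine Finset.sum_le_sum fun i _ => ?_
          rw [← mul_assoc, ← mul_assoc, ← add_mul]
          refine mul_le_mul_of_nonneg_right ?_ (hk i).le
          refine (abs_add_le _ _).trans_eq ?_
          simp [abs_mul, abs_of_nonneg ha, abs_of_nonneg hb]
      _ = a * ∑ i, |x i| * k i + b * ∑ i, |y i| * k i := by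
          rw [Finset.sum_add_distrib, Finset.mul_sum, Finset.mul_sum]
      _ ≤ a * 1 + b * 1 := by
          gcongr
          exacts [hx, hy]
      _ = 1 := by rw [mul_one, mul_one, hab]
  have hDcomp : IsCompact D := by
    refine Metric.isCompact_of_isClosed_isBounded
      (isClosed_le (by fun_prop) continuous_const) ?_
    refine (isBounded_iff_forall_norm_le.2 ⟨∑ i, 1 / k i, fun d hd => ?_⟩)
    have hsum : 0 ≤ ∑ i, 1 / k i := Finset.sum_nonneg fun i _ => (one_div_pos.2 (hk i)).le
    rw [pi_norm_le_iff_of_nonneg hsum]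
    intro i
    have h1 : |d i| * k i ≤ 1 := (Finset.single_le_sum (f := fun i => |d i| * k i)
      (fun i _ => mul_nonneg (abs_nonneg _) (hk i).le) (Finset.mem_univ i)).trans hd
    have h2 : 1 / k i ≤ ∑ i, 1 / k i := Finset.single_le_sum (f := fun i => 1 / k i)
      (fun i _ => (one_div_pos.2 (hk i)).le) (Finset.mem_univ i)
    exact ((le_div_iff₀ (hk i)).2 h1).trans h2
  have hΦc : Continuous Φ := (LinearMap.toContinuousLinearMap Φ).continuous
  by_contra hno
  push Not at hno
  have hwD : w ∉ Φ '' D := by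
    rintro ⟨d, hd, hdw⟩
    exact absurd hd (not_le.2 (hno d (by rw [← hdw, hΦ])))
  -- A functional separating `w` from the convex hull of the `±(k i)⁻¹ • u i` is, after scaling by
  -- `s⁻¹`, a point of the slab intersection at which `w` exceeds `1`.
  obtain ⟨f, s, hfs, hsw⟩ := geometric_hahn_banach_closed_point (hDconv.linear_image Φ)
    (hDcomp.image hΦc).isClosed hwD
  have hs : 0 < s := by
    have := hfs (Φ 0) ⟨0, by simp [hD], rfl⟩
    simpa using this
  obtain ⟨x, hx⟩ : ∃ x : EuclideanSpace ℝ (Fin n), ∀ y, f y = ⟪x, y⟫ :=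
    ⟨(InnerProductSpace.toDual ℝ _).symm f, fun y => by simp⟩
  have hmem : s⁻¹ • x ∈ slab u k := by
    intro i
    have key : ∀ c : ℝ, |c| = 1 → c * ⟪x, u i⟫ ≤ s * k i := by
      intro c hc
      have h1 := hfs (Φ (Pi.single i (c / k i))) ⟨_, ?_, rfl⟩
      · rw [hΦ, Finset.sum_eq_single i (fun j _ hj => by simp [hj]) (by simp), Pi.single_eq_same,
          map_smul, hx, smul_eq_mul, div_mul_eq_mul_div, div_lt_iff₀ (hk i)] at h1
        exact h1.le
      · simp only [hD, mem_ofPred_eq]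
        rw [Finset.sum_eq_single i (fun j _ hj => by simp [hj]) (by simp), Pi.single_eq_same,
          abs_div, hc, abs_of_pos (hk i), div_mul_cancel₀ _ (hk i).ne']
    rw [real_inner_smul_left, abs_mul, abs_of_pos (inv_pos.2 hs), inv_mul_le_iff₀ hs]
    refine abs_le'.2 ⟨by simpa using key 1 (by simp), by simpa using key (-1) (by simp)⟩
  have h1 := (le_supportFn (hu.isCompact_slab k) hmem w).trans hw
  rw [real_inner_smul_left, inv_mul_le_iff₀ hs, mul_one, ← hx] at h1
  linarith

/-- Every vector is a combination of the normals which is compatible with both support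
functions. -/
theorem StronglyIsomorphic.exists_combination {K L : Set (EuclideanSpace ℝ (Fin n))}
    (hKL : StronglyIsomorphic K L) (hK : IsSymmConvexBody K) (hL : IsSymmConvexBody L)
    (hKP : IsPolytope K) (hLP : IsPolytope L) {ι : Type} [Fintype ι]
    {u : ι → EuclideanSpace ℝ (Fin n)} (hu : IsFrame u)
    (hKu : K = slab u fun i => supportFn K (u i)) {w : EuclideanSpace ℝ (Fin n)} (hw : w ≠ 0) :
    ∃ d : ι → ℝ, w = ∑ i, d i • u i ∧ supportFn K w = ∑ i, |d i| * supportFn K (u i) ∧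
      supportFn L w = ∑ i, |d i| * supportFn L (u i) := by
  have hu0 : ∀ i, u i ≠ 0 := fun i => by
    rw [← norm_ne_zero_iff, hu.norm_eq]
    exact one_ne_zero
  have hk : ∀ i, 0 < supportFn K (u i) := fun i => hK.supportFn_pos (hu0 i)
  obtain ⟨v, hv, y, hvw, hlin⟩ := hKL.exists_linear_supportFn hK hL hKP hLP hw
  set H := supportFn K w with hH
  have hHpos : 0 < H := hK.supportFn_pos hw
  have h1 : supportFn (slab u fun i => supportFn K (u i)) (H⁻¹ • w) ≤ 1 := by
    rw [← hKu]
    refine supportFn_le hK.nonempty fun z hz => ?_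
    rw [real_inner_smul_right, inv_mul_le_iff₀ hHpos, mul_one]
    exact le_supportFn hK.isCompact hz w
  obtain ⟨d, hd, hsum⟩ := exists_combination_of_supportFn_le hu hk h1
  have hw' : w = ∑ i, (H * d i) • u i := by
    simp_rw [mul_smul]
    rw [← Finset.smul_sum, ← hd, smul_inv_smul₀ hHpos.ne']
  have hterm : ∀ i, (H * d i) * ⟪v, u i⟫ ≤ |H * d i| * supportFn K (u i) := by
    intro i
    refine (le_abs_self _).trans ?_
    rw [abs_mul]
    refine mul_le_mul_of_nonneg_left ?_ (abs_nonneg _)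
    rw [hKu] at hv
    exact hv i
  have hvsum : H = ∑ i, (H * d i) * ⟪v, u i⟫ := by
    conv_lhs => rw [← hvw, hw', inner_sum]
    simp_rw [real_inner_smul_right]
  have hle : ∑ i, |H * d i| * supportFn K (u i) ≤ H := by
    simp_rw [abs_mul, abs_of_pos hHpos, mul_assoc]
    rw [← Finset.mul_sum]
    exact mul_le_of_le_one_right hHpos.le hsum
  have heq : ∑ i, (H * d i) * ⟪v, u i⟫ = ∑ i, |H * d i| * supportFn K (u i) :=
    le_antisymm (Finset.sum_le_sum fun i _ => hterm i) (hle.trans_eq hvsum)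
  -- Equality term by term: whenever `d i ≠ 0`, the vector `±u i` with the sign of `d i` lies in the
  -- closed normal cone of `v`, where `h_L` is given by the same point `y`.
  have heach := (Finset.sum_eq_sum_iff_of_le fun i _ => hterm i).1 heq
  refine ⟨fun i => H * d i, hw', hvsum.trans heq, ?_⟩
  rw [← hlin w hvw]
  conv_lhs => rw [hw', inner_sum]
  refine Finset.sum_congr rfl fun i hi => ?_
  have h2 := heach i hi
  rw [real_inner_smul_right]
  rcases lt_trichotomy (H * d i) 0 with h | h | h
  · rw [abs_of_neg h] at h2 ⊢
    have h3 : ⟪v, -u i⟫ = supportFn K (-u i) := by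
      rw [hK.supportFn_neg, inner_neg_right]
      have h0 : (H * d i) * (⟪v, u i⟫ + supportFn K (u i)) = 0 := by linarith
      have := (mul_eq_zero.1 h0).resolve_left h.ne
      linarith
    have h4 := hlin _ h3
    rw [hL.supportFn_neg, inner_neg_right] at h4
    rw [← h4]
    ring
  · simp [h]
  · rw [abs_of_pos h] at h2 ⊢
    rw [hlin _ (mul_left_cancel₀ h.ne' h2)]

/-- The power mean lies below its tangent planes. -/
theorem exists_lpMean_le_linear {p t A B : ℝ} (hp0 : 0 ≤ p) (hp1 : p < 1)
    (ht : t ∈ Icc (0 : ℝ) 1) (hA : 0 < A) (hB : 0 < B) :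
    ∃ α β : ℝ, α * A + β * B = lpMean p t A B ∧
      ∀ a b : ℝ, 0 < a → 0 < b → lpMean p t a b ≤ α * a + β * b := by
  have ht1 : 0 ≤ 1 - t := by linarith [ht.2]
  rcases hp0.eq_or_lt with rfl | hp
  · set M := lpMean 0 t A B with hM
    -- The coefficients are the gradient of the mean at `(A, B)`; the bound is the weighted AM-GM
    -- inequality for `a / A` and `b / B`.
    refine ⟨(1 - t) * M / A, t * M / B, ?_, fun a b ha hb => ?_⟩
    · field_simp
      ring
    · have h1 := Real.geom_mean_le_arith_mean2_weighted ht1 ht.1 (div_pos ha hA).le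
        (div_pos hb hB).le (by ring)
      rw [Real.div_rpow ha.le hA.le, Real.div_rpow hb.le hB.le] at h1
      have h2 : lpMean 0 t a b =
          M * (a ^ (1 - t) / A ^ (1 - t) * (b ^ t / B ^ t)) := by
        have := (Real.rpow_pos_of_pos hA (1 - t)).ne'
        have := (Real.rpow_pos_of_pos hB t).ne'
        simp only [hM, lpMean, if_true]
        field_simp
      rw [h2]
      have hM0 : 0 ≤ M := (lpMean_pos 0 ht hA hB).le
      refine (mul_le_mul_of_nonneg_left h1 hM0).trans_eq ?_
      field_simp
  · set S := (1 - t) * A ^ p + t * B ^ p with hS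
    have hSpos : 0 < S := lpBase_pos p ht hA hB
    have hAp := Real.rpow_pos_of_pos hA p
    have hBp := Real.rpow_pos_of_pos hB p
    set M := lpMean p t A B with hM
    have hMS : M = S ^ (1 / p) := by rw [hM, lpMean, if_neg hp.ne']
    set σ := (1 - t) * A ^ p / S with hσ
    set τ := t * B ^ p / S with hτ
    have hσ0 : 0 ≤ σ := div_nonneg (mul_nonneg ht1 hAp.le) hSpos.le
    have hτ0 : 0 ≤ τ := div_nonneg (mul_nonneg ht.1 hBp.le) hSpos.le
    have hστ : σ + τ = 1 := by rw [hσ, hτ, ← add_div, ← hS, div_self hSpos.ne']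
    refine ⟨M * σ / A, M * τ / B, ?_, fun a b ha hb => ?_⟩
    · rw [div_mul_cancel₀ _ hA.ne', div_mul_cancel₀ _ hB.ne', ← mul_add, hστ, mul_one]
    · have hx := (div_pos ha hA).le
      have hy := (div_pos hb hB).le
      -- For `p > 0` the tangent bound is Jensen's inequality for `x ↦ x ^ (1 / p)`, with `σ`, `τ`
      -- the shares of the two summands of `S`.
      have h1 := (convexOn_rpow ((one_le_div hp).2 hp1.le)).2 (Real.rpow_nonneg hx p)
        (Real.rpow_nonneg hy p) hσ0 hτ0 hστ
      simp only [smul_eq_mul] at h1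
      rw [← Real.rpow_mul hx, ← Real.rpow_mul hy, mul_one_div_cancel hp.ne', Real.rpow_one,
        Real.rpow_one] at h1
      have h2 : (1 - t) * a ^ p + t * b ^ p = S * (σ * (a / A) ^ p + τ * (b / B) ^ p) := by
        rw [Real.div_rpow ha.le hA.le, Real.div_rpow hb.le hB.le, hσ, hτ]
        field_simp
      rw [lpMean, if_neg hp.ne', h2, Real.mul_rpow hSpos.le (by positivity), ← hMS]
      have hM0 : 0 ≤ M := (lpMean_pos p ht hA hB).le
      refine (mul_le_mul_of_nonneg_left h1 hM0).trans_eq ?_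
      ring

/-- The `L^p`-combination of strongly isomorphic symmetric polytopes is determined by the facet
normals. -/
theorem StronglyIsomorphic.lpComb_eq_slab {K L : Set (EuclideanSpace ℝ (Fin n))}
    (hKL : StronglyIsomorphic K L) (hK : IsSymmConvexBody K) (hL : IsSymmConvexBody L)
    (hKP : IsPolytope K) (hLP : IsPolytope L) {ι : Type} [Fintype ι]
    {u : ι → EuclideanSpace ℝ (Fin n)} (hu : IsFrame u)
    (hKu : K = slab u fun i => supportFn K (u i)) {p t : ℝ} (hp0 : 0 ≤ p) (hp1 : p < 1)
    (ht : t ∈ Icc (0 : ℝ) 1) :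
    lpComb p t K L = slab u fun i => lpMean p t (supportFn K (u i)) (supportFn L (u i)) := by
  have hu0 : ∀ i, u i ≠ 0 := fun i => by
    rw [← norm_ne_zero_iff, hu.norm_eq]
    exact one_ne_zero
  apply Subset.antisymm
  · intro x hx i
    refine abs_le'.2 ⟨hx (u i) (hu.norm_eq i), ?_⟩
    have := hx (-u i) (by rw [norm_neg, hu.norm_eq])
    dsimp only at this
    rwa [inner_neg_right, hK.supportFn_neg, hL.supportFn_neg] at this
  -- Linearizing the mean at `(h_K w, h_L w)` lets the sums over `d` be reassembled into `h_K w` and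
  -- `h_L w`, where the tangent plane touches.
  · intro x hx w hw
    have hw0 : w ≠ 0 := by
      rw [← norm_ne_zero_iff, hw]
      exact one_ne_zero
    obtain ⟨d, hd, hdK, hdL⟩ := hKL.exists_combination hK hL hKP hLP hu hKu hw0
    obtain ⟨α, β, htan, hle⟩ := exists_lpMean_le_linear hp0 hp1 ht (hK.supportFn_pos hw0)
      (hL.supportFn_pos hw0)
    calc ⟪x, w⟫ = ∑ i, d i * ⟪x, u i⟫ := by
          conv_lhs => rw [hd, inner_sum]
          simp_rw [real_inner_smul_right]
      _ ≤ ∑ i, |d i| * (α * supportFn K (u i) + β * supportFn L (u i)) := by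
          refine Finset.sum_le_sum fun i _ => (le_abs_self _).trans ?_
          rw [abs_mul]
          exact mul_le_mul_of_nonneg_left ((hx i).trans
            (hle _ _ (hK.supportFn_pos (hu0 i)) (hL.supportFn_pos (hu0 i)))) (abs_nonneg _)
      _ = α * ∑ i, |d i| * supportFn K (u i) + β * ∑ i, |d i| * supportFn L (u i) := by
          rw [Finset.mul_sum, Finset.mul_sum, ← Finset.sum_add_distrib]
          exact Finset.sum_congr rfl fun i _ => by ring
      _ = lpMean p t (supportFn K w) (supportFn L w) := by rw [← hdK, ← hdL, htan]

end

end LpBrunnMinkowski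

end

/-! ### Assembly: reduction to slab volumes along power mean curves. -/

theorem proposition3p4 (n : ℕ) (hn : 1 ≤ n) (p : ℝ) (hp0 : 0 ≤ p) (hp1 : p < 1)
    (hloc : LpBrunnMinkowski.LocalLpBrunnMinkowski n p)
    (K L : Set (EuclideanSpace ℝ (Fin n)))
    (hK : LpBrunnMinkowski.IsSymmConvexBody K) (hL : LpBrunnMinkowski.IsSymmConvexBody L)
    (hKP : LpBrunnMinkowski.IsPolytope K) (hLP : LpBrunnMinkowski.IsPolytope L)
    (hKL : LpBrunnMinkowski.StronglyIsomorphic K L) :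
    LpBrunnMinkowski.PowerConcaveOn (p / (n : ℝ)) (Set.Icc (0 : ℝ) 1)
      (fun t => MeasureTheory.volume.real (LpBrunnMinkowski.lpComb p t K L)) := by
  obtain ⟨A, hu, hKu⟩ := hK.exists_frame hKP
  have hu0 : ∀ i : A, (i : EuclideanSpace ℝ (Fin n)) ≠ 0 := fun i => by
    rw [← norm_ne_zero_iff, hu.norm_eq i]
    exact one_ne_zero
  have hcomb := fun t (ht : t ∈ Set.Icc (0 : ℝ) 1) =>
    hKL.lpComb_eq_slab hK hL hKP hLP hu hKu hp0 hp1 ht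
  have hconc := hu.concaveOn_slabVolume hn hp0 hp1 hloc
    (fun i => hK.supportFn_pos (hu0 i)) fun i => hL.supportFn_pos (hu0 i)
  refine ⟨fun t ht => ?_, hconc.congr fun t ht => ?_⟩
  · dsimp only
    rw [hcomb t ht]
    exact hu.slabVolume_pos fun i =>
      LpBrunnMinkowski.lpMean_pos p ht (hK.supportFn_pos (hu0 i)) (hL.supportFn_pos (hu0 i))
  · dsimp only
    rw [hcomb t ht]
    rfl
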